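/- **Setting.** A *label* is a point of $\mathbb Z^3_{1/2}=\{(x,y,z)\in(\tfrac12\mathbb Z)^3: x+y+z\in\mathbb Z\}$, i.e. a lattice point or the center of a unit lattice square; its level is $x+y+z$. Let $U_0$ be the closed negative orthant, viewed as a union of unit lattice cubes, and let $\mathcal L$ be the set of all downwardly closed unions of lattice cubes $U\subseteq U_0$ that contain all but finitely many cubes of $U_0$. For $n\ge 0$, $U_{-n}\in\mathcal L$ consists of the cubes of $U_0$ contained in $\{x+y+z\le -n\}$. *The graph $\Gamma(U)$.* The boundary $\partial U$ is a union of lattice squares. $\Gamma(U)$ has one vertex for each pair $(Q,a)$ of a square $Q\subset\partial U$ and a side $a$ of $Q$; $(Q,a)$ and $(Q,a')$ are joined if $a\ne a'$ share a corner (the edge faces this corner), and $(Q,a)$ and $(Q',a)$ are joined if $Q\neq Q'$ (a *leg*). Its faces are a quadrilateral for each square $Q$, labelled by the center of $Q$, and for each lattice point $v\in\partial U$ a face labelled $v$, bounded by the edges facing $v$ and the legs crossing lattice edges that end in $v$. Let $\mathcal I(U)$ be the set of all these labels. *Taut configurations.* A double-dimer configuration $m$ is a union, with multiplicities, of two perfect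 matchings; it consists of doubled edges, loops, and bi-infinite paths. The configuration $m_0$ on $\Gamma(U_0)$ has one dimer on each leg, and one on each quadrilateral edge unless that edge faces the corner of its square nearest to or farthest from the origin, in which case it has none. A double-dimer configuration $m$ on $\Gamma(U)$ is *taut*, written $m\preceq U$, if outside some finite set it is identical to $m_0$ and there is a bijection between its bi-infinite paths and those of $m_0$ under which corresponding paths agree outside this set. Let $c(m)$ be the number of (nontrivial) loops of $m$, and for $\ell\in\mathcal I(U)$ let $c(m;\ell)=L(\ell)-2-d(m;\ell)$, where $L(\ell)$ is the number of edges of the face labelled $\ell$ and $d(m;\ell)$ is the number of dimers of $m$ along it, counted with multiplicity. *The recurrence.* A function $A$ on labels satisfies the hexahedron recurrence at the cube with lowest corner $v$ if, writing $h=A(v)$, $h_1=A(v+e_1)$, $h_{12}=A(v+e_1+e_2)$ etc., $h^{(x)},h^{(y)},h^{(z)}$ for the values of $A$ at $v+\tfrac12(e_2+e_3)$, $v+\tfrac12(e_1+e_3)$, $v+\tfrac12(e_1+e_2)$, and $h^{(x)}_{1},h^{(y)}_{2},h^{(z)}_{3}$ for its values at these points translated by $e_1,e_2,e_3$ respectively,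 $$h^{(x)}_{1}h^{(x)}h=h^{(x)}h^{(y)}h^{(z)}+h_1h_2h_3+hh_1h_{23},$$ $$h^{(y)}_{2}h^{(y)}h=h^{(x)}h^{(y)}h^{(z)}+h_1h_2h_3+hh_2h_{13},$$ $$h^{(z)}_{3}h^{(z)}h=h^{(x)}h^{(y)}h^{(z)}+h_1h_2h_3+hh_3h_{12},$$ $$\begin{aligned}h_{123}h^2h^{(x)}h^{(y)}h^{(z)}={}&(h^{(x)}h^{(y)}h^{(z)})^2+h^{(x)}h^{(y)}h^{(z)}(2h_1h_2h_3+hh_1h_{23}+hh_2h_{13}+hh_3h_{12})\\&+(h_1h_2+hh_{12})(h_1h_3+hh_{13})(h_2h_3+hh_{23}).\end{aligned}$$ Let $K$ be a field of characteristic $0$. For $U\in\mathcal L$, let the $A(\ell)$, $\ell\in\mathcal I(U)$, be independent variables over $K$, and represent the values of $A$ at the remaining labels of the cubes of $U_0\setminus U$ as rational functions in these variables by means of the recurrence at all cubes of $U_0\setminus U$. **Theorem.** Let $U\in\mathcal L$. The representation exists. There are finitely many taut configurations $m$ on $\Gamma(U)$; each has finitely many loops and $c(m;\ell)\ne0$ for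 only finitely many $\ell\in\mathcal I(U)$. The value $A(0,0,0)$ is the Laurent polynomial in the variables in $\mathcal I(U)$ given by $$A(0,0,0)=\sum_{m\preceq U}2^{c(m)}\prod_{\ell\in\mathcal I(U)}A(\ell)^{c(m;\ell)}.$$ In particular, if $A$ takes values in $K$, equals $1$ on $\mathcal I(U)$, and satisfies the recurrence at all cubes of $U_0\setminus U$, then $A(0,0,0)=\sum_{m\preceq U}2^{c(m)}$. For $U=U_{-n}$, $n\ge0$, this holds already if $A=1$ on the labels in $\mathcal I(U_{-n})$ of levels $-n-2,\,-n-1,\,-n$. -/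

import Mathlib

noncomputable section

namespace Hexahedron

/-! ### Lattice cells -/

/-- Points of the lattice `ℤ³`. A lattice point `u` also names the unit cube
`[u₀, u₀+1] × [u₁, u₁+1] × [u₂, u₂+1]` whose lowest corner it is. -/
abbrev Vec := Fin 3 → ℤ

/-- The standard basis vector `e_i`. -/
def e (i : Fin 3) : Vec := Pi.single i 1

/-- The unit lattice square orthogonal to `e normal`, with lowest corner `base`; its vertices
are `base`, `base + e_i`, `base + e_j`, `base + e_i + e_j`, where `{i, j, normal} = {0, 1, 2}`. -/
@[ext] structure Square where
  normal : Fin 3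
  base : Vec

/-- The four vertices of a lattice square. -/
def Square.corners (Q : Square) : Set Vec :=
  {w | w Q.normal = Q.base Q.normal ∧
    ∀ i, i ≠ Q.normal → w i = Q.base i ∨ w i = Q.base i + 1}

/-- The corner of a lattice square opposite to its lowest corner. -/
def Square.top (Q : Square) : Vec := fun i => if i = Q.normal then Q.base i else Q.base i + 1

/-- The lattice edge from `base` to `base + e dir`. -/
@[ext] structure LEdge where
  dir : Fin 3
  base : Vec

/-- The two endpoints of a lattice edge. -/
def LEdge.ends (a : LEdge) : Set Vec := {a.base, a.base + e a.dir}

/-- `a` is one of the four sides of `Q`. -/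
def LEdge.IsSide (a : LEdge) (Q : Square) : Prop := a.ends ⊆ Q.corners

/-- The labels, i.e. the elements of `{(x,y,z) ∈ (½ℤ)³ : x + y + z ∈ ℤ}`: such a point is either
a lattice point (`vertex v`) or has exactly two coordinates that are not integers, and is then
the center of a unique lattice square (`face Q`). -/
inductive Label where
  | vertex (v : Vec)
  | face (Q : Square)

/-- The level `x + y + z` of a label `(x, y, z)`; the center of a square with lowest corner `v`
is `v + (e_i + e_j) / 2`, so that its level exceeds the one of `v` by one. -/
def Label.level : Label → ℤ
  | .vertex v => ∑ i, v i
  | .face Q => ∑ i, Q.base i + 1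

/-! ### Stepped solids -/

/-- The closed negative orthant, as a set of cubes. -/
def orthant : Set Vec := {u | ∀ i, u i < 0}

/-- The stepped solids obtained from the negative orthant by removing finitely many cubes.
A solid is given by the set of its cubes. -/
structure IsSolid (U : Set Vec) : Prop where
  lower : IsLowerSet U
  subset : U ⊆ orthant
  cofinite : (orthant \ U).Finite

/-- The cubes of the negative orthant that lie entirely in the half-space `x + y + z ≤ -n`. -/
def cornerSolid (n : ℕ) : Set Vec := {u | u ∈ orthant ∧ ∑ i, (u i + 1) ≤ -(n : ℤ)}

/-- The lattice squares that make up the stepped surface, i.e. the topological boundary of `U`: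
those that separate a cube of `U` from a cube not in `U`. Since `U` is downwardly closed, the
cube of `U` is the lower one. -/
def surface (U : Set Vec) : Set Square := {Q | Q.base - e Q.normal ∈ U ∧ Q.base ∉ U}

/-- The labels of the faces of `Γ(U)`: the vertices and the square centers of the
stepped surface. -/
def labels (U : Set Vec) : Set Label :=
  {l | match l with
    | .vertex v => ∃ Q ∈ surface U, v ∈ Q.corners
    | .face Q => Q ∈ surface U}

/-! ### The graph `Γ(U)` -/

/-- The vertices of `Γ(U)`: the dual graph of the 1-skeleton of the surface has a vertex for each
square `Q` and an edge crossing each lattice edge `a`; replacing each of its vertices by a small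
quadrilateral gives one node `(Q, a)` near the middle of each side `a` of each square `Q`. -/
abbrev Node := Square × LEdge

/-- The vertex set of `Γ(U)`. -/
def nodes (U : Set Vec) : Set Node := {x | x.1 ∈ surface U ∧ x.2.IsSide x.1}

/-- The graph `Γ(U)`, as a graph on the type `Node` (nodes not in `nodes U` are isolated and do
not count). Two distinct nodes are adjacent if they lie in the same square, on two sides which
meet in a corner (an edge of the small quadrilateral), or if they lie on the same lattice edge,
in two squares (the edge of the dual graph that crosses this lattice edge; a leg). -/
def graph (U : Set Vec) : SimpleGraph Node where
  Adj x y := x ∈ nodes U ∧ y ∈ nodes U ∧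
    ((x.1 = y.1 ∧ x.2 ≠ y.2 ∧ (x.2.ends ∩ y.2.ends).Nonempty) ∨ (x.2 = y.2 ∧ x.1 ≠ y.1))
  symm := ⟨by
    rintro x y ⟨hx, hy, h⟩
    refine ⟨hy, hx, ?_⟩
    rcases h with ⟨h1, h2, h3⟩ | ⟨h1, h2⟩
    · exact Or.inl ⟨h1.symm, h2.symm, by rwa [Set.inter_comm]⟩
    · exact Or.inr ⟨h1.symm, h2.symm⟩⟩
  loopless := ⟨by
    rintro x ⟨_, _, ⟨_, h, _⟩ | ⟨_, h⟩⟩ <;> exact h rfl⟩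

/-- The edges of `Γ(U)` on the boundary of the face with the given label. The face at a square `Q`
is bounded by the four quadrilateral edges in `Q`. The face at a lattice point `v` is bounded by
the quadrilateral edges between two sides that meet in `v` and the legs crossing a lattice edge
with endpoint `v`. -/
def faceEdges (U : Set Vec) : Label → Set (Sym2 Node)
  | .vertex v => {E | E ∈ (graph U).edgeSet ∧ ∀ x ∈ E, v ∈ x.2.ends}
  | .face Q => {E | E ∈ (graph U).edgeSet ∧ ∀ x ∈ E, x.1 = Q}

/-! ### Double-dimer configurations -/

/-- A dimer cover (perfect matching) of `Γ(U)`. -/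
def IsDimerCover (U : Set Vec) (M : Set (Sym2 Node)) : Prop :=
  M ⊆ (graph U).edgeSet ∧ ∀ x ∈ nodes U, ∃! E, E ∈ M ∧ x ∈ E

/-- A double-dimer configuration of `Γ(U)`: the union, with multiplicities, of two dimer covers.
It is recorded by the number `m E ∈ {0, 1, 2}` of dimers on each edge `E`. -/
def IsDoubleDimer (U : Set Vec) (m : Sym2 Node → ℕ) : Prop :=
  ∃ M₁ M₂ : Set (Sym2 Node), IsDimerCover U M₁ ∧ IsDimerCover U M₂ ∧
    m = M₁.indicator 1 + M₂.indicator 1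

/-- The initial configuration `m₀` on the cubic corner graph `Γ(U₀)`: each leg has one dimer, and
so has each quadrilateral edge, except for those facing the corner of their square nearest to, or
farthest from, the origin, which have none. -/
def initialConfig : Sym2 Node → ℕ :=
  Set.indicator
    {E | E ∈ (graph orthant).edgeSet ∧
      ∀ Q : Square, E ∈ faceEdges orthant (.face Q) →
        E ∉ faceEdges orthant (.vertex Q.base) ∧ E ∉ faceEdges orthant (.vertex Q.top)} 1

/-- The graph formed by the edges with exactly one dimer. In a double-dimer configuration each
node has degree `0` (it is then on a doubled edge) or `2` in this graph, whose connected
components are hence isolated nodes, loops, and bi-infinite paths. -/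
def singleGraph (m : Sym2 Node → ℕ) : SimpleGraph Node where
  Adj x y := x ≠ y ∧ m s(x, y) = 1
  symm := ⟨fun x y h => ⟨h.1.symm, by rw [Sym2.eq_swap]; exact h.2⟩⟩
  loopless := ⟨fun _ h => h.1 rfl⟩

/-- The (nontrivial) loops of `m`: the finite components with more than one node. -/
def loops (m : Sym2 Node → ℕ) : Set (singleGraph m).ConnectedComponent :=
  {C | C.supp.Finite ∧ C.supp.Nontrivial}

/-- The bi-infinite paths of `m`: the infinite components. -/
def infinitePaths (m : Sym2 Node → ℕ) : Set (singleGraph m).ConnectedComponent :=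
  {C | C.supp.Infinite}

/-- The number `c(m)` of loops. -/
def loopCount (m : Sym2 Node → ℕ) : ℕ := (loops m).ncard

/-- Taut configurations of `Γ(U)`: the double-dimer configurations that agree with `m₀` outside
a finite set of nodes, and whose bi-infinite paths are in bijection with those of `m₀`, a path
and its image being identical outside this finite set. -/
def IsTaut (U : Set Vec) (m : Sym2 Node → ℕ) : Prop :=
  IsDoubleDimer U m ∧ ∃ S : Set Node, S.Finite ∧
    (∀ E : Sym2 Node, (∃ x ∈ E, x ∉ S) → m E = initialConfig E) ∧
    ∃ φ : infinitePaths m ≃ infinitePaths initialConfig,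
      ∀ C : infinitePaths m, C.1.supp \ S = (φ C).1.supp \ S

/-- The taut configurations of `Γ(U)`. -/
def tautConfigs (U : Set Vec) : Set (Sym2 Node → ℕ) := {m | IsTaut U m}

/-- The exponent `c(m; i,j,k)`: the number of edges of the face, minus two, minus the number of
dimers along the face (those on a doubled edge count twice). -/
def faceExponent (U : Set Vec) (m : Sym2 Node → ℕ) (l : Label) : ℤ :=
  ((faceEdges U l).ncard : ℤ) - 2 - ∑ᶠ E ∈ faceEdges U l, (m E : ℤ)

/-! ### The hexahedron recurrence -/

/-- The four equations of the hexahedron recurrence for the cube with lowest corner `v`, where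
`h` is the restriction of `A` to lattice points and `hx`, `hy`, `hz` are its values at the centers
of the squares with lowest corner `v` orthogonal to the three coordinate axes. -/
def HexahedronAt {K : Type*} [Field K] (A : Label → K) (v : Vec) : Prop :=
  let h := A (.vertex v)
  let h1 := A (.vertex (v + e 0))
  let h2 := A (.vertex (v + e 1))
  let h3 := A (.vertex (v + e 2))
  let h12 := A (.vertex (v + e 0 + e 1))
  let h13 := A (.vertex (v + e 0 + e 2))
  let h23 := A (.vertex (v + e 1 + e 2))
  let h123 := A (.vertex (v + e 0 + e 1 + e 2))
  let hx := A (.face ⟨0, v⟩)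
  let hy := A (.face ⟨1, v⟩)
  let hz := A (.face ⟨2, v⟩)
  let hx1 := A (.face ⟨0, v + e 0⟩)
  let hy2 := A (.face ⟨1, v + e 1⟩)
  let hz3 := A (.face ⟨2, v + e 2⟩)
  hx1 * hx * h = hx * hy * hz + h1 * h2 * h3 + h * h1 * h23 ∧
  hy2 * hy * h = hx * hy * hz + h1 * h2 * h3 + h * h2 * h13 ∧
  hz3 * hz * h = hx * hy * hz + h1 * h2 * h3 + h * h3 * h12 ∧
  h123 * h ^ 2 * hx * hy * hz =
    (hx * hy * hz) ^ 2 +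
      hx * hy * hz * (2 * h1 * h2 * h3 + h * h1 * h23 + h * h2 * h13 + h * h3 * h12) +
      (h1 * h2 + h * h12) * (h1 * h3 + h * h13) * (h2 * h3 + h * h23)

/-- `A` satisfies the hexahedron recurrence on all the cubes removed from the orthant. -/
def SatisfiesRecurrence {K : Type*} [Field K] (U : Set Vec) (A : Label → K) : Prop :=
  ∀ v ∈ orthant \ U, HexahedronAt A v

/-- The field of rational functions over `K` in independent variables indexed by the labels. -/
abbrev RatFun (K : Type*) [Field K] := FractionRing (MvPolynomial Label K)

/-- The variable with label `l`, as a rational function. -/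
def var (K : Type*) [Field K] (l : Label) : RatFun K :=
  algebraMap (MvPolynomial Label K) (RatFun K) (MvPolynomial.X l)

/-- `A` represents the variables on and above the stepped surface of `U` as rational functions in
the variables labelling `Γ(U)`: at the labels of `Γ(U)` it is given by independent variables, and
it satisfies the recurrence on all removed cubes. -/
def IsRepresentation {K : Type*} [Field K] (U : Set Vec) (A : Label → RatFun K) : Prop :=
  (∀ l ∈ labels U, A l = var K l) ∧ SatisfiesRecurrence U A

end Hexahedron

end

/-! Every solid arises from the orthant by deleting cubes one at a time (`IsSolid.induction`). It
therefore suffices to evaluate the sum over taut configurations for the orthant, and to show that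
this sum is unchanged when a cube `v` is deleted and the values of `A` are related by the recurrence
at `v` (`tautSum_exchange`).

Deleting `v` replaces the three upper squares of the cube by the three lower ones, so the graph
changes only inside a hexagon, where twelve nodes are attached to a common outside by six legs
(`patching`, `facePatching`). The outside sees of a patch configuration only its key: the
multiplicities of the six legs, and how the single legs are connected inside. Tautness, the loops
that meet the outside, and the outer factor of the weight are determined by the outer part and the
key (`isTaut_exchange`, `loopTraces_exchange`, `outerWeight_exchange`). What remains is a local
identity, `keySum_false_eq_true`: for each key, the sums of `2 ^ loops * weight` over the
configurations of either patch with this key agree.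

The local identity is deduced from single dimer covers. For each of the twenty possible sets of
legs, the weighted numbers of dimer covers of the two patches agree by the recurrence
(`coverSum_false_eq_true`). In the product of two such sums each configuration that is compatible
with the prescribed legs appears `2 ^ loops` times (`card_decompositions`): every inner loop splits
in two ways, while the splitting of a path through the patch is forced by its legs. This gives, for
every key and every compatible set of legs, a homogeneous linear equation for the differences of the
two sums. A finite computation (`keyTest`) shows that the system is triangular: each key is isolated
by some equation, at once or after a first round of eliminations. The finite combinatorics of the
patch is done with bit masks, together with proofs that these encode what they should.

For the orthant, the initial configuration is the only taut one (`tautConfigs_orthant`). Far from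
the origin the paths are known; pigeonhole arguments on axis crossings, and then on the nodes of a
given level in a given sector, show that every node lies on a path and that no path visits a level
of a sector twice, which leaves no freedom. This configuration has no loops, and its only nonzero
exponent is `1` at the origin (`tautSum_orthant`).

All divisions are legitimate because the solved recurrence is free of subtractions: values stay in a
set of nonzero elements closed under sums, products and inverses (`IsPositiveCone`). For
indeterminates this is the set of fractions whose numerator and denominator are positive rationals
where all variables are `1`. The same principle gives existence (`exists_satisfiesRecurrence`). For
the solids cut off by planes, values below the three uppermost levels never enter the recurrence and
may be replaced by `1`. -/

noncomputable section
namespace Hexahedron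

/-! ### The patch inside a hexagon, encoded by bit masks

A removable cube contributes three squares to the surface before it is removed and three others
afterwards. Either patch has twelve nodes: `k` on the `k`-th side of the bounding hexagon, and
`6 + k` next to it, for `k < 6`. Its edges are the six edges from `k` to `6 + k`, the six edges
from `6 + k` to `6 + (k + 1)`, three edges between consecutive nodes on the hexagon (depending on
the patch), and the six legs leaving the patch. A set of edges is encoded by the bits of a
number; the tables list the edges with their bit and the mask of their endpoints. -/

/-- The edges inside the patch. -/
def innerTable (t : Bool) : List (ℕ × ℕ) :=
  [(1, 65), (2, 130), (4, 260), (8, 520), (16, 1040), (32, 2080), (64, 192), (128, 384),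
    (256, 768), (512, 1536), (1024, 3072), (2048, 2112)] ++
  bif t then [(4096, 6), (8192, 24), (16384, 33)] else [(4096, 3), (8192, 12), (16384, 48)]

/-- All edges of the patch, including the legs. -/
def edgeTable (t : Bool) : List (ℕ × ℕ) :=
  innerTable t ++ [(32768, 1), (65536, 2), (131072, 4), (262144, 8), (524288, 16), (1048576, 32)]

/-! The following list functions are defined by recursors for the sake of kernel evaluation. -/

def listAll {α : Type} (f : α → Bool) (L : List α) : Bool :=
  List.rec true (fun x _ ih => bif f x then ih else false) L

def listFilter (f : ℕ → Bool) (L : List ℕ) : List ℕ :=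
  List.rec [] (fun x _ ih => bif f x then x :: ih else ih) L

def listCount (f : ℕ → Bool) (L : List ℕ) : ℕ :=
  List.rec 0 (fun x _ ih => bif f x then Nat.succ ih else ih) L

def listNodup (L : List ℕ) : Bool :=
  List.rec true (fun x l ih => bif listAll (fun y => !(x.beq y)) l then ih else false) L

def listMem (k : ℕ) (L : List ℕ) : Bool := !(listAll (fun y => !(k.beq y)) L)

/-- Test all pairs of members of a list, up to order. -/
def allPairs (f : ℕ → ℕ → Bool) (L : List ℕ) : Bool :=
  List.rec true (fun a l ih =>
    bif listAll (fun b => f (Nat.land a b) (Nat.xor a b)) (a :: l) then ih else false) L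

/-- The ways to add an edge to the partial cover `c` so that the node with mask `a` is covered. -/
def extendCover (t : Bool) (c a : ℕ) : List ℕ :=
  bif listAll (fun p => (Nat.land p.1 c).beq 0 || (Nat.land p.2 a).beq 0) (edgeTable t) then
    ((edgeTable t).filter fun p => !(Nat.land p.2 a).beq 0 &&
      listAll (fun q => (Nat.land q.1 c).beq 0 || (Nat.land q.2 p.2).beq 0) (edgeTable t)).map
        fun p => Nat.lor c p.1
  else [c]

/-- The dimer covers of the patch. -/
def matchings (t : Bool) : List ℕ :=
  [1, 2, 4, 8, 16, 32, 64, 128, 256, 512, 1024, 2048].foldl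
    (fun L a => L.flatMap fun c => extendCover t c a) [0]

/-- Merge the masks in `L` which meet `p`. -/
def mergeMasks (p : ℕ) (L : List ℕ) : List ℕ :=
  List.rec (motive := fun _ => ℕ → List ℕ) (fun q => [q])
    (fun m _ ih q => bif (Nat.land m p).beq 0 then m :: ih q else ih (Nat.lor m q)) L 0

def masksFrom (S : ℕ) (E : List (ℕ × ℕ)) (L : List ℕ) : List ℕ :=
  List.rec (motive := fun _ => List ℕ → List ℕ) (fun L => L)
    (fun p _ ih L => bif (Nat.land S p.1).beq 0 then ih L else ih (mergeMasks p.2 L)) E L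

/-- The components of the patch with the edge set `S`, as masks of nodes. -/
def compMasks (t : Bool) (S : ℕ) : List ℕ :=
  masksFrom S (innerTable t) [1, 2, 4, 8, 16, 32, 64, 128, 256, 512, 1024, 2048]

/-- The legs in an edge set. -/
def legBits (N : ℕ) : ℕ := Nat.shiftRight N 15

/-- The number of nontrivial components of `S` without a leg. -/
def loopNum (t : Bool) (S : ℕ) : ℕ :=
  listCount (fun m => (Nat.land m (legBits S)).beq 0 && !(Nat.land m (Nat.pred m)).beq 0)
    (compMasks t S)

/-- The set of nonempty sets of legs cut out by components, as a mask. -/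
def codeOf (S : ℕ) (L : List ℕ) : ℕ :=
  List.rec 0 (fun m _ ih => bif (Nat.land m (legBits S)).beq 0 then ih else
    Nat.lor (Nat.pow 2 (Nat.land m (legBits S))) ih) L

/-- If `s` is the set of legs of one of two dimer covers, and `l` the set of legs of a path formed
by them, then `s` contains exactly one leg of `l`, up to the bipartite colouring. -/
def compatMask (s l : ℕ) : Bool :=
  l.beq 0 || (!(Nat.land l (Nat.xor s 21)).beq 0 && !(Nat.land l (Nat.xor s 21)).beq l)

/-- `D ⊆ N ⊆ DS` for the encoded sets. -/
def fits (D DS N : ℕ) : Bool := (Nat.land N D).beq D && (Nat.lor N DS).beq DS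

/-- The sets of legs of dimer covers. -/
def legSets : List ℕ :=
  [0, 3, 6, 12, 24, 48, 33, 15, 30, 60, 57, 51, 39, 9, 18, 36, 27, 54, 45, 63]

def closedTest (t : Bool) (S : ℕ) : Bool :=
  listAll (fun p => (Nat.land S p.1).beq 0 ||
    listAll (fun m => (Nat.land m p.2).beq 0 || (Nat.land m p.2).beq p.2) (compMasks t S))
    (innerTable t)

/-- For every compatible set of legs, the union with doubled edges `D` and single edges `S` has
`2 ^ loopNum t S` decompositions into two dimer covers such that the first has these legs. -/
def countTest (t : Bool) (D S : ℕ) : Bool :=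
  listAll (fun s =>
    bif fits (legBits D) (legBits (Nat.lor D S)) s then
      (listCount (fun N => (legBits N).beq s)
        (listFilter (fits D (Nat.lor D S)) (matchings t))).beq
      (bif listAll (fun m => compatMask s (Nat.land m (legBits S))) (compMasks t S)
        then Nat.pow 2 (loopNum t S) else 0)
    else true) legSets

/-- The doubled legs, the single legs, and the way in which the latter are connected. -/
def codeKey (t : Bool) (D S : ℕ) : ℕ :=
  Nat.lor (Nat.lor (legBits D) (Nat.shiftLeft (legBits S) 6))
    (Nat.shiftLeft (codeOf S (compMasks t S)) 12)

def collectKeys (f : ℕ → ℕ) (L : List ℕ) (acc : List ℕ) : List ℕ :=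
  List.rec (motive := fun _ => List ℕ → List ℕ) (fun acc => acc)
    (fun a _ ih acc => bif listMem (f a) acc then ih acc else ih (f a :: acc)) L acc

def keyListFrom (L : List ℕ) (acc : List ℕ) : List ℕ :=
  List.rec (motive := fun _ => List ℕ → List ℕ) (fun acc => acc)
    (fun a l ih acc =>
      ih (collectKeys (fun b => codeKey false (Nat.land a b) (Nat.xor a b)) (a :: l) acc))
    L acc

/-- The keys of all double-dimer configurations of the patch. -/
def keyList : List ℕ := keyListFrom (matchings false) []

/-- The legs `s` are possible for one of two covers forming a configuration with the key `k`. -/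
def okKey (k s : ℕ) : Bool :=
  fits (Nat.land k 63) (Nat.lor (Nat.land k 63) (Nat.land (Nat.shiftRight k 6) 63)) s &&
  listAll (fun l => !(Nat.testBit k (12 + l)) || compatMask s l) (List.range 64)

def sameLegs (k k' : ℕ) : Bool := (Nat.land k 4095).beq (Nat.land k' 4095)

def soleKey (ok : ℕ → Bool) (k s : ℕ) : Bool :=
  okKey k s && listAll (fun k' => !(sameLegs k k') || k'.beq k || ok k' || !(okKey k' s)) keyList

def determined₁ (k : ℕ) : Bool := legSets.any fun s => soleKey (fun _ => false) k s

def determined₂ (k : ℕ) : Bool := determined₁ k || legSets.any fun s => soleKey determined₁ k s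

-- Three facts are verified for every pair of covers: the computed masks are closed under single
-- inner edges, they are pairwise different, and decompositions with prescribed legs are counted by
-- a power of two. The first two certify that the masks are the components.
set_option maxHeartbeats 4000000 in
theorem patchTest_false :
    allPairs (fun D S => closedTest false S && listNodup (compMasks false S) &&
      countTest false D S) (matchings false) = true := by decide +kernel

set_option maxHeartbeats 4000000 in
theorem patchTest_true :
    allPairs (fun D S => closedTest true S && listNodup (compMasks true S) &&
      countTest true D S) (matchings true) = true := by decide +kernel

-- The first part says that the second patch has no keys besides those of the first. The second part
-- is the triangularity of the linear system for the key sums: two rounds of elimination reach every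
-- key.
set_option maxHeartbeats 4000000 in
theorem keyTest :
    (allPairs (fun D S => listMem (codeKey true D S) keyList) (matchings true) &&
      listAll determined₂ keyList) = true := by decide +kernel

/-! ### Specifications of the list functions and of the bitwise operations. -/

theorem listAll_iff {α : Type} (f : α → Bool) (L : List α) :
    listAll f L = true ↔ ∀ x ∈ L, f x = true := by
  induction L with
  | nil => simp [listAll]
  | cons x l ih =>
    have : listAll f (x :: l) = bif f x then listAll f l else false := rfl
    rw [this]
    cases h : f x <;> simp [h, ih]

theorem listFilter_eq (f : ℕ → Bool) (L : List ℕ) : listFilter f L = L.filter f := by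
  induction L with
  | nil => rfl
  | cons x l ih =>
    have : listFilter f (x :: l) = bif f x then x :: listFilter f l else listFilter f l := rfl
    rw [this]
    cases h : f x <;> simp [h, ih]

theorem listCount_eq (f : ℕ → Bool) (L : List ℕ) : listCount f L = L.countP f := by
  induction L with
  | nil => rfl
  | cons x l ih =>
    have : listCount f (x :: l) = bif f x then Nat.succ (listCount f l) else listCount f l := rfl
    rw [this]
    cases h : f x <;> simp [h, ih]

theorem listNodup_iff (L : List ℕ) : listNodup L = true ↔ L.Nodup := by
  induction L with
  | nil => simp [listNodup]
  | cons x l ih =>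
    have : listNodup (x :: l) =
      bif listAll (fun y => !(x.beq y)) l then listNodup l else false := rfl
    rw [this, List.nodup_cons, ← ih]
    have h2 : listAll (fun y => !(x.beq y)) l = true ↔ x ∉ l := by
      rw [listAll_iff]
      constructor
      · intro h hx
        simpa using h x hx
      · intro h y hy
        have : x ≠ y := by rintro rfl; exact h hy
        rw [Bool.not_eq_true', ← Bool.not_eq_true, Nat.beq_eq]
        exact this
    cases h : listAll (fun y => !(x.beq y)) l
    · rw [h] at h2; simp at h2; simp [h2]
    · rw [h] at h2; simp at h2; simp [h2]

theorem listMem_iff (k : ℕ) (L : List ℕ) : listMem k L = true ↔ k ∈ L := by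
  unfold listMem
  rw [Bool.not_eq_true', ← Bool.not_eq_true, listAll_iff]
  simp

/-- The test visits each unordered pair once, the diagonal included; symmetry of intersection and
symmetric difference yields the ordered pairs. -/
theorem allPairs_spec {f : ℕ → ℕ → Bool} {L : List ℕ} (h : allPairs f L = true) :
    ∀ a ∈ L, ∀ b ∈ L, f (a &&& b) (a ^^^ b) = true := by
  induction L with
  | nil => simp
  | cons x l ih =>
    have h1 : allPairs f (x :: l) =
      bif listAll (fun b => f (x &&& b) (x ^^^ b)) (x :: l) then allPairs f l else false := rfl
    rw [h1] at h
    cases h2 : listAll (fun b => f (x &&& b) (x ^^^ b)) (x :: l)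
    · simp [h2] at h
    · rw [h2] at h
      rw [listAll_iff] at h2
      intro a ha b hb
      rcases List.mem_cons.1 ha with rfl | ha'
      · exact h2 b hb
      · rcases List.mem_cons.1 hb with rfl | hb'
        · rw [Nat.land_comm, Nat.xor_comm]; exact h2 a ha
        · exact ih h a ha' b hb'

theorem land_eq_zero_iff (a b : ℕ) : a &&& b = 0 ↔ ∀ i, a.testBit i → b.testBit i → False := by
  constructor
  · intro h i ha hb
    have := Nat.testBit_and a b i
    rw [h] at this
    simp [ha, hb] at this
  · intro h
    apply Nat.eq_of_testBit_eq
    intro i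
    rw [Nat.testBit_and]
    have := h i
    cases ha : a.testBit i <;> cases hb : b.testBit i <;> simp_all

theorem land_eq_left_iff (a b : ℕ) : a &&& b = a ↔ ∀ i, a.testBit i → b.testBit i := by
  constructor
  · intro h i ha
    rw [← h, Nat.testBit_and] at ha
    simp_all
  · intro h
    apply Nat.eq_of_testBit_eq
    intro i
    rw [Nat.testBit_and]
    have := h i
    cases ha : a.testBit i <;> simp_all

theorem lor_eq_right_iff (a b : ℕ) : a ||| b = b ↔ ∀ i, a.testBit i → b.testBit i := by
  constructor
  · intro h i ha
    rw [← h, Nat.testBit_or]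
    simp [ha]
  · intro h
    apply Nat.eq_of_testBit_eq
    intro i
    rw [Nat.testBit_or]
    have := h i
    cases ha : a.testBit i <;> simp_all

/-! ### The patch as a graph with eighteen nodes -/

/-- The first endpoint of an edge of the patch. The nodes `12 + k` are the other ends of the legs;
the edges `15 + k` are the legs. -/
def src (t : Bool) : Fin 21 → Fin 18 :=
  ![0, 1, 2, 3, 4, 5, 6, 7, 8, 9, 10, 11, bif t then 1 else 0, bif t then 3 else 2,
    bif t then 5 else 4, 0, 1, 2, 3, 4, 5]

/-- The second endpoint of an edge of the patch. -/
def tgt (t : Bool) : Fin 21 → Fin 18 :=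
  ![6, 7, 8, 9, 10, 11, 7, 8, 9, 10, 11, 6, bif t then 2 else 1, bif t then 4 else 3,
    bif t then 0 else 5, 12, 13, 14, 15, 16, 17]

/-- `a` is an endpoint of `e`. -/
def Inc (t : Bool) (e : Fin 21) (a : Fin 18) : Prop := src t e = a ∨ tgt t e = a

instance (t : Bool) (e : Fin 21) (a : Fin 18) : Decidable (Inc t e a) :=
  inferInstanceAs (Decidable (_ ∨ _))

theorem mem_edgeTable (t : Bool) (p : ℕ × ℕ) :
    p ∈ edgeTable t ↔ ∃ e : Fin 21, p = (2 ^ e.1, (edgeTable t).getD e.1 (0, 0) |>.2) := by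
  cases t <;> simp [edgeTable, innerTable, Fin.exists_fin_succ]

theorem edgeTable_testBit_fin (t : Bool) (e : Fin 21) (a : Fin 12) :
    ((edgeTable t).getD e.1 (0, 0)).2.testBit a.1 = true ↔ Inc t e (a.castLE (by norm_num)) := by
  revert t e a; decide +kernel

theorem edgeTable_testBit (t : Bool) (e : Fin 21) (a : ℕ) :
    ((edgeTable t).getD e.1 (0, 0)).2.testBit a = true ↔ ∃ h : a < 12, Inc t e ⟨a, by omega⟩ := by
  by_cases h : a < 12
  · simp only [h, exists_true_left]
    exact edgeTable_testBit_fin t e ⟨a, h⟩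
  · simp only [h, IsEmpty.exists_iff, iff_false, Bool.not_eq_true]
    apply Nat.testBit_lt_two_pow
    have : ∀ (t : Bool) (e : Fin 21), ((edgeTable t).getD e.1 (0, 0)).2 < 2 ^ 12 := by
      decide +kernel
    exact (this t e).trans_le (Nat.pow_le_pow_right (by norm_num) (by omega))

/-- `N` is a dimer cover of the patch. -/
def IsPatchCover (t : Bool) (N : Fin 21 → Bool) : Prop :=
  ∀ a : Fin 12, ∑ e, (if Inc t e (a.castLE (by norm_num)) then (N e).toNat else 0) = 1

instance (t : Bool) (N : Fin 21 → Bool) : Decidable (IsPatchCover t N) :=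
  inferInstanceAs (Decidable (∀ _, _))

theorem isPatchCover_iff {t : Bool} {N : Fin 21 → Bool} : IsPatchCover t N ↔
    ∀ a : Fin 12, ∃! e, N e = true ∧ Inc t e (a.castLE (by norm_num)) := by
  unfold IsPatchCover
  refine forall_congr' fun a => ?_
  have : ∑ e, (if Inc t e (a.castLE (by norm_num)) then (N e).toNat else 0) =
      (Finset.univ.filter fun e => N e = true ∧ Inc t e (a.castLE (by norm_num))).card := by
    rw [Finset.card_filter]
    refine Finset.sum_congr rfl fun e _ => ?_
    cases N e <;> simp
  rw [this, Finset.card_eq_one]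
  constructor
  · rintro ⟨e, he⟩
    have h1 := Finset.mem_singleton_self e
    rw [← he] at h1
    refine ⟨e, by simpa using h1, fun y hy => ?_⟩
    have : y ∈ Finset.univ.filter fun e => N e = true ∧ Inc t e (a.castLE (by norm_num)) := by
      simpa using hy
    rw [he] at this
    simpa using this
  · rintro ⟨e, he, hu⟩
    refine ⟨e, ?_⟩
    ext y
    simp only [Finset.mem_filter, Finset.mem_univ, true_and, Finset.mem_singleton]
    exact ⟨fun h => hu y h, by rintro rfl; exact he⟩

/-- The set of edges encoded by a mask. -/
def ofMask (m : ℕ) : Fin 21 → Bool := fun e => m.testBit e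

theorem ofMask_ofBits (N : Fin 21 → Bool) : ofMask (Nat.ofBits N) = N := by
  funext e
  simp [ofMask, Nat.testBit_ofBits_lt]

theorem ofBits_ofMask {m : ℕ} (h : m < 2 ^ 21) : Nat.ofBits (ofMask m) = m := by
  apply Nat.eq_of_testBit_eq
  intro i
  by_cases hi : i < 21
  · rw [Nat.testBit_ofBits_lt _ _ hi]; rfl
  · rw [Nat.testBit_ofBits_ge _ _ (by omega), Nat.testBit_lt_two_pow]
    exact h.trans_le (Nat.pow_le_pow_right (by norm_num) (by omega))

theorem lt_of_mem_matchings (t : Bool) : ∀ m ∈ matchings t, m < 2 ^ 21 := by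
  revert t; decide +kernel

theorem isPatchCover_of_mem (t : Bool) : ∀ m ∈ matchings t, IsPatchCover t (ofMask m) := by
  revert t; decide +kernel

theorem legBits_mem_legSets (t : Bool) : ∀ m ∈ matchings t, legBits m ∈ legSets := by
  revert t; decide +kernel

theorem pow_land_eq_zero (a i : ℕ) : 2 ^ i &&& a = 0 ↔ a.testBit i = false := by
  rw [land_eq_zero_iff]
  simp only [Nat.testBit_two_pow]
  simp

/-- The invariant behind the completeness of the search: a partial cover inside a given cover `N`
has an extension in the list which covers one more node and is still inside `N`. -/
theorem extendCover_sub {t : Bool} {N : Fin 21 → Bool} (hN : IsPatchCover t N) {c : ℕ}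
    (hc : ∀ i, c.testBit i → (Nat.ofBits N).testBit i) (a : Fin 12) :
    ∃ c' ∈ extendCover t c (2 ^ a.1), (∀ i, c.testBit i → c'.testBit i) ∧
      (∀ i, c'.testBit i → (Nat.ofBits N).testBit i) ∧
      ∃ e : Fin 21, c'.testBit e.1 ∧ Inc t e (a.castLE (by norm_num)) := by
  rw [isPatchCover_iff] at hN
  have key : ∀ (p : ℕ × ℕ), p ∈ edgeTable t → ∃ e : Fin 21, p.1 = 2 ^ e.1 ∧
      ∀ b, p.2.testBit b = true ↔ ∃ h : b < 12, Inc t e ⟨b, by omega⟩ := by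
    intro p hp
    obtain ⟨e, rfl⟩ := (mem_edgeTable t p).1 hp
    exact ⟨e, rfl, edgeTable_testBit t e⟩
  have bitN : ∀ e : Fin 21, (Nat.ofBits N).testBit e.1 = N e := fun e => by
    rw [Nat.testBit_ofBits_lt _ _ e.2]
  have hl : ∀ x y : ℕ, Nat.land x y = x &&& y := fun _ _ => rfl
  have hl' : ∀ x y : ℕ, Nat.lor x y = x ||| y := fun _ _ => rfl
  unfold extendCover
  cases h : listAll (fun p => (Nat.land p.1 c).beq 0 || (Nat.land p.2 (2 ^ a.1)).beq 0) (edgeTable t)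
  · refine ⟨c, by simp, fun _ h => h, hc, ?_⟩
    rw [← Bool.not_eq_true, listAll_iff] at h
    push Not at h
    obtain ⟨p, hp, h⟩ := h
    obtain ⟨e, he, hb⟩ := key p hp
    refine ⟨e, ?_⟩
    rw [hl, hl, he, ne_eq, Bool.or_eq_true, Nat.beq_eq, Nat.beq_eq, Nat.land_comm p.2,
      pow_land_eq_zero, pow_land_eq_zero, not_or, Bool.not_eq_false, Bool.not_eq_false] at h
    exact ⟨h.1, ((hb a.1).1 h.2).2⟩
  · obtain ⟨e, ⟨he, hea⟩, hu⟩ := hN a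
    rw [listAll_iff] at h
    -- The edge to add is the one by which `N` covers the node. It is admissible since an edge of
    -- `c` meeting it would be a second edge of `N` at a common node, hence the same edge, and then
    -- `a` would already be covered by `c`.
    refine ⟨c ||| 2 ^ e.1, ?_, ?_, ?_, e, ?_, hea⟩
    · simp only [cond_true, List.mem_map, List.mem_filter, Bool.and_eq_true, listAll_iff]
      refine ⟨_, ⟨(mem_edgeTable t _).2 ⟨e, rfl⟩, ?_, ?_⟩, rfl⟩
      · simp only [hl, Bool.not_eq_true', ← Bool.not_eq_true, Nat.beq_eq, Nat.land_comm _ (2 ^ a.1),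
          pow_land_eq_zero]
        rw [Bool.not_eq_true, Bool.not_eq_false, edgeTable_testBit]
        exact ⟨a.2, hea⟩
      · intro q hq
        obtain ⟨e', he', hb'⟩ := key q hq
        simp only [hl, he', Bool.or_eq_true, Nat.beq_eq, pow_land_eq_zero]
        by_contra hcon
        push Not at hcon
        obtain ⟨h1, h2⟩ := hcon
        rw [Bool.ne_false_iff] at h1
        have h3 : ¬ ∀ i, q.2.testBit i → ((edgeTable t).getD e.1 (0, 0)).2.testBit i → False := by
          rw [← land_eq_zero_iff]; exact h2
        simp only [not_forall, not_false_eq_true] at h3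
        obtain ⟨b, hb1, hb2, -⟩ := h3
        obtain ⟨hb, hb1⟩ := (hb' b).1 hb1
        obtain ⟨_, hb3⟩ := (edgeTable_testBit t e b).1 hb2
        have h4 : N e' = true := by rw [← bitN]; exact hc _ h1
        have : e = e' := (hN ⟨b, hb⟩).unique ⟨he, hb3⟩ ⟨h4, hb1⟩
        subst this
        have h5 := h q hq
        simp only [hl, he', Bool.or_eq_true, Nat.beq_eq, pow_land_eq_zero, h1, Nat.land_comm q.2] at h5
        have h6 : q.2.testBit a.1 = true := (hb' a.1).2 ⟨a.2, hea⟩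
        simp [h6] at h5
    · intro i hi
      simp [Nat.testBit_or, hi]
    · intro i hi
      rw [Nat.testBit_or, Bool.or_eq_true] at hi
      rcases hi with hi | hi
      · exact hc i hi
      · rw [Nat.testBit_two_pow] at hi
        simp only [decide_eq_true_eq] at hi
        subst hi
        rw [bitN, he]
    · simp [Nat.testBit_or]

/-- After all twelve nodes have been treated, some partial cover inside `N` covers every node. A
subset of a perfect matching which covers every node is the whole matching. -/
theorem ofBits_mem_matchings {t : Bool} {N : Fin 21 → Bool} (hN : IsPatchCover t N) :
    Nat.ofBits N ∈ matchings t := by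
  have key : ∀ (l : List (Fin 12)) (L : List ℕ) (P : Fin 12 → Prop),
      (∃ c ∈ L, (∀ i, c.testBit i → (Nat.ofBits N).testBit i) ∧
        ∀ a, P a → ∃ e : Fin 21, c.testBit e.1 ∧ Inc t e (a.castLE (by norm_num))) →
      ∃ c ∈ (l.map fun a => 2 ^ a.1).foldl (fun L a => L.flatMap fun c => extendCover t c a) L,
        (∀ i, c.testBit i → (Nat.ofBits N).testBit i) ∧
        ∀ a, (P a ∨ a ∈ l) → ∃ e : Fin 21, c.testBit e.1 ∧ Inc t e (a.castLE (by norm_num)) := by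
    intro l
    induction l with
    | nil => intro L P h; simpa using h
    | cons x l ih =>
      rintro L P ⟨c, hcL, hc, hP⟩
      obtain ⟨c', h1, h2, h3, e, h4, h5⟩ := extendCover_sub hN hc x
      obtain ⟨c'', h6, h7, h8⟩ := ih (L.flatMap fun c => extendCover t c (2 ^ x.1))
        (fun a => P a ∨ a = x) ⟨c', List.mem_flatMap.2 ⟨c, hcL, h1⟩, h3, by
          rintro a (ha | rfl)
          · obtain ⟨e, he, he'⟩ := hP a ha
            exact ⟨e, h2 _ he, he'⟩
          · exact ⟨e, h4, h5⟩⟩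
      refine ⟨c'', h6, h7, fun a ha => h8 a ?_⟩
      rcases ha with ha | ha
      · exact Or.inl (Or.inl ha)
      · rcases List.mem_cons.1 ha with rfl | ha
        · exact Or.inl (Or.inr rfl)
        · exact Or.inr ha
  obtain ⟨c, h1, h2, h3⟩ := key (List.finRange 12) [0] (fun _ => False) ⟨0, by simp, by simp, by simp⟩
  have h4 : c = Nat.ofBits N := by
    apply Nat.eq_of_testBit_eq
    intro i
    rw [Bool.eq_iff_iff]
    refine ⟨h2 i, fun hi => ?_⟩
    have hi21 : i < 21 := by
      by_contra hcon
      rw [Nat.testBit_ofBits_ge _ _ (by omega)] at hi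
      simp at hi
    have hN' := isPatchCover_iff.1 hN
    have hsrc : ∀ (t : Bool) (e : Fin 21), ∃ a : Fin 12, Inc t e (a.castLE (by norm_num)) := by
      decide +kernel
    obtain ⟨a, ha⟩ := hsrc t ⟨i, hi21⟩
    obtain ⟨e, he, hea⟩ := h3 a (Or.inr (List.mem_finRange a))
    have hb : ∀ e : Fin 21, (Nat.ofBits N).testBit e.1 = N e := fun e => by
      rw [Nat.testBit_ofBits_lt _ _ e.2]
    have : e = ⟨i, hi21⟩ := (hN' a).unique ⟨by rw [← hb]; exact h2 _ he, hea⟩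
      ⟨by rw [← hb]; exact hi, ha⟩
    rw [this] at he
    exact he
  rw [← h4]
  have h5 : (List.finRange 12).map (fun a : Fin 12 => 2 ^ a.1) =
      [1, 2, 4, 8, 16, 32, 64, 128, 256, 512, 1024, 2048] := by decide +kernel
  rwa [h5] at h1

/-! ### Components of a configuration of the patch -/

/-- The accumulator `q` must be general for the induction. The first half is soundness: a mask is
either old, or its nodes come from `q` and from old masks meeting `p`. The second half says that no
node gets lost. -/
theorem mergeMasks_aux (p : ℕ) (L : List ℕ) : ∀ q : ℕ,
    (∀ m ∈ List.rec (motive := fun _ => ℕ → List ℕ) (fun q => [q])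
      (fun m _ ih q => bif (Nat.land m p).beq 0 then m :: ih q else ih (Nat.lor m q)) L q,
      m ∈ L ∨ ∀ i, m.testBit i → q.testBit i ∨ ∃ m' ∈ L, m'.testBit i ∧ m' &&& p ≠ 0) ∧
    (∀ i, (q.testBit i ∨ ∃ m' ∈ L, m'.testBit i) →
      ∃ m ∈ List.rec (motive := fun _ => ℕ → List ℕ) (fun q => [q])
      (fun m _ ih q => bif (Nat.land m p).beq 0 then m :: ih q else ih (Nat.lor m q)) L q,
        m.testBit i) := by
  induction L with
  | nil => intro q; simp
  | cons x l ih =>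
    intro q
    have hl : Nat.land x p = x &&& p := rfl
    cases h : (Nat.land x p).beq 0
    · have hx : x &&& p ≠ 0 := by
        rw [← Bool.not_eq_true, Nat.beq_eq] at h; exact h
      obtain ⟨h1, h2⟩ := ih (Nat.lor x q)
      simp only [h, cond_false]
      constructor
      · intro m hm
        rcases h1 m hm with h3 | h3
        · exact Or.inl (List.mem_cons_of_mem _ h3)
        · refine Or.inr fun i hi => ?_
          rcases h3 i hi with h4 | ⟨m', h4, h5⟩
          · change (x ||| q).testBit i = true at h4
            rw [Nat.testBit_or, Bool.or_eq_true] at h4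
            rcases h4 with h4 | h4
            · exact Or.inr ⟨x, List.mem_cons_self, h4, hx⟩
            · exact Or.inl h4
          · exact Or.inr ⟨m', List.mem_cons_of_mem _ h4, h5⟩
      · intro i hi
        apply h2
        change (x ||| q).testBit i = true ∨ _
        rw [Nat.testBit_or, Bool.or_eq_true]
        rcases hi with hi | ⟨m', hm', hi⟩
        · exact Or.inl (Or.inr hi)
        · rcases List.mem_cons.1 hm' with rfl | hm'
          · exact Or.inl (Or.inl hi)
          · exact Or.inr ⟨m', hm', hi⟩
    · obtain ⟨h1, h2⟩ := ih q
      simp only [h, cond_true]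
      constructor
      · intro m hm
        rcases List.mem_cons.1 hm with rfl | hm
        · exact Or.inl List.mem_cons_self
        · rcases h1 m hm with h3 | h3
          · exact Or.inl (List.mem_cons_of_mem _ h3)
          · refine Or.inr fun i hi => ?_
            rcases h3 i hi with h4 | ⟨m', h4, h5⟩
            · exact Or.inl h4
            · exact Or.inr ⟨m', List.mem_cons_of_mem _ h4, h5⟩
      · intro i hi
        rcases hi with hi | ⟨m', hm', hi⟩
        · obtain ⟨m, hm, hmi⟩ := h2 i (Or.inl hi)
          exact ⟨m, List.mem_cons_of_mem _ hm, hmi⟩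
        · rcases List.mem_cons.1 hm' with rfl | hm'
          · exact ⟨m', List.mem_cons_self, hi⟩
          · obtain ⟨m, hm, hmi⟩ := h2 i (Or.inr ⟨m', hm', hi⟩)
            exact ⟨m, List.mem_cons_of_mem _ hm, hmi⟩

theorem of_mem_mergeMasks {p : ℕ} {L : List ℕ} {m : ℕ} (hm : m ∈ mergeMasks p L) :
    m ∈ L ∨ ∀ i, m.testBit i → ∃ m' ∈ L, m'.testBit i ∧ m' &&& p ≠ 0 := by
  rcases (mergeMasks_aux p L 0).1 m hm with h | h
  · exact Or.inl h
  · refine Or.inr fun i hi => ?_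
    simpa using h i hi

theorem exists_mem_mergeMasks {p : ℕ} {L : List ℕ} {m i : ℕ} (hm : m ∈ L) (hi : m.testBit i) :
    ∃ m' ∈ mergeMasks p L, m'.testBit i :=
  (mergeMasks_aux p L 0).2 i (Or.inr ⟨m, hm, hi⟩)

theorem masksFrom_cons (S : ℕ) (p : ℕ × ℕ) (E : List (ℕ × ℕ)) (L : List ℕ) :
    masksFrom S (p :: E) L =
      if S &&& p.1 = 0 then masksFrom S E L else masksFrom S E (mergeMasks p.2 L) := by
  have : masksFrom S (p :: E) L = bif (Nat.land S p.1).beq 0 then masksFrom S E L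
    else masksFrom S E (mergeMasks p.2 L) := rfl
  rw [this]
  have hl : Nat.land S p.1 = S &&& p.1 := rfl
  rw [hl]
  by_cases h : S &&& p.1 = 0
  · simp [h]
  · have : (S &&& p.1).beq 0 = false := by rw [← Bool.not_eq_true, Nat.beq_eq]; exact h
    simp [h, this]

/-- If `a` and `b` fall into one merged mask, then each shared an old mask with an endpoint of the
edge `p`, and transitivity connects them through this edge. -/
theorem masksFrom_sound {S : ℕ} {R : ℕ → ℕ → Prop}
    (htrans : ∀ a b c, R a b → R b c → R a c) (E : List (ℕ × ℕ)) :
    ∀ L : List ℕ, (∀ p ∈ E, S &&& p.1 ≠ 0 → ∀ a b, p.2.testBit a → p.2.testBit b → R a b) →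
    (∀ m ∈ L, ∀ a b, m.testBit a → m.testBit b → R a b) →
    ∀ m ∈ masksFrom S E L, ∀ a b, m.testBit a → m.testBit b → R a b := by
  induction E with
  | nil => intro L _ hL; exact hL
  | cons p E ih =>
    intro L hE hL
    rw [masksFrom_cons]
    have hE' : ∀ p ∈ E, S &&& p.1 ≠ 0 → ∀ a b, p.2.testBit a → p.2.testBit b → R a b :=
      fun q hq => hE q (List.mem_cons_of_mem _ hq)
    split_ifs with h
    · exact ih L hE' hL
    · refine ih _ hE' fun m hm a b ha hb => ?_
      rcases of_mem_mergeMasks hm with hm | hm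
      · exact hL m hm a b ha hb
      · obtain ⟨m₁, hm₁, ha₁, hp₁⟩ := hm a ha
        obtain ⟨m₂, hm₂, hb₂, hp₂⟩ := hm b hb
        rw [ne_eq, land_eq_zero_iff] at hp₁ hp₂
        simp only [not_forall, not_false_eq_true, exists_prop] at hp₁ hp₂
        obtain ⟨x, hx, hx', -⟩ := hp₁
        obtain ⟨y, hy, hy', -⟩ := hp₂
        exact htrans _ _ _ (hL m₁ hm₁ a x ha₁ hx) (htrans _ _ _
          (hE p List.mem_cons_self h x y hx' hy') (hL m₂ hm₂ y b hy hb₂))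

theorem exists_mem_masksFrom {S i : ℕ} (E : List (ℕ × ℕ)) :
    ∀ L : List ℕ, (∃ m ∈ L, m.testBit i) → ∃ m ∈ masksFrom S E L, m.testBit i := by
  induction E with
  | nil => intro L h; exact h
  | cons p E ih =>
    intro L h
    rw [masksFrom_cons]
    split_ifs
    · exact ih L h
    · obtain ⟨m, hm, hi⟩ := h
      exact ih _ (exists_mem_mergeMasks hm hi)

theorem codeOf_testBit (S : ℕ) (L : List ℕ) (l : ℕ) : (codeOf S L).testBit l = true ↔
    ∃ m ∈ L, m &&& legBits S ≠ 0 ∧ m &&& legBits S = l := by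
  induction L with
  | nil => simp [codeOf]
  | cons m L ih =>
    have : codeOf S (m :: L) = bif (m &&& legBits S).beq 0 then codeOf S L else
      2 ^ (m &&& legBits S) ||| codeOf S L := rfl
    rw [this]
    by_cases h : m &&& legBits S = 0
    · simp [h, ih]
    · have h' : (m &&& legBits S).beq 0 = false := by
        rw [← Bool.not_eq_true, Nat.beq_eq]; exact h
      simp only [h', cond_false, Nat.testBit_or, Bool.or_eq_true, Nat.testBit_two_pow,
        decide_eq_true_eq, ih, List.mem_cons, exists_eq_or_imp, ne_eq, h, not_false_eq_true,
        true_and]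

/-- The mask of the doubled edges of a configuration. -/
def dbl (κ : Fin 21 → ℕ) : ℕ := Nat.ofBits fun e => decide (κ e = 2)

/-- The mask of the single edges of a configuration. -/
def sgl (κ : Fin 21 → ℕ) : ℕ := Nat.ofBits fun e => decide (κ e = 1)

/-- The union of two sets of edges of the patch, with multiplicities. -/
def cfg (N₁ N₂ : Fin 21 → Bool) : Fin 21 → ℕ := fun e => (N₁ e).toNat + (N₂ e).toNat

/-- The node of the patch on the `k`-th side of the hexagon. -/
def hexNode (k : Fin 6) : Fin 18 := k.castLE (by norm_num)

/-- The `k`-th leg of the patch. -/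
def leg (k : Fin 6) : Fin 21 := Fin.natAdd 15 k

/-- The key of a configuration: its legs, and how they are connected inside the patch. -/
def key (t : Bool) (κ : Fin 21 → ℕ) : ℕ := codeKey t (dbl κ) (sgl κ)

/-- Two nodes are connected by single edges inside the patch. -/
def Linked (t : Bool) (κ : Fin 21 → ℕ) : Fin 18 → Fin 18 → Prop :=
  Relation.ReflTransGen fun a b => ∃ e : Fin 21, e.1 < 15 ∧ κ e = 1 ∧ Inc t e a ∧ Inc t e b

theorem sgl_testBit (κ : Fin 21 → ℕ) (e : Fin 21) : (sgl κ).testBit e.1 = true ↔ κ e = 1 := by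
  rw [sgl, Nat.testBit_ofBits_lt _ _ e.2]; simp

theorem dbl_testBit (κ : Fin 21 → ℕ) (e : Fin 21) : (dbl κ).testBit e.1 = true ↔ κ e = 2 := by
  rw [dbl, Nat.testBit_ofBits_lt _ _ e.2]; simp

theorem legBits_testBit (N k : ℕ) : (legBits N).testBit k = N.testBit (15 + k) := by
  change (N >>> 15).testBit k = _
  rw [Nat.testBit_shiftRight]

theorem sgl_leg (κ : Fin 21 → ℕ) (k : Fin 6) :
    (legBits (sgl κ)).testBit k.1 = true ↔ κ (leg k) = 1 := by
  rw [legBits_testBit, ← sgl_testBit]; rfl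

theorem dbl_leg (κ : Fin 21 → ℕ) (k : Fin 6) :
    (legBits (dbl κ)).testBit k.1 = true ↔ κ (leg k) = 2 := by
  rw [legBits_testBit, ← dbl_testBit]; rfl

theorem legBits_lt {N : ℕ} (h : N < 2 ^ 21) : legBits N < 2 ^ 6 := by
  change N >>> 15 < _
  rw [Nat.shiftRight_eq_div_pow]; omega

theorem ofBits_lt (f : Fin 21 → Bool) : Nat.ofBits f < 2 ^ 21 := Nat.ofBits_lt_two_pow f

theorem innerTable_mem (t : Bool) (p : ℕ × ℕ) : p ∈ innerTable t ↔
    ∃ e : Fin 21, e.1 < 15 ∧ p = (2 ^ e.1, ((edgeTable t).getD e.1 (0, 0)).2) := by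
  cases t <;> simp [edgeTable, innerTable, Fin.exists_fin_succ]

theorem land_two_pow_ne_zero (a i : ℕ) : a &&& 2 ^ i ≠ 0 ↔ a.testBit i = true := by
  rw [Nat.land_comm, ne_eq, pow_land_eq_zero, Bool.not_eq_false]

theorem inc_lt {t : Bool} {e : Fin 21} {a : Fin 18} (he : e.1 < 15) (h : Inc t e a) : a.1 < 12 := by
  revert t e a; decide +kernel

/-- This is the half of the correctness of the component algorithm that holds for all edge sets. The
converse, that a mask is closed under linking, is taken from the computed `closedTest`. -/
theorem compMasks_sound (t : Bool) (κ : Fin 21 → ℕ) : ∀ m ∈ compMasks t (sgl κ), ∀ a b,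
    m.testBit a → m.testBit b → ∃ (ha : a < 12) (hb : b < 12),
      Linked t κ ⟨a, by omega⟩ ⟨b, by omega⟩ := by
  refine masksFrom_sound (R := fun a b => ∃ (ha : a < 12) (hb : b < 12),
      Linked t κ ⟨a, by omega⟩ ⟨b, by omega⟩) ?_ _ _ ?_ ?_
  · rintro a b c ⟨ha, hb, h⟩ ⟨hb', hc, h'⟩
    exact ⟨ha, hc, h.trans h'⟩
  · intro p hp hS a b ha hb
    obtain ⟨e, he, rfl⟩ := (innerTable_mem t p).1 hp
    obtain ⟨ha, ha'⟩ := (edgeTable_testBit t e a).1 ha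
    obtain ⟨hb, hb'⟩ := (edgeTable_testBit t e b).1 hb
    rw [land_two_pow_ne_zero, sgl_testBit] at hS
    exact ⟨ha, hb, Relation.ReflTransGen.single ⟨e, he, hS, ha', hb'⟩⟩
  · have : ∀ m ∈ [1, 2, 4, 8, 16, 32, 64, 128, 256, 512, 1024, 2048], ∃ i < 12, m = 2 ^ i := by
      decide +kernel
    intro m hm a b ha hb
    obtain ⟨i, hi, rfl⟩ := this m hm
    simp only [Nat.testBit_two_pow, decide_eq_true_eq] at ha hb
    subst ha; subst hb
    exact ⟨hi, hi, Relation.ReflTransGen.refl⟩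

theorem exists_compMask (t : Bool) (S : ℕ) {a : ℕ} (ha : a < 12) :
    ∃ m ∈ compMasks t S, m.testBit a := by
  refine exists_mem_masksFrom _ _ ⟨2 ^ a, ?_, by simp⟩
  interval_cases a <;> simp

/-- By `closedTest`, an inner single edge has both endpoints in a mask or neither, so a mask cannot
be left along such edges. -/
theorem mem_of_linked {t : Bool} {κ : Fin 21 → ℕ} (hc : closedTest t (sgl κ) = true) {m : ℕ}
    (hm : m ∈ compMasks t (sgl κ)) {a b : Fin 18} (h : Linked t κ a b) (ha : m.testBit a.1) :
    m.testBit b.1 := by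
  induction h with
  | refl => exact ha
  | @tail b c _ h ih =>
    obtain ⟨e, he, hκ, hb, hc'⟩ := h
    rw [closedTest, listAll_iff] at hc
    have h1 := hc _ ((innerTable_mem t _).2 ⟨e, he, rfl⟩)
    rw [Bool.or_eq_true, Nat.beq_eq] at h1
    have hb' := (edgeTable_testBit t e b.1).2 ⟨inc_lt he hb, hb⟩
    have hc'' := (edgeTable_testBit t e c.1).2 ⟨inc_lt he hc', hc'⟩
    rcases h1 with h1 | h1
    · exact absurd h1 ((land_two_pow_ne_zero _ _).2 ((sgl_testBit κ e).2 hκ))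
    · rw [listAll_iff] at h1
      have h2 := h1 m hm
      rw [Bool.or_eq_true, Nat.beq_eq, Nat.beq_eq] at h2
      rcases h2 with h2 | h2
      · exact ((land_eq_zero_iff _ _).1 h2 _ ih hb').elim
      · change m &&& _ = _ at h2
        rw [Nat.land_comm, land_eq_left_iff] at h2
        exact h2 _ hc''

theorem linked_iff {t : Bool} {κ : Fin 21 → ℕ} (hc : closedTest t (sgl κ) = true) {m : ℕ}
    (hm : m ∈ compMasks t (sgl κ)) {a b : Fin 18} (ha : m.testBit a.1) :
    Linked t κ a b ↔ m.testBit b.1 = true := by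
  refine ⟨fun h => mem_of_linked hc hm h ha, fun h => ?_⟩
  obtain ⟨_, _, h⟩ := compMasks_sound t κ m hm _ _ ha h
  exact h

/-- The nontrivial components inside the patch which do not contain a single leg. -/
def innerLoops (t : Bool) (κ : Fin 21 → ℕ) : Set (Set (Fin 18)) :=
  {T | ∃ a : Fin 18, a.1 < 12 ∧ T = {b | Linked t κ a b} ∧ T.Nontrivial ∧
    ∀ k : Fin 6, κ (leg k) = 1 → hexNode k ∉ T}

/-- The operation `m &&& (m - 1)` erases the lowest bit, so for nonzero `m` it gives zero exactly
when `m` is a power of two. -/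
theorem nontrivial_of_land_pred {m : ℕ} : m &&& (m - 1) ≠ 0 ↔
    ∃ i j, i ≠ j ∧ m.testBit i ∧ m.testBit j := by
  constructor
  · intro h
    have hm : m ≠ 0 := by rintro rfl; simp at h
    obtain ⟨i, hi⟩ := Nat.exists_testBit_of_ne_zero hm
    by_contra hcon
    push Not at hcon
    apply h
    have : m = 2 ^ i := by
      apply Nat.eq_of_testBit_eq
      intro j
      rw [Nat.testBit_two_pow]
      by_cases hij : i = j
      · subst hij; simp [hi]
      · simp only [hij, decide_false]
        rw [← Bool.not_eq_true]
        exact fun hj => hcon i j hij hi hj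
    rw [this, Nat.and_two_pow_sub_one_eq_mod]
    simp
  · rintro ⟨i, j, hij, hi, hj⟩ h
    have : m = 2 ^ (Nat.log2 m) := by
      have hm : m ≠ 0 := by rintro rfl; simp at hi
      exact ((Nat.and_sub_one_eq_zero_iff_isPowerOfTwo hm).1 h).elim fun k hk => by
        rw [hk, Nat.log2_two_pow]
    rw [this, Nat.testBit_two_pow, decide_eq_true_eq] at hi hj
    exact hij (hi.symm.trans hj)

/-- A mask without single legs and with at least two bits is the node set of an inner loop. Distinct
masks give distinct sets, and since the list has no repetitions the list count is a cardinality. -/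
theorem loopNum_eq {t : Bool} {κ : Fin 21 → ℕ} (hc : closedTest t (sgl κ) = true)
    (hn : (compMasks t (sgl κ)).Nodup) :
    loopNum t (sgl κ) = (innerLoops t κ).ncard := by
  set f : ℕ → Set (Fin 18) := fun m => {b | m.testBit b.1 = true} with hf
  set L := (compMasks t (sgl κ)).filter fun m => (Nat.land m (legBits (sgl κ))).beq 0 &&
    !(Nat.land m (Nat.pred m)).beq 0 with hL
  have h1 : loopNum t (sgl κ) = L.toFinset.card := by
    rw [loopNum, listCount_eq, List.countP_eq_length_filter,
      List.toFinset_card_of_nodup (hn.filter _)]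
  have hmem : ∀ m, m ∈ L ↔ m ∈ compMasks t (sgl κ) ∧ m &&& legBits (sgl κ) = 0 ∧
      m &&& (m - 1) ≠ 0 := by
    intro m
    rw [hL, List.mem_filter, Bool.and_eq_true, Bool.not_eq_true', ← Bool.not_eq_true, Nat.beq_eq,
      Nat.beq_eq]
    rfl
  have hinj : Set.InjOn f (L.toFinset : Set ℕ) := by
    intro m hm m' hm' h
    simp only [List.coe_toFinset, Set.mem_ofPred_eq, hmem] at hm hm'
    apply Nat.eq_of_testBit_eq
    intro i
    by_cases hi : i < 18
    · have := Set.ext_iff.1 h ⟨i, hi⟩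
      simp only [hf, Set.mem_ofPred_eq] at this
      rw [Bool.eq_iff_iff]; exact this
    · have aux : ∀ m ∈ compMasks t (sgl κ), m.testBit i = false := by
        intro m hm
        rw [← Bool.not_eq_true]
        intro h
        obtain ⟨h, -⟩ := compMasks_sound t κ m hm i i h h
        omega
      rw [aux m hm.1, aux m' hm'.1]
  have himg : f '' (L.toFinset : Set ℕ) = innerLoops t κ := by
    ext T
    simp only [List.coe_toFinset, Set.mem_image, Set.mem_ofPred_eq, hmem, innerLoops]
    constructor
    · rintro ⟨m, ⟨hm, hl, ht⟩, rfl⟩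
      obtain ⟨i, j, hij, hi, hj⟩ := nontrivial_of_land_pred.1 ht
      obtain ⟨hi', hj', -⟩ := compMasks_sound t κ m hm i j hi hj
      refine ⟨⟨i, by omega⟩, hi', ?_, ?_, ?_⟩
      · ext b
        simp only [hf, Set.mem_ofPred_eq]
        rw [linked_iff hc hm hi]
      · exact ⟨⟨i, by omega⟩, hi, ⟨j, by omega⟩, hj, by simpa using hij⟩
      · intro k hk hkT
        exact (land_eq_zero_iff _ _).1 hl k.1 hkT ((sgl_leg κ k).2 hk)
    · rintro ⟨a, ha, rfl, ⟨x, hx, y, hy, hxy⟩, hT⟩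
      obtain ⟨m, hm, hma⟩ := exists_compMask t (sgl κ) ha
      have hlm : ∀ b, Linked t κ a b ↔ m.testBit b.1 = true := fun b => linked_iff hc hm hma
      refine ⟨m, ⟨hm, ?_, ?_⟩, ?_⟩
      · rw [land_eq_zero_iff]
        intro i hi hi'
        have h6 : i < 6 := by
          by_contra hcon
          have h7 : legBits (sgl κ) < 2 ^ i := (legBits_lt (ofBits_lt _)).trans_le
            (Nat.pow_le_pow_right (by norm_num) (by omega))
          rw [Nat.testBit_lt_two_pow h7] at hi'
          exact Bool.false_ne_true hi'
        exact hT ⟨i, h6⟩ ((sgl_leg κ ⟨i, h6⟩).1 hi') ((hlm _).2 hi)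
      · exact nontrivial_of_land_pred.2 ⟨x.1, y.1, fun h => hxy (Fin.ext h), (hlm x).1 hx, (hlm y).1 hy⟩
      · ext b
        simp only [hf, Set.mem_ofPred_eq, hlm]
  rw [h1, ← himg, hinj.ncard_image, Set.ncard_coe_finset]

/-! ### Keys and decompositions -/

/-- A double-dimer configuration of the patch. -/
def IsPatchConfig (t : Bool) (κ : Fin 21 → ℕ) : Prop :=
  ∃ N₁ N₂, IsPatchCover t N₁ ∧ IsPatchCover t N₂ ∧ κ = cfg N₁ N₂

theorem dbl_cfg (N₁ N₂ : Fin 21 → Bool) :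
    dbl (cfg N₁ N₂) = Nat.ofBits N₁ &&& Nat.ofBits N₂ := by
  apply Nat.eq_of_testBit_eq
  intro i
  rw [Nat.testBit_and]
  by_cases hi : i < 21
  · rw [dbl, Nat.testBit_ofBits_lt _ _ hi, Nat.testBit_ofBits_lt _ _ hi,
      Nat.testBit_ofBits_lt _ _ hi, cfg]
    cases N₁ ⟨i, hi⟩ <;> cases N₂ ⟨i, hi⟩ <;> rfl
  · rw [dbl, Nat.testBit_ofBits_ge _ _ (by omega), Nat.testBit_ofBits_ge _ _ (by omega)]
    rfl

theorem sgl_cfg (N₁ N₂ : Fin 21 → Bool) :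
    sgl (cfg N₁ N₂) = Nat.ofBits N₁ ^^^ Nat.ofBits N₂ := by
  apply Nat.eq_of_testBit_eq
  intro i
  rw [Nat.testBit_xor]
  by_cases hi : i < 21
  · rw [sgl, Nat.testBit_ofBits_lt _ _ hi, Nat.testBit_ofBits_lt _ _ hi,
      Nat.testBit_ofBits_lt _ _ hi, cfg]
    cases N₁ ⟨i, hi⟩ <;> cases N₂ ⟨i, hi⟩ <;> rfl
  · rw [sgl, Nat.testBit_ofBits_ge _ _ (by omega), Nat.testBit_ofBits_ge _ _ (by omega),
      Nat.testBit_ofBits_ge _ _ (by omega)]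
    rfl

theorem IsPatchConfig.tests {t : Bool} {κ : Fin 21 → ℕ} (h : IsPatchConfig t κ) :
    closedTest t (sgl κ) = true ∧ (compMasks t (sgl κ)).Nodup ∧
      countTest t (dbl κ) (sgl κ) = true := by
  obtain ⟨N₁, N₂, h₁, h₂, rfl⟩ := h
  have h1 := ofBits_mem_matchings h₁
  have h2 := ofBits_mem_matchings h₂
  rw [dbl_cfg, sgl_cfg]
  cases t
  · have := allPairs_spec patchTest_false _ h1 _ h2
    simpa [listNodup_iff, and_assoc] using this
  · have := allPairs_spec patchTest_true _ h1 _ h2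
    simpa [listNodup_iff, and_assoc] using this

theorem codeKey_testBit (t : Bool) (D S i : ℕ) : (codeKey t D S).testBit i =
    ((legBits D).testBit i || (decide (6 ≤ i) && (legBits S).testBit (i - 6)) ||
      (decide (12 ≤ i) && (codeOf S (compMasks t S)).testBit (i - 12))) := by
  change (legBits D ||| (legBits S <<< 6) ||| (codeOf S (compMasks t S)) <<< 12).testBit i = _
  simp only [Nat.testBit_or, Nat.testBit_shiftLeft, ge_iff_le]

theorem testBit_of_lt_64 {n i : ℕ} (hn : n < 2 ^ 6) (hi : 6 ≤ i) : n.testBit i = false :=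
  Nat.testBit_lt_two_pow (hn.trans_le (Nat.pow_le_pow_right (by norm_num) hi))

theorem legBits_dbl_lt (κ : Fin 21 → ℕ) : legBits (dbl κ) < 2 ^ 6 := legBits_lt (ofBits_lt _)

theorem legBits_sgl_lt (κ : Fin 21 → ℕ) : legBits (sgl κ) < 2 ^ 6 := legBits_lt (ofBits_lt _)

theorem key_testBit_dbl (t : Bool) (κ : Fin 21 → ℕ) {i : ℕ} (hi : i < 6) :
    (key t κ).testBit i = (legBits (dbl κ)).testBit i := by
  rw [key, codeKey_testBit]
  simp [show ¬ 6 ≤ i by omega, show ¬ 12 ≤ i by omega]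

theorem key_testBit_sgl (t : Bool) (κ : Fin 21 → ℕ) {i : ℕ} (hi : i < 6) :
    (key t κ).testBit (6 + i) = (legBits (sgl κ)).testBit i := by
  rw [key, codeKey_testBit, testBit_of_lt_64 (legBits_dbl_lt κ) (by omega)]
  simp [show ¬ 12 ≤ 6 + i by omega]

theorem key_testBit_code (t : Bool) (κ : Fin 21 → ℕ) (i : ℕ) :
    (key t κ).testBit (12 + i) = (codeOf (sgl κ) (compMasks t (sgl κ))).testBit i := by
  rw [key, codeKey_testBit, testBit_of_lt_64 (legBits_dbl_lt κ) (by omega),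
    testBit_of_lt_64 (legBits_sgl_lt κ) (by omega)]
  simp

theorem key_land_dbl (t : Bool) (κ : Fin 21 → ℕ) : key t κ &&& 63 = legBits (dbl κ) := by
  apply Nat.eq_of_testBit_eq
  intro i
  have h63 : (63 : ℕ) = 2 ^ 6 - 1 := rfl
  rw [Nat.testBit_and, h63, Nat.testBit_two_pow_sub_one]
  by_cases hi : i < 6
  · simp [hi, key_testBit_dbl t κ hi]
  · simp [hi, testBit_of_lt_64 (legBits_dbl_lt κ) (by omega : 6 ≤ i)]

theorem key_land_sgl (t : Bool) (κ : Fin 21 → ℕ) : (key t κ >>> 6) &&& 63 = legBits (sgl κ) := by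
  apply Nat.eq_of_testBit_eq
  intro i
  have h63 : (63 : ℕ) = 2 ^ 6 - 1 := rfl
  rw [Nat.testBit_and, h63, Nat.testBit_two_pow_sub_one, Nat.testBit_shiftRight]
  by_cases hi : i < 6
  · simp [hi, key_testBit_sgl t κ hi]
  · simp [hi, testBit_of_lt_64 (legBits_sgl_lt κ) (by omega : 6 ≤ i)]

theorem leg_eq_two_of_key {t t' : Bool} {κ κ' : Fin 21 → ℕ} (h : key t κ = key t' κ') (k : Fin 6) :
    κ (leg k) = 2 ↔ κ' (leg k) = 2 := by
  rw [← dbl_leg, ← dbl_leg, ← key_land_dbl t, ← key_land_dbl t', h]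

theorem leg_eq_one_of_key {t t' : Bool} {κ κ' : Fin 21 → ℕ} (h : key t κ = key t' κ') (k : Fin 6) :
    κ (leg k) = 1 ↔ κ' (leg k) = 1 := by
  rw [← sgl_leg, ← sgl_leg, ← key_land_sgl t, ← key_land_sgl t', h]

theorem cfg_le (N₁ N₂ : Fin 21 → Bool) (e : Fin 21) : cfg N₁ N₂ e ≤ 2 := by
  rw [cfg]; cases N₁ e <;> cases N₂ e <;> simp

theorem IsPatchConfig.le {t : Bool} {κ : Fin 21 → ℕ} (h : IsPatchConfig t κ) (e : Fin 21) :
    κ e ≤ 2 := by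
  obtain ⟨N₁, N₂, -, -, rfl⟩ := h; exact cfg_le _ _ e

theorem leg_eq_of_key {t t' : Bool} {κ κ' : Fin 21 → ℕ} (hκ : IsPatchConfig t κ)
    (hκ' : IsPatchConfig t' κ') (h : key t κ = key t' κ') (k : Fin 6) :
    κ (leg k) = κ' (leg k) := by
  have h1 := leg_eq_one_of_key h k
  have h2 := leg_eq_two_of_key h k
  have h3 := hκ.le (leg k)
  have h4 := hκ'.le (leg k)
  omega

/-- The key lists the sets of single legs cut out by the components. The component through `i` and
`j` contributes such a set, and equality of keys makes some component of `κ'` cut out the same one.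
-/
theorem linked_of_key {t t' : Bool} {κ κ' : Fin 21 → ℕ} (hκ : IsPatchConfig t κ)
    (hκ' : IsPatchConfig t' κ') (h : key t κ = key t' κ') {i j : Fin 6}
    (hi : κ (leg i) = 1) (hj : κ (leg j) = 1) (hij : Linked t κ (hexNode i) (hexNode j)) :
    Linked t' κ' (hexNode i) (hexNode j) := by
  obtain ⟨m, hm, hmi⟩ := exists_compMask t (sgl κ) (show i.1 < 12 by omega)
  have hmj : m.testBit j.1 = true := (linked_iff hκ.tests.1 hm (a := hexNode i) hmi).1 hij
  have hi' := (sgl_leg κ i).2 hi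
  have hj' := (sgl_leg κ j).2 hj
  have hne : m &&& legBits (sgl κ) ≠ 0 := by
    rw [ne_eq, land_eq_zero_iff]
    exact fun h => h _ hmi hi'
  have h1 : (key t κ).testBit (12 + (m &&& legBits (sgl κ))) = true := by
    rw [key_testBit_code, codeOf_testBit]
    exact ⟨m, hm, hne, rfl⟩
  rw [h, key_testBit_code, codeOf_testBit] at h1
  obtain ⟨m', hm', -, he⟩ := h1
  have h2 : ∀ k : Fin 6, m.testBit k.1 → (legBits (sgl κ)).testBit k.1 → m'.testBit k.1 := by
    intro k h3 h4
    have h5 : (m &&& legBits (sgl κ)).testBit k.1 = true := by rw [Nat.testBit_and, h3, h4]; rfl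
    rw [← he, Nat.testBit_and, Bool.and_eq_true] at h5
    exact h5.1
  exact (linked_iff hκ'.tests.1 hm' (a := hexNode i) (h2 i hmi hi')).2 (h2 j hmj hj')

/-- `N` contains the doubled edges of `κ`, and is contained in its support. -/
def SubCfg (κ : Fin 21 → ℕ) (N : Fin 21 → Bool) : Prop :=
  ∀ e, (κ e = 2 → N e = true) ∧ (N e = true → κ e = 1 ∨ κ e = 2)

theorem fits_iff (D DS N : ℕ) : fits D DS N = true ↔
    (∀ i, D.testBit i → N.testBit i) ∧ ∀ i, N.testBit i → DS.testBit i := by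
  rw [fits, Bool.and_eq_true, Nat.beq_eq, Nat.beq_eq]
  change N &&& D = D ∧ N ||| DS = DS ↔ _
  rw [Nat.land_comm, land_eq_left_iff, lor_eq_right_iff]

theorem fits_iff_subCfg (κ : Fin 21 → ℕ) (N : Fin 21 → Bool) :
    fits (dbl κ) (dbl κ ||| sgl κ) (Nat.ofBits N) = true ↔ SubCfg κ N := by
  have hN : ∀ e : Fin 21, (Nat.ofBits N).testBit e.1 = N e := fun e => by
    rw [Nat.testBit_ofBits_lt _ _ e.2]
  rw [fits_iff]
  constructor
  · rintro ⟨h1, h2⟩ e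
    refine ⟨fun h => ?_, fun h => ?_⟩
    · rw [← hN]; exact h1 _ ((dbl_testBit κ e).2 h)
    · have := h2 e.1 (by rw [hN]; exact h)
      rw [Nat.testBit_or, Bool.or_eq_true, dbl_testBit, sgl_testBit] at this
      exact this.symm
  · intro h
    constructor
    · intro i hi
      by_cases hi' : i < 21
      · have := (h ⟨i, hi'⟩).1 ((dbl_testBit κ ⟨i, hi'⟩).1 hi)
        rw [← hN] at this; exact this
      · rw [dbl, Nat.testBit_ofBits_ge _ _ (by omega)] at hi; simp at hi
    · intro i hi
      by_cases hi' : i < 21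
      · have h2 := (h ⟨i, hi'⟩).2 (by rw [← hN]; exact hi)
        rw [← sgl_testBit, ← dbl_testBit] at h2
        rw [Nat.testBit_or, Bool.or_eq_true]
        exact h2.symm
      · rw [Nat.testBit_ofBits_ge _ _ (by omega)] at hi; simp at hi

theorem legBits_or (a b : ℕ) : legBits (a ||| b) = legBits a ||| legBits b := by
  apply Nat.eq_of_testBit_eq
  intro i
  simp [legBits_testBit, Nat.testBit_or]

/-- Whether a set of legs can belong to one of the two covers depends only on the doubled legs, the
single legs and their connections, all of which can be read off from the key. -/
theorem okKey_key (t : Bool) (κ : Fin 21 → ℕ) (s : ℕ) : okKey (key t κ) s =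
    (fits (legBits (dbl κ)) (legBits (dbl κ ||| sgl κ)) s &&
      listAll (fun m => compatMask s (m &&& legBits (sgl κ))) (compMasks t (sgl κ))) := by
  have h1 : okKey (key t κ) s =
    (fits (key t κ &&& 63) ((key t κ &&& 63) ||| ((key t κ >>> 6) &&& 63)) s &&
      listAll (fun l => !(Nat.testBit (key t κ) (12 + l)) || compatMask s l) (List.range 64)) := rfl
  rw [h1, key_land_dbl, key_land_sgl, legBits_or]
  congr 1
  rw [Bool.eq_iff_iff, listAll_iff, listAll_iff]
  constructor
  · intro h m hm
    by_cases h0 : m &&& legBits (sgl κ) = 0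
    · rw [h0]; rfl
    · have h2 := h (m &&& legBits (sgl κ)) (List.mem_range.2
        (lt_of_le_of_lt Nat.and_le_right (legBits_lt (ofBits_lt _))))
      have h3 : (key t κ).testBit (12 + (m &&& legBits (sgl κ))) = true := by
        rw [key_testBit_code, codeOf_testBit]; exact ⟨m, hm, h0, rfl⟩
      simpa [h3] using h2
  · intro h l _
    cases h2 : (key t κ).testBit (12 + l)
    · simp
    · rw [key_testBit_code, codeOf_testBit] at h2
      obtain ⟨m, hm, _, rfl⟩ := h2
      simpa using h m hm

/-- The set of legs of a set of edges, as a mask. -/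
def legMask (N : Fin 21 → Bool) : ℕ := legBits (Nat.ofBits N)

theorem legMask_testBit (N : Fin 21 → Bool) (k : Fin 6) :
    (legMask N).testBit k.1 = N (leg k) := by
  rw [legMask, legBits_testBit]
  exact Nat.testBit_ofBits_lt _ _ (leg k).2

theorem legMask_eq_iff (N N' : Fin 21 → Bool) :
    legMask N = legMask N' ↔ ∀ k, N (leg k) = N' (leg k) := by
  constructor
  · intro h k
    rw [← legMask_testBit N, h, legMask_testBit]
  · intro h
    apply Nat.eq_of_testBit_eq
    intro i
    by_cases hi : i < 6
    · have := h ⟨i, hi⟩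
      rw [← legMask_testBit N, ← legMask_testBit N'] at this
      exact this
    · rw [legMask, legMask, testBit_of_lt_64 (legBits_lt (ofBits_lt _)) (by omega),
        testBit_of_lt_64 (legBits_lt (ofBits_lt _)) (by omega)]

/-- The dimer covers of the patch. -/
def patchCovers (t : Bool) : Finset (Fin 21 → Bool) := (matchings t).toFinset.image ofMask

theorem mem_patchCovers {t : Bool} {N : Fin 21 → Bool} : N ∈ patchCovers t ↔ IsPatchCover t N := by
  rw [patchCovers, Finset.mem_image]
  constructor
  · rintro ⟨m, hm, rfl⟩
    exact isPatchCover_of_mem t m (List.mem_toFinset.1 hm)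
  · intro h
    exact ⟨_, List.mem_toFinset.2 (ofBits_mem_matchings h), ofMask_ofBits N⟩

theorem nodup_matchings (t : Bool) : (matchings t).Nodup := by
  revert t; decide +kernel

-- In a decomposition each inner loop alternates between the two covers in one of two ways, and each
-- path through the patch alternates as its legs prescribe. The count is obtained from the verified
-- `countTest`.
open Classical in
theorem card_decompositions {t : Bool} {κ : Fin 21 → ℕ} (hκ : IsPatchConfig t κ) {s : ℕ}
    (hs : s ∈ legSets) :
    ((patchCovers t).filter fun N => SubCfg κ N ∧ legMask N = s).card =
      if okKey (key t κ) s = true then 2 ^ loopNum t (sgl κ) else 0 := by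
  have h1 : ((patchCovers t).filter fun N => SubCfg κ N ∧ legMask N = s).card =
      listCount (fun N => (legBits N).beq s)
        (listFilter (fits (dbl κ) (dbl κ ||| sgl κ)) (matchings t)) := by
    rw [listCount_eq, listFilter_eq, List.countP_eq_length_filter, List.filter_filter,
      ← List.toFinset_card_of_nodup ((nodup_matchings t).filter _)]
    symm
    refine Finset.card_bij (fun m _ => ofMask m) ?_ ?_ ?_
    · intro m hm
      rw [List.mem_toFinset, List.mem_filter, Bool.and_eq_true, Nat.beq_eq] at hm
      have hlt := ofBits_ofMask (lt_of_mem_matchings t m hm.1)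
      rw [Finset.mem_filter, mem_patchCovers, ← fits_iff_subCfg, legMask, hlt]
      exact ⟨isPatchCover_of_mem t m hm.1, hm.2.2, hm.2.1⟩
    · intro m hm m' hm' h
      rw [List.mem_toFinset, List.mem_filter] at hm hm'
      rw [← ofBits_ofMask (lt_of_mem_matchings t m hm.1), h,
        ofBits_ofMask (lt_of_mem_matchings t m' hm'.1)]
    · intro N hN
      rw [Finset.mem_filter, mem_patchCovers, ← fits_iff_subCfg] at hN
      refine ⟨Nat.ofBits N, ?_, ofMask_ofBits N⟩
      rw [List.mem_toFinset, List.mem_filter, Bool.and_eq_true, Nat.beq_eq]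
      exact ⟨ofBits_mem_matchings hN.1, hN.2.2, hN.2.1⟩
  have h2 := hκ.tests.2.2
  rw [countTest, listAll_iff] at h2
  have h3 := h2 s hs
  rw [okKey_key]
  have hl : Nat.lor (dbl κ) (sgl κ) = dbl κ ||| sgl κ := rfl
  rw [hl] at h3
  cases h4 : fits (legBits (dbl κ)) (legBits (dbl κ ||| sgl κ)) s
  -- `countTest` says nothing about sets of legs that do not fit, but for these both sides vanish: a
  -- subconfiguration contains all doubled legs and only legs of the support.
  · simp only [Bool.false_and, Bool.false_eq_true, if_false, Finset.card_eq_zero]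
    rw [Finset.filter_eq_empty_iff]
    rintro N - ⟨hN, rfl⟩
    rw [← fits_iff_subCfg, fits_iff] at hN
    rw [← Bool.not_eq_true, fits_iff] at h4
    refine h4 ⟨fun i hi => ?_, fun i hi => ?_⟩
    · rw [legMask, legBits_testBit]; rw [legBits_testBit] at hi; exact hN.1 _ hi
    · rw [legMask, legBits_testBit] at hi; rw [legBits_testBit]; exact hN.2 _ hi
  · rw [h4, cond_true, Nat.beq_eq] at h3
    rw [h1, h3, Bool.true_and]
    have hm : (fun m => compatMask s (Nat.land m (legBits (sgl κ)))) =
      fun m => compatMask s (m &&& legBits (sgl κ)) := rfl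
    rw [hm]
    cases listAll (fun m => compatMask s (m &&& legBits (sgl κ))) (compMasks t (sgl κ)) <;> simp

theorem subCfg_left (N₁ N₂ : Fin 21 → Bool) : SubCfg (cfg N₁ N₂) N₁ := by
  intro e
  rw [cfg]
  cases N₁ e <;> cases N₂ e <;> simp

/-- The complement of a cover in a configuration is a cover. -/
theorem exists_complement {t : Bool} {κ : Fin 21 → ℕ} (hκ : IsPatchConfig t κ)
    {N : Fin 21 → Bool} (hN : IsPatchCover t N) (hs : SubCfg κ N) :
    ∃ N', IsPatchCover t N' ∧ κ = cfg N N' := by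
  have hle := hκ.le
  obtain ⟨N₁, N₂, h₁, h₂, rfl⟩ := hκ
  -- Since `N` contains the doubled edges and lies in the support, the remaining multiplicity on
  -- each edge is `0` or `1`, and it is `1` exactly when `N` does not exhaust the edge.
  have hN' : cfg N₁ N₂ = cfg N fun e => decide (cfg N₁ N₂ e ≠ (N e).toNat) := by
    funext e
    have h1 := hs e
    have h2 := hle e
    rw [cfg.eq_def N]
    generalize cfg N₁ N₂ e = c at h1 h2
    interval_cases c <;> cases h : N e <;> simp_all
  refine ⟨_, fun a => ?_, hN'⟩
  -- Degrees at the node `a` are compared: the configuration has degree `2` there and `N` has degree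
  -- `1`, which leaves degree `1` for the complement.
  have h3 := congrArg (fun κ : Fin 21 → ℕ =>
    ∑ e, if Inc t e (a.castLE (by norm_num)) then κ e else 0) hN'
  have key : ∀ M M' : Fin 21 → Bool,
      (∑ e, if Inc t e (a.castLE (by norm_num)) then cfg M M' e else 0) =
      (∑ e, if Inc t e (a.castLE (by norm_num)) then (M e).toNat else 0) +
      ∑ e, if Inc t e (a.castLE (by norm_num)) then (M' e).toNat else 0 := by
    intro M M'
    rw [← Finset.sum_add_distrib]
    refine Finset.sum_congr rfl fun e _ => ?_
    split_ifs <;> simp [cfg]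
  simp only [key] at h3
  rw [h₁ a, h₂ a, hN a] at h3
  omega

theorem legMask_mem_legSets {t : Bool} {N : Fin 21 → Bool} (hN : IsPatchCover t N) :
    legMask N ∈ legSets := legBits_mem_legSets t _ (ofBits_mem_matchings hN)

/-- The cover `N₁` is itself among the objects counted by `card_decompositions`, so the count is not
zero. -/
theorem okKey_of_decomposition {t : Bool} {N₁ N₂ : Fin 21 → Bool} (h₁ : IsPatchCover t N₁)
    (h₂ : IsPatchCover t N₂) : okKey (key t (cfg N₁ N₂)) (legMask N₁) = true := by
  classical
  have h := card_decompositions ⟨N₁, N₂, h₁, h₂, rfl⟩ (legMask_mem_legSets h₁)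
  by_contra hcon
  rw [if_neg hcon, Finset.card_eq_zero, Finset.filter_eq_empty_iff] at h
  exact h (mem_patchCovers.2 h₁) ⟨subCfg_left N₁ N₂, rfl⟩

/-- Configurations with the same key have decompositions with the same legs. -/
theorem exists_decomposition_of_key {t t' : Bool} {N₁ N₂ : Fin 21 → Bool}
    (h₁ : IsPatchCover t N₁) (h₂ : IsPatchCover t N₂) {κ : Fin 21 → ℕ}
    (hκ : IsPatchConfig t' κ) (h : key t (cfg N₁ N₂) = key t' κ) :
    ∃ N₁' N₂', IsPatchCover t' N₁' ∧ IsPatchCover t' N₂' ∧ κ = cfg N₁' N₂' ∧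
      (∀ k, N₁' (leg k) = N₁ (leg k)) ∧ ∀ k, N₂' (leg k) = N₂ (leg k) := by
  classical
  have h3 := card_decompositions hκ (legMask_mem_legSets h₁)
  rw [← h, if_pos (okKey_of_decomposition h₁ h₂)] at h3
  have h4 : 0 < ((patchCovers t').filter fun N => SubCfg κ N ∧ legMask N = legMask N₁).card := by
    rw [h3]; positivity
  obtain ⟨N, hN⟩ := Finset.card_pos.1 h4
  rw [Finset.mem_filter, mem_patchCovers] at hN
  obtain ⟨N', hN', he⟩ := exists_complement hκ hN.1 hN.2.1
  have h5 := (legMask_eq_iff _ _).1 hN.2.2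
  refine ⟨N, N', hN.1, hN', he, h5, fun k => ?_⟩
  have h6 := leg_eq_of_key ⟨N₁, N₂, h₁, h₂, rfl⟩ hκ h k
  rw [he, cfg, cfg, h5 k] at h6
  have h7 : (N₂ (leg k)).toNat = (N' (leg k)).toNat := by omega
  revert h7
  cases N₂ (leg k) <;> cases N' (leg k) <;> simp

/-! ### The weights of the patch -/

/-- The edges of the patch on the boundary of a face. The faces `k < 6` are the corners of the
hexagon, `k` lying between the sides `k` and `k + 1` (legs are not counted), the faces `6 + j`
are the squares, and `9` is the central vertex. -/
def patchFace : Bool → Fin 10 → Finset (Fin 21)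
  | false => ![{12}, {1, 7, 2}, {13}, {3, 9, 4}, {14}, {5, 11, 0},
      {12, 0, 1, 6}, {13, 2, 3, 8}, {14, 4, 5, 10}, {6, 7, 8, 9, 10, 11}]
  | true => ![{0, 6, 1}, {12}, {2, 8, 3}, {13}, {4, 10, 5}, {14},
      {12, 1, 2, 7}, {13, 3, 4, 9}, {14, 5, 0, 11}, {6, 7, 8, 9, 10, 11}]

/-- The number of edges of a face of the patch, minus two for the interior ones. -/
def patchExp : Bool → Fin 10 → ℕ
  | false => ![1, 3, 1, 3, 1, 3, 2, 2, 2, 4]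
  | true => ![3, 1, 3, 1, 3, 1, 2, 2, 2, 4]

variable {F : Type*} [Field F]

/-- The weight of a configuration of the patch. -/
def patchWeight (t : Bool) (a : Fin 10 → F) (κ : Fin 21 → ℕ) : F :=
  ∏ l, a l ^ ((patchExp t l : ℤ) - ∑ e ∈ patchFace t l, (κ e : ℤ))

/-- The weight of an edge. -/
def edgeWeight (t : Bool) (a : Fin 10 → F) (e : Fin 21) : F :=
  ∏ l, if e ∈ patchFace t l then (a l)⁻¹ else 1

/-- The factor is chosen so that its square times `a 0 * ... * a 5` is the product of the `a l ^
patchExp t l`; it absorbs the constant parts of the exponents symmetrically into the two covers. -/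
def coverConst (t : Bool) (a : Fin 10 → F) : F :=
  a 9 ^ 2 * (a 6 * a 7 * a 8) * bif t then a 0 * a 2 * a 4 else a 1 * a 3 * a 5

/-- The weight of a dimer cover of the patch. -/
def coverWeight (t : Bool) (a : Fin 10 → F) (N : Fin 21 → Bool) : F :=
  coverConst t a * ∏ e, if N e = true then edgeWeight t a e else 1

theorem patchWeight_eq {t : Bool} {a : Fin 10 → F} (ha : ∀ l, a l ≠ 0) (κ : Fin 21 → ℕ) :
    patchWeight t a κ = (∏ l, a l ^ patchExp t l) * ∏ e, edgeWeight t a e ^ κ e := by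
  simp only [patchWeight, edgeWeight, ← Finset.prod_pow]
  rw [Finset.prod_comm (s := Finset.univ (α := Fin 21)), ← Finset.prod_mul_distrib]
  refine Finset.prod_congr rfl fun l _ => ?_
  rw [zpow_sub₀ (ha l), zpow_natCast, div_eq_mul_inv]
  congr 1
  have : ∑ e ∈ patchFace t l, (κ e : ℤ) = ((∑ e ∈ patchFace t l, κ e : ℕ) : ℤ) := by push_cast; rfl
  rw [this, zpow_natCast, ← inv_pow, ← Finset.prod_pow_eq_pow_sum]
  simp only [ite_pow, one_pow, Finset.prod_ite_mem, Finset.univ_inter]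

/-- Multiplicities occur linearly in the exponents, so the weight of a union is multiplicative in
the two covers. This is what links double-dimer sums to products of single-dimer sums. -/
theorem patchWeight_cfg {t : Bool} {a : Fin 10 → F} (ha : ∀ l, a l ≠ 0) (N₁ N₂ : Fin 21 → Bool) :
    patchWeight t a (cfg N₁ N₂) =
      (a 0 * a 1 * a 2 * a 3 * a 4 * a 5) * (coverWeight t a N₁ * coverWeight t a N₂) := by
  rw [patchWeight_eq ha]
  have h1 : (∏ l, a l ^ patchExp t l) =
      (a 0 * a 1 * a 2 * a 3 * a 4 * a 5) * (coverConst t a * coverConst t a) := by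
    simp only [Fin.prod_univ_succ, coverConst]
    cases t <;> simp [patchExp, Fin.succ] <;> ring
  have h2 : ∏ e, edgeWeight t a e ^ cfg N₁ N₂ e =
      (∏ e, if N₁ e = true then edgeWeight t a e else 1) *
        ∏ e, if N₂ e = true then edgeWeight t a e else 1 := by
    rw [← Finset.prod_mul_distrib]
    refine Finset.prod_congr rfl fun e _ => ?_
    rw [cfg, pow_add]
    cases N₁ e <;> cases N₂ e <;> simp
  rw [h1, h2, coverWeight, coverWeight]
  ring

open Classical in
/-- The weighted number of dimer covers with given legs. -/
def coverSum (t : Bool) (a : Fin 10 → F) (s : ℕ) : F :=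
  ∑ N ∈ (patchCovers t).filter fun N => legMask N = s, coverWeight t a N

/-- The product of the entries of a list at the positions given by a mask. -/
def maskProd : ℕ → List F → F
  | _, [] => 1
  | m, x :: l => (if m % 2 = 1 then x else 1) * maskProd (m / 2) l

theorem maskProd_ofFn (n : ℕ) : ∀ (m : ℕ) (x : Fin n → F),
    maskProd m (List.ofFn x) = ∏ e, if m.testBit e.1 = true then x e else 1 := by
  induction n with
  | zero => intro m x; simp [maskProd]
  | succ n ih =>
    intro m x
    rw [List.ofFn_succ, maskProd, ih, Fin.prod_univ_succ]
    simp [Nat.testBit_succ, Nat.testBit_zero]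

theorem matchings_false : matchings false = [63, 17423, 1573903, 786983, 8499, 25859, 1582339, 393523, 410883, 1967363, 598689, 196793,
  214153, 1770633, 983713, 4220, 21580, 1578060, 791140, 12656, 30016, 31360, 1586496, 1587840, 1185944, 397680, 415040,
  416384, 1971520, 1972864, 1083422, 313862, 1870342, 1091858, 1476882, 98428, 115788, 1672268, 885348, 106864, 124224,
  125568, 1680704, 1682048, 1280152, 491888, 509248, 510592, 2065728, 2067072] := by decide +kernel

theorem matchings_true : matchings true = [63, 1573903, 8743, 786983, 1189123, 393523, 1967363, 4281, 1578121, 12961, 791201, 196793, 1770633, 205473, 983713,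
  18462, 27142, 805382, 411922, 22680, 30016, 31360, 808256, 809600, 607308, 215192, 222528, 223872, 1000768, 1002112,
  1083422, 1092102, 1870342, 1476882, 1087640, 1094976, 1096320, 299376, 1873216, 1874560, 98428, 1672268, 107108,
  885348, 1280152, 1287488, 1288832, 491888, 2065728, 2067072] := by decide +kernel

/-- This brings the sum into a form that can be evaluated from the explicit list of matchings, one
monomial for each. -/
theorem coverSum_eq (t : Bool) (a : Fin 10 → F) (s : ℕ) : coverSum t a s = coverConst t a *
    (((matchings t).filter fun m => (legBits m).beq s).map fun m =>
      maskProd m (List.ofFn fun e : Fin 15 => edgeWeight t a (e.castLE (by norm_num)))).sum := by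
  classical
  rw [coverSum, patchCovers, Finset.filter_image, Finset.sum_image]
  · rw [← List.sum_toFinset _ ((nodup_matchings t).filter _), List.toFinset_filter, Finset.mul_sum]
    refine Finset.sum_congr ?_ fun m hm => ?_
    · ext m
      simp only [Finset.mem_filter, List.mem_toFinset, Nat.beq_eq]
      refine and_congr_right fun hm => ?_
      rw [legMask, ofBits_ofMask (lt_of_mem_matchings t m hm)]
    · rw [coverWeight, maskProd_ofFn]
      congr 1
      refine (Fin.prod_univ_add (a := 15) (b := 6) fun e : Fin 21 =>
        if ofMask m e = true then edgeWeight t a e else 1).trans ?_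
      -- Legs belong to no `patchFace`, so they have weight `1` and only the fifteen inner edges
      -- matter.
      have : ∏ i : Fin 6, (if ofMask m (Fin.natAdd 15 i) = true then edgeWeight t a (Fin.natAdd 15 i) else 1) = 1 := by
        refine Finset.prod_eq_one fun i _ => ?_
        have h : ∀ (t : Bool) (i : Fin 6) (l : Fin 10), Fin.natAdd 15 i ∉ patchFace t l := by decide +kernel
        simp [edgeWeight, h]
      rw [this, mul_one]
      rfl
  · intro m hm m' hm' h
    simp only [Finset.coe_filter, List.mem_toFinset, Set.mem_ofPred_eq] at hm hm'
    rw [← ofBits_ofMask (lt_of_mem_matchings t m hm.1), h,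
        ofBits_ofMask (lt_of_mem_matchings t m' hm'.1)]

theorem ofFn_edgeWeight (t : Bool) (z q₀ q₁ q₂ u₀ u₁ u₂ u₃ u₄ u₅ : F) :
    List.ofFn (fun e : Fin 15 => edgeWeight t ![u₀, u₁, u₂, u₃, u₄, u₅, q₀, q₁, q₂, z]
      (e.castLE (by norm_num))) =
    bif t then
      [u₀⁻¹ * q₂⁻¹, u₀⁻¹ * q₀⁻¹, u₂⁻¹ * q₀⁻¹, u₂⁻¹ * q₁⁻¹, u₄⁻¹ * q₁⁻¹, u₄⁻¹ * q₂⁻¹,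
        u₀⁻¹ * z⁻¹, q₀⁻¹ * z⁻¹, u₂⁻¹ * z⁻¹, q₁⁻¹ * z⁻¹, u₄⁻¹ * z⁻¹, q₂⁻¹ * z⁻¹,
        u₁⁻¹ * q₀⁻¹, u₃⁻¹ * q₁⁻¹, u₅⁻¹ * q₂⁻¹]
    else
      [u₅⁻¹ * q₀⁻¹, u₁⁻¹ * q₀⁻¹, u₁⁻¹ * q₁⁻¹, u₃⁻¹ * q₁⁻¹, u₃⁻¹ * q₂⁻¹, u₅⁻¹ * q₂⁻¹,
        q₀⁻¹ * z⁻¹, u₁⁻¹ * z⁻¹, q₁⁻¹ * z⁻¹, u₃⁻¹ * z⁻¹, q₂⁻¹ * z⁻¹, u₅⁻¹ * z⁻¹,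
        u₀⁻¹ * q₀⁻¹, u₂⁻¹ * q₁⁻¹, u₄⁻¹ * q₂⁻¹] := by
  simp only [edgeWeight, Fin.prod_univ_succ, List.ofFn_succ, patchFace]
  cases t <;> simp [Fin.succ]

set_option maxHeartbeats 4000000 in
/-- The weighted numbers of dimer covers agree for both patches, by the recurrence. -/
theorem coverSum_false_eq_true (z q₀ q₁ q₂ h p₀ p₁ p₂ u₀ u₁ u₂ u₃ u₄ u₅ : F) (hz : z ≠ 0)
    (hq₀ : q₀ ≠ 0) (hq₁ : q₁ ≠ 0) (hq₂ : q₂ ≠ 0) (hh : h ≠ 0) (hp₀ : p₀ ≠ 0) (hp₁ : p₁ ≠ 0)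
    (hp₂ : p₂ ≠ 0) (h₀ : u₀ ≠ 0) (h₁ : u₁ ≠ 0) (h₂ : u₂ ≠ 0) (h₃ : u₃ ≠ 0) (h₄ : u₄ ≠ 0)
    (h₅ : u₅ ≠ 0)
    (e₀ : q₀ = (p₁ * p₂ * p₀ + u₀ * u₂ * u₄ + h * u₀ * u₃) / (p₁ * h))
    (e₁ : q₁ = (p₁ * p₂ * p₀ + u₀ * u₂ * u₄ + h * u₂ * u₅) / (p₂ * h))
    (e₂ : q₂ = (p₁ * p₂ * p₀ + u₀ * u₂ * u₄ + h * u₄ * u₁) / (p₀ * h))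
    (e₃ : z = ((p₁ * p₂ * p₀) ^ 2 +
      p₁ * p₂ * p₀ * (2 * u₀ * u₂ * u₄ + h * u₀ * u₃ + h * u₂ * u₅ + h * u₄ * u₁) +
      (u₀ * u₂ + h * u₁) * (u₀ * u₄ + h * u₅) * (u₂ * u₄ + h * u₃)) / (h ^ 2 * p₁ * p₂ * p₀))
    {s : ℕ} (hs : s ∈ legSets) :
    coverSum false ![u₀, u₁, u₂, u₃, u₄, u₅, q₀, q₁, q₂, z] s =
      coverSum true ![u₀, u₁, u₂, u₃, u₄, u₅, p₀, p₁, p₂, h] s := by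
  have c₁ : coverConst false ![u₀, u₁, u₂, u₃, u₄, u₅, q₀, q₁, q₂, z] =
    z ^ 2 * (q₀ * q₁ * q₂) * (u₁ * u₃ * u₅) := rfl
  have c₂ : coverConst true ![u₀, u₁, u₂, u₃, u₄, u₅, p₀, p₁, p₂, h] =
    h ^ 2 * (p₀ * p₁ * p₂) * (u₀ * u₂ * u₄) := rfl
  rw [coverSum_eq, coverSum_eq, c₁, c₂, matchings_false, matchings_true]
  simp only [ofFn_edgeWeight, cond_true, cond_false]
  have ns : ∀ m k : ℕ, Nat.shiftRight m k = m >>> k := fun _ _ => rfl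
  simp only [legSets, List.mem_cons, List.not_mem_nil, or_false] at hs
  clear c₁ c₂
  rcases hs with rfl | rfl | rfl | rfl | rfl | rfl | rfl | rfl | rfl | rfl | rfl | rfl | rfl |
    rfl | rfl | rfl | rfl | rfl | rfl | rfl
  all_goals
    simp only [legBits, ns, Nat.reduceShiftRight, List.filter, Nat.beq]
    simp only [maskProd, Nat.reduceMod, Nat.reduceDiv, reduceIte, zero_ne_one, one_mul, mul_one,
      List.map_cons, List.map_nil, List.sum_cons, List.sum_nil, add_zero]
    field_simp
  all_goals
    -- Denominators were first cleared with the upper values as nonzero atoms. Now the upper values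
    -- are expressed by the lower ones, and the remaining denominators contain only lower variables,
    -- so that each of the twenty cases becomes a polynomial identity.
    subst e₀ e₁ e₂ e₃
    field_simp
    ring

attribute [local irreducible] matchings keyList patchCovers key okKey sameLegs legSets legMask loopNum

/-! ### The weighted sum over the configurations of the patch with a given key -/

theorem mem_collectKeys (f : ℕ → ℕ) (L : List ℕ) : ∀ (acc : List ℕ) (k : ℕ),
    k ∈ collectKeys f L acc ↔ k ∈ acc ∨ ∃ a ∈ L, f a = k := by
  induction L with
  | nil => intro acc k; simp [collectKeys]
  | cons x l ih =>
    intro acc k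
    have : collectKeys f (x :: l) acc = bif listMem (f x) acc then collectKeys f l acc
      else collectKeys f l (f x :: acc) := rfl
    rw [this]
    cases h : listMem (f x) acc
    · rw [cond_false, ih]
      simp only [List.mem_cons, exists_eq_or_imp]
      constructor
      · rintro ((rfl | h) | h)
        exacts [Or.inr (Or.inl rfl), Or.inl h, Or.inr (Or.inr h)]
      · rintro (h | rfl | h)
        exacts [Or.inl (Or.inr h), Or.inl (Or.inl rfl), Or.inr h]
    · rw [listMem_iff] at h
      rw [cond_true, ih]
      simp only [List.mem_cons, exists_eq_or_imp]
      constructor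
      · rintro (h | h)
        exacts [Or.inl h, Or.inr (Or.inr h)]
      · rintro (h | rfl | h')
        exacts [Or.inl h, Or.inl h, Or.inr h']

theorem mem_keyListFrom (L : List ℕ) : ∀ (acc : List ℕ) (k : ℕ), k ∈ keyListFrom L acc ↔
    k ∈ acc ∨ ∃ a ∈ L, ∃ b ∈ L, codeKey false (a &&& b) (a ^^^ b) = k := by
  induction L with
  | nil => intro acc k; simp [keyListFrom]
  | cons x l ih =>
    intro acc k
    have : keyListFrom (x :: l) acc = keyListFrom l
      (collectKeys (fun b => codeKey false (x &&& b) (x ^^^ b)) (x :: l) acc) := rfl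
    rw [this, ih, mem_collectKeys]
    constructor
    · rintro ((h | ⟨b, hb, h⟩) | ⟨a, ha, b, hb, h⟩)
      · exact Or.inl h
      · exact Or.inr ⟨x, List.mem_cons_self, b, hb, h⟩
      · exact Or.inr ⟨a, List.mem_cons_of_mem _ ha, b, List.mem_cons_of_mem _ hb, h⟩
    · rintro (h | ⟨a, ha, b, hb, h⟩)
      · exact Or.inl (Or.inl h)
      · rcases List.mem_cons.1 ha with rfl | ha'
        · exact Or.inl (Or.inr ⟨b, hb, h⟩)
        · rcases List.mem_cons.1 hb with rfl | hb'
          · refine Or.inl (Or.inr ⟨a, ha, ?_⟩)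
            rwa [Nat.land_comm, Nat.xor_comm]
          · exact Or.inr ⟨a, ha', b, hb', h⟩

theorem toNat_injective {a b : Bool} (h : a.toNat = b.toNat) : a = b := by
  revert a b; decide

/-- The double-dimer configurations of the patch. -/
def patchConfigs (t : Bool) : Finset (Fin 21 → ℕ) :=
  (patchCovers t ×ˢ patchCovers t).image fun p => cfg p.1 p.2

theorem mem_patchConfigs {t : Bool} {κ : Fin 21 → ℕ} :
    κ ∈ patchConfigs t ↔ IsPatchConfig t κ := by
  simp only [patchConfigs, Finset.mem_image, Finset.mem_product, mem_patchCovers, Prod.exists,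
    IsPatchConfig]
  constructor
  · rintro ⟨N₁, N₂, ⟨h₁, h₂⟩, rfl⟩; exact ⟨N₁, N₂, h₁, h₂, rfl⟩
  · rintro ⟨N₁, N₂, h₁, h₂, rfl⟩; exact ⟨N₁, N₂, ⟨h₁, h₂⟩, rfl⟩

theorem key_mem_keyList {t : Bool} {κ : Fin 21 → ℕ} (hκ : IsPatchConfig t κ) :
    key t κ ∈ keyList := by
  obtain ⟨N₁, N₂, h₁, h₂, rfl⟩ := hκ
  rw [key, dbl_cfg, sgl_cfg]
  cases t
  · rw [keyList]
    exact (mem_keyListFrom _ _ _).2 (Or.inr ⟨_, ofBits_mem_matchings h₁, _,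
      ofBits_mem_matchings h₂, rfl⟩)
  · have h := keyTest
    rw [Bool.and_eq_true] at h
    rw [← listMem_iff]
    exact allPairs_spec h.1 _ (ofBits_mem_matchings h₁) _ (ofBits_mem_matchings h₂)

theorem exists_of_mem_keyList {k : ℕ} (hk : k ∈ keyList) :
    ∃ κ, IsPatchConfig false κ ∧ key false κ = k := by
  rw [keyList, mem_keyListFrom] at hk
  rcases hk with hk | ⟨a, ha, b, hb, h⟩
  · simp at hk
  · refine ⟨_, ⟨ofMask a, ofMask b, isPatchCover_of_mem _ _ ha, isPatchCover_of_mem _ _ hb, rfl⟩, ?_⟩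
    rw [key, dbl_cfg, sgl_cfg, ofBits_ofMask (lt_of_mem_matchings _ _ ha),
      ofBits_ofMask (lt_of_mem_matchings _ _ hb), h]

theorem sameLegs_iff {t t' : Bool} {κ κ' : Fin 21 → ℕ} (hκ : IsPatchConfig t κ)
    (hκ' : IsPatchConfig t' κ') :
    sameLegs (key t κ) (key t' κ') = true ↔ ∀ k, κ (leg k) = κ' (leg k) := by
  rw [sameLegs, Nat.beq_eq]
  change key t κ &&& 4095 = key t' κ' &&& 4095 ↔ _
  have h12 : (4095 : ℕ) = 2 ^ 12 - 1 := rfl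
  constructor
  · intro h k
    have aux : ∀ i < 12, (key t κ).testBit i = (key t' κ').testBit i := by
      intro i hi
      have := congrArg (fun n => n.testBit i) h
      simp only [Nat.testBit_and, h12, Nat.testBit_two_pow_sub_one] at this
      simpa [hi] using this
    have h1 := aux k.1 (by omega)
    rw [key_testBit_dbl _ _ k.2, key_testBit_dbl _ _ k.2, Bool.eq_iff_iff, dbl_leg, dbl_leg] at h1
    have h2 := aux (6 + k.1) (by omega)
    rw [key_testBit_sgl _ _ k.2, key_testBit_sgl _ _ k.2, Bool.eq_iff_iff, sgl_leg, sgl_leg] at h2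
    have h3 := hκ.le (leg k)
    have h4 := hκ'.le (leg k)
    omega
  · intro h
    apply Nat.eq_of_testBit_eq
    intro i
    rw [Nat.testBit_and, Nat.testBit_and, h12, Nat.testBit_two_pow_sub_one]
    by_cases hi : i < 12
    · simp only [hi, decide_true, Bool.and_true]
      by_cases hi6 : i < 6
      · rw [key_testBit_dbl _ _ hi6, key_testBit_dbl _ _ hi6, Bool.eq_iff_iff,
          dbl_leg κ ⟨i, hi6⟩, dbl_leg κ' ⟨i, hi6⟩, h]
      · obtain ⟨j, rfl⟩ : ∃ j, i = 6 + j := ⟨i - 6, by omega⟩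
        have hj : j < 6 := by omega
        rw [key_testBit_sgl _ _ hj, key_testBit_sgl _ _ hj, Bool.eq_iff_iff,
          sgl_leg κ ⟨j, hj⟩, sgl_leg κ' ⟨j, hj⟩, h]
    · simp [hi]

variable {F : Type*} [Field F]

/-- The sum over the configurations with a given key. -/
def keySum (t : Bool) (a : Fin 10 → F) (k : ℕ) : F :=
  ∑ κ ∈ (patchConfigs t).filter fun κ => key t κ = k, 2 ^ loopNum t (sgl κ) * patchWeight t a κ

/-- When the product of the two cover sums is expanded, a pair of covers contributes the weight of
its union. The unions that occur are the configurations with the prescribed leg multiplicities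
compatible with the legs of `N₁`, and each arises from exactly `2 ^ loopNum` pairs. -/
theorem sum_filter_sameLegs {t : Bool} {a : Fin 10 → F} (ha : ∀ l, a l ≠ 0)
    {N₁ N₂ : Fin 21 → Bool} (h₁ : IsPatchCover false N₁) (h₂ : IsPatchCover false N₂) :
    ∑ κ ∈ (patchConfigs t).filter fun κ => sameLegs (key false (cfg N₁ N₂)) (key t κ) = true ∧
      okKey (key t κ) (legMask N₁) = true, 2 ^ loopNum t (sgl κ) * patchWeight t a κ =
    (a 0 * a 1 * a 2 * a 3 * a 4 * a 5) *
      (coverSum t a (legMask N₁) * coverSum t a (legMask N₂)) := by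
  classical
  rw [coverSum, coverSum, Finset.sum_mul_sum, Finset.mul_sum]
  simp only [Finset.mul_sum, ← patchWeight_cfg ha]
  rw [← Finset.sum_product']
  set P := (patchCovers t).filter (fun N => legMask N = legMask N₁) ×ˢ
    (patchCovers t).filter (fun N => legMask N = legMask N₂) with hP
  set Q := (patchConfigs t).filter fun κ => sameLegs (key false (cfg N₁ N₂)) (key t κ) = true ∧
      okKey (key t κ) (legMask N₁) = true with hQ
  have hmaps : ∀ p ∈ P, cfg p.1 p.2 ∈ Q := by
    rintro ⟨M₁, M₂⟩ hp
    simp only [hP, Finset.mem_product, Finset.mem_filter, mem_patchCovers] at hp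
    obtain ⟨⟨h1, h2⟩, h3, h4⟩ := hp
    rw [hQ, Finset.mem_filter, mem_patchConfigs,
      sameLegs_iff ⟨N₁, N₂, h₁, h₂, rfl⟩ ⟨M₁, M₂, h1, h3, rfl⟩, ← h2]
    refine ⟨⟨M₁, M₂, h1, h3, rfl⟩, fun k => ?_, okKey_of_decomposition h1 h3⟩
    rw [cfg, cfg, (legMask_eq_iff _ _).1 h2, (legMask_eq_iff _ _).1 h4]
  rw [← Finset.sum_fiberwise_of_maps_to hmaps]
  refine Finset.sum_congr rfl fun κ hκ => ?_
  rw [hQ, Finset.mem_filter, mem_patchConfigs] at hκ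
  obtain ⟨hκ, hsame, hok⟩ := hκ
  rw [sameLegs_iff ⟨N₁, N₂, h₁, h₂, rfl⟩ hκ] at hsame
  rw [Finset.sum_congr rfl (g := fun _ => patchWeight t a κ) fun p hp => by
    rw [(Finset.mem_filter.1 hp).2], Finset.sum_const, nsmul_eq_mul]
  congr 1
  have hcard := card_decompositions hκ (legMask_mem_legSets h₁)
  rw [if_pos hok] at hcard
  -- The first cover of a pair determines the second one as its complement in `κ`, so the pairs over
  -- `κ` are counted by `card_decompositions`.
  have : (P.filter fun p => cfg p.1 p.2 = κ).card = 2 ^ loopNum t (sgl κ) := by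
    rw [← hcard]
    refine Finset.card_bij (fun p _ => p.1) ?_ ?_ ?_
    · rintro ⟨M₁, M₂⟩ hp
      simp only [hP, Finset.mem_product, Finset.mem_filter] at hp ⊢
      refine ⟨hp.1.1.1, ?_, hp.1.1.2⟩
      rw [← hp.2]
      exact subCfg_left _ _
    · rintro ⟨M₁, M₂⟩ hp ⟨M₁', M₂'⟩ hp' h
      simp only [Finset.mem_filter] at hp hp' h
      subst h
      have h3 := hp.2.trans hp'.2.symm
      refine Prod.ext rfl ?_
      funext e
      have h4 := congrFun h3 e
      simp only [cfg] at h4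
      have h5 : (M₂ e).toNat = (M₂' e).toNat := by omega
      exact toNat_injective h5
    · intro M₁ hM
      rw [Finset.mem_filter, mem_patchCovers] at hM
      obtain ⟨M₂, hM₂, he⟩ := exists_complement hκ hM.1 hM.2.1
      refine ⟨(M₁, M₂), ?_, rfl⟩
      simp only [hP, Finset.mem_product, Finset.mem_filter, mem_patchCovers]
      refine ⟨⟨⟨hM.1, hM.2.2⟩, hM₂, ?_⟩, he.symm⟩
      rw [legMask_eq_iff]
      intro k
      have h4 := hsame k
      have h6 := (legMask_eq_iff _ _).1 hM.2.2 k
      rw [he, cfg, cfg, h6] at h4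
      have h5 : (N₂ (leg k)).toNat = (M₂ (leg k)).toNat := by omega
      exact (toNat_injective h5).symm
  rw [this]
  push_cast
  rfl

theorem sum_keySum (t : Bool) (a : Fin 10 → F) (p : ℕ → Prop) [DecidablePred p] :
    ∑ k ∈ keyList.toFinset.filter p, keySum t a k =
      ∑ κ ∈ (patchConfigs t).filter fun κ => p (key t κ),
        2 ^ loopNum t (sgl κ) * patchWeight t a κ := by
  classical
  have hmaps : ∀ κ ∈ (patchConfigs t).filter fun κ => p (key t κ),
      key t κ ∈ keyList.toFinset.filter p := by
    intro κ hκ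
    rw [Finset.mem_filter, mem_patchConfigs] at hκ
    rw [Finset.mem_filter, List.mem_toFinset]
    exact ⟨key_mem_keyList hκ.1, hκ.2⟩
  rw [← Finset.sum_fiberwise_of_maps_to hmaps]
  refine Finset.sum_congr rfl fun k hk => ?_
  rw [keySum, Finset.filter_filter]
  refine Finset.sum_congr ?_ fun _ _ => rfl
  ext κ
  simp only [Finset.mem_filter]
  refine and_congr_right fun _ => ⟨fun h => ⟨?_, h⟩, fun h => h.2⟩
  rw [h]
  exact (Finset.mem_filter.1 hk).2

/-- If the weighted numbers of dimer covers of the two patches agree, then so do the weighted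
sums over the configurations with a given key. -/
theorem keySum_eq_of_coverSum_eq {a a' : Fin 10 → F} (ha : ∀ l, a l ≠ 0) (ha' : ∀ l, a' l ≠ 0)
    (hu : a 0 * a 1 * a 2 * a 3 * a 4 * a 5 = a' 0 * a' 1 * a' 2 * a' 3 * a' 4 * a' 5)
    (h : ∀ s ∈ legSets, coverSum false a s = coverSum true a' s) {k : ℕ} (hk : k ∈ keyList) :
    keySum false a k = keySum true a' k := by
  classical
  -- The linear system: a key with a compatible set of legs `s` is realised by covers `N₁`, `N₂` of
  -- the first patch, and equality of the products of their cover sums becomes one equation for the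
  -- differences of the key sums.
  have h1 : ∀ k ∈ keyList, ∀ s ∈ legSets, okKey k s = true →
      ∑ k' ∈ keyList.toFinset.filter (fun k' => sameLegs k k' = true ∧ okKey k' s = true),
        (keySum false a k' - keySum true a' k') = 0 := by
    intro k hk s hs hok
    obtain ⟨κ, hκ, rfl⟩ := exists_of_mem_keyList hk
    have hc := card_decompositions hκ hs
    rw [if_pos hok] at hc
    have hpos : 0 < 2 ^ loopNum false (sgl κ) := by positivity
    rw [← hc] at hpos
    obtain ⟨N₁, hN₁⟩ := Finset.card_pos.1 hpos
    rw [Finset.mem_filter, mem_patchCovers] at hN₁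
    obtain ⟨hN₁, hsub, rfl⟩ := hN₁
    obtain ⟨N₂, hN₂, rfl⟩ := exists_complement hκ hN₁ hsub
    rw [Finset.sum_sub_distrib, sum_keySum, sum_keySum, sum_filter_sameLegs ha hN₁ hN₂,
      sum_filter_sameLegs ha' hN₁ hN₂, hu, h _ hs, h _ (legMask_mem_legSets hN₂), sub_self]
  -- One elimination step: in the equation for `k` and `s`, every key other than `k` has a
  -- difference already known to vanish.
  have h2 : ∀ (ok : ℕ → Bool), (∀ k ∈ keyList, ok k = true → keySum false a k - keySum true a' k = 0) →
      ∀ k ∈ keyList, (∃ s ∈ legSets, soleKey ok k s = true) →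
        keySum false a k - keySum true a' k = 0 := by
    rintro ok hok k hk ⟨s, hs, hsole⟩
    rw [soleKey, Bool.and_eq_true, listAll_iff] at hsole
    obtain ⟨hks, hsole⟩ := hsole
    rw [← h1 k hk s hs hks]
    symm
    apply Finset.sum_eq_single k
    · intro k' hk' hne
      rw [Finset.mem_filter, List.mem_toFinset] at hk'
      have := hsole k' hk'.1
      simp only [hk'.2.1, hk'.2.2, Bool.not_true, Bool.false_or, Bool.or_false,
        Bool.or_eq_true, Nat.beq_eq, hne, false_or] at this
      exact hok k' hk'.1 this
    · intro hcon
      exfalso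
      apply hcon
      rw [Finset.mem_filter, List.mem_toFinset]
      refine ⟨hk, ?_, hks⟩
      rw [sameLegs, Nat.beq_eq]
  -- In the first round nothing is known yet, so `k` must be the only key in its equation.
  have h3 : ∀ k ∈ keyList, determined₁ k = true → keySum false a k - keySum true a' k = 0 := by
    intro k hk hd
    rw [determined₁, List.any_eq_true] at hd
    exact h2 (fun _ => false) (by simp) k hk hd
  have h4 := keyTest
  rw [Bool.and_eq_true] at h4
  have h5 := (listAll_iff _ _).1 h4.2 k hk
  rw [determined₂, Bool.or_eq_true, List.any_eq_true] at h5
  rw [← sub_eq_zero]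
  rcases h5 with h5 | h5
  · exact h3 k hk h5
  · exact h2 _ h3 k hk h5

/-- The values at the labels of the patch satisfy the hexahedron recurrence. -/
def PatchRecurrence (a a' : Fin 10 → F) : Prop :=
  (∀ k : Fin 10, k.1 < 6 → a k = a' k) ∧
  a 6 * a' 7 * a' 9 = a' 7 * a' 8 * a' 6 + a 0 * a 2 * a 4 + a' 9 * a 0 * a 3 ∧
  a 7 * a' 8 * a' 9 = a' 7 * a' 8 * a' 6 + a 0 * a 2 * a 4 + a' 9 * a 2 * a 5 ∧
  a 8 * a' 6 * a' 9 = a' 7 * a' 8 * a' 6 + a 0 * a 2 * a 4 + a' 9 * a 4 * a 1 ∧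
  a 9 * a' 9 ^ 2 * a' 7 * a' 8 * a' 6 = (a' 7 * a' 8 * a' 6) ^ 2 + a' 7 * a' 8 * a' 6 *
    (2 * a 0 * a 2 * a 4 + a' 9 * a 0 * a 3 + a' 9 * a 2 * a 5 + a' 9 * a 4 * a 1) +
    (a 0 * a 2 + a' 9 * a 1) * (a 0 * a 4 + a' 9 * a 5) * (a 2 * a 4 + a' 9 * a 3)

theorem eq_vec_ten {α : Type*} (a : Fin 10 → α) :
    a = ![a 0, a 1, a 2, a 3, a 4, a 5, a 6, a 7, a 8, a 9] := by
  funext l; fin_cases l <;> rfl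

theorem keySum_false_eq_true {a a' : Fin 10 → F} (ha : ∀ l, a l ≠ 0) (ha' : ∀ l, a' l ≠ 0)
    (h : PatchRecurrence a a') {k : ℕ} (hk : k ∈ keyList) :
    keySum false a k = keySum true a' k := by
  obtain ⟨hu, e₀, e₁, e₂, e₃⟩ := h
  have u₀ := hu 0 (by decide)
  have u₁ := hu 1 (by decide)
  have u₂ := hu 2 (by decide)
  have u₃ := hu 3 (by decide)
  have u₄ := hu 4 (by decide)
  have u₅ := hu 5 (by decide)
  refine keySum_eq_of_coverSum_eq ha ha' (by rw [u₀, u₁, u₂, u₃, u₄, u₅]) (fun s hs => ?_) hk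
  rw [eq_vec_ten a, eq_vec_ten a', ← u₀, ← u₁, ← u₂, ← u₃, ← u₄, ← u₅]
  refine coverSum_false_eq_true _ _ _ _ _ _ _ _ _ _ _ _ _ _ (ha 9) (ha 6) (ha 7) (ha 8) (ha' 9)
    (ha' 6) (ha' 7) (ha' 8) (ha 0) (ha 1) (ha 2) (ha 3) (ha 4) (ha 5) ?_ ?_ ?_ ?_ hs
  · rw [eq_div_iff (mul_ne_zero (ha' 7) (ha' 9)), ← e₀]; ring
  · rw [eq_div_iff (mul_ne_zero (ha' 8) (ha' 9)), ← e₁]; ring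
  · rw [eq_div_iff (mul_ne_zero (ha' 6) (ha' 9)), ← e₂]; ring
  · rw [eq_div_iff (mul_ne_zero (mul_ne_zero (mul_ne_zero (pow_ne_zero 2 (ha' 9)) (ha' 7)) (ha' 8))
      (ha' 6)), ← e₃]; ring

/-- Every key of a configuration of one patch is also one of the other patch. -/
theorem exists_patchConfig_of_key {t : Bool} {κ : Fin 21 → ℕ} (hκ : IsPatchConfig t κ)
    (t' : Bool) : ∃ κ', IsPatchConfig t' κ' ∧ key t' κ' = key t κ := by
  obtain ⟨κ₀, hκ₀, h₀⟩ := exists_of_mem_keyList (key_mem_keyList hκ)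
  cases t'
  · exact ⟨κ₀, hκ₀, h₀⟩
  -- If all lower values are `1`, the recurrence gives `3, 3, 3, 14` for the upper ones. As all
  -- weights are positive, the key sum of the first patch is nonzero; so is that of the second,
  -- which therefore has a configuration with this key.
  · have h := keySum_false_eq_true (F := ℚ) (a := ![1, 1, 1, 1, 1, 1, 3, 3, 3, 14])
      (a' := fun _ => 1) (by intro l; fin_cases l <;> simp) (by simp)
      ⟨by decide +kernel, by decide +kernel, by decide +kernel, by decide +kernel, by decide +kernel⟩
      (key_mem_keyList hκ)
    have hpos : (0 : ℚ) < keySum false ![1, 1, 1, 1, 1, 1, 3, 3, 3, 14] (key t κ) := by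
      rw [keySum]
      refine Finset.sum_pos (fun κ _ => mul_pos (by positivity) ?_) ⟨κ₀, ?_⟩
      · refine Finset.prod_pos fun l _ => zpow_pos ?_ _
        fin_cases l <;> simp
      · rw [Finset.mem_filter, mem_patchConfigs]; exact ⟨hκ₀, h₀⟩
    rw [h] at hpos
    obtain ⟨κ', hκ', -⟩ := Finset.exists_ne_zero_of_sum_ne_zero hpos.ne'
    rw [Finset.mem_filter, mem_patchConfigs] at hκ'
    exact ⟨κ', hκ'⟩

/-! ### Replacing a patch of a graph -/

/-- The edge of `Γ(U)` which corresponds to an edge of the patch. -/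
def patchEdge (t : Bool) (φ : Fin 18 → Node) (e : Fin 21) : Sym2 Node := s(φ (src t e), φ (tgt t e))

/-- The nodes `φ` form a patch of type `t` in `Γ(U)`, with outer nodes `O` and outer edges `Eo`. -/
structure Patching (t : Bool) (U : Set Vec) (O : Set Node) (Eo : Set (Sym2 Node))
    (φ : Fin 18 → Node) : Prop where
  inj : Function.Injective φ
  inner : ∀ a : Fin 18, a.1 < 12 → φ a ∉ O
  outer : ∀ a : Fin 18, 12 ≤ a.1 → φ a ∈ O
  nodes_eq : nodes U = O ∪ {x | ∃ a : Fin 18, a.1 < 12 ∧ φ a = x}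
  mem_outer : ∀ E ∈ Eo, ∀ x ∈ E, x ∈ O
  edges_eq : (graph U).edgeSet = Eo ∪ Set.range (patchEdge t φ)

theorem src_lt (t : Bool) (e : Fin 21) : (src t e).1 < 12 := by
  revert t e; decide

theorem mem_patchEdge {t : Bool} {φ : Fin 18 → Node} (hφ : Function.Injective φ) {e : Fin 21}
    {a : Fin 18} : φ a ∈ patchEdge t φ e ↔ Inc t e a := by
  rw [patchEdge, Sym2.mem_iff, hφ.eq_iff, hφ.eq_iff, Inc, eq_comm, @eq_comm _ a (tgt t e)]

theorem exists_of_mem_patchEdge {t : Bool} {φ : Fin 18 → Node} {e : Fin 21} {x : Node}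
    (h : x ∈ patchEdge t φ e) : ∃ a, φ a = x ∧ Inc t e a := by
  rw [patchEdge, Sym2.mem_iff] at h
  rcases h with rfl | rfl
  exacts [⟨_, rfl, Or.inl rfl⟩, ⟨_, rfl, Or.inr rfl⟩]

theorem patchEdge_injective (t : Bool) {φ : Fin 18 → Node} (hφ : Function.Injective φ) :
    Function.Injective (patchEdge t φ) := by
  intro e e' h
  have h1 : ∀ (t : Bool) (e e' : Fin 21), s(src t e, tgt t e) = s(src t e', tgt t e') → e = e' := by
    decide +kernel
  apply h1 t
  have h2 : Sym2.map φ s(src t e, tgt t e) = Sym2.map φ s(src t e', tgt t e') := h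
  exact Sym2.map.injective hφ h2

theorem inc_outer {t : Bool} {e : Fin 21} {a : Fin 18} (h : Inc t e a) (ha : 12 ≤ a.1) :
    ∃ k : Fin 6, e = leg k ∧ a = Fin.natAdd 12 k := by
  revert t e a; decide +kernel

theorem inc_leg (t : Bool) (k : Fin 6) (a : Fin 18) :
    Inc t (leg k) a ↔ a = hexNode k ∨ a = Fin.natAdd 12 k := by
  revert t k a; decide +kernel

theorem eq_leg_of_le {e : Fin 21} (h : 15 ≤ e.1) : ∃ k, e = leg k :=
  ⟨⟨e.1 - 15, by omega⟩, Fin.ext (by simp [leg]; omega)⟩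

namespace Patching

variable {t : Bool} {U : Set Vec} {O : Set Node} {Eo : Set (Sym2 Node)} {φ : Fin 18 → Node}

theorem patchEdge_notMem (h : Patching t U O Eo φ) (e : Fin 21) : patchEdge t φ e ∉ Eo :=
  fun he => h.inner _ (src_lt t e) (h.mem_outer _ he _ (Sym2.mem_mk_left _ _))

theorem edge_cases (h : Patching t U O Eo φ) {E : Sym2 Node} (hE : E ∈ (graph U).edgeSet) :
    E ∈ Eo ∨ ∃ e, patchEdge t φ e = E := by
  rw [h.edges_eq] at hE; exact hE

theorem exists_leg (h : Patching t U O Eo φ) {e : Fin 21} {x : Node} (hx : x ∈ O)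
    (hxe : x ∈ patchEdge t φ e) : ∃ k : Fin 6, e = leg k ∧ x = φ (Fin.natAdd 12 k) := by
  obtain ⟨a, rfl, ha⟩ := exists_of_mem_patchEdge hxe
  have h12 : 12 ≤ a.1 := by
    by_contra hcon
    exact h.inner a (by omega) hx
  obtain ⟨k, rfl, rfl⟩ := inc_outer ha h12
  exact ⟨k, rfl, rfl⟩

end Patching

open Classical in
/-- The edges of a patch in a set. -/
def patchPart (t : Bool) (φ : Fin 18 → Node) (M : Set (Sym2 Node)) : Fin 21 → Bool :=
  fun e => decide (patchEdge t φ e ∈ M)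

theorem patchPart_eq_true {t : Bool} {φ : Fin 18 → Node} {M : Set (Sym2 Node)} {e : Fin 21} :
    patchPart t φ M e = true ↔ patchEdge t φ e ∈ M := by
  simp [patchPart]

open Classical in
/-- The function given by `κ` on a patch and `μ` elsewhere. -/
def glue (t : Bool) (φ : Fin 18 → Node) (μ : Sym2 Node → ℕ) (κ : Fin 21 → ℕ) : Sym2 Node → ℕ :=
  fun E => if h : ∃ e, patchEdge t φ e = E then κ h.choose else μ E

theorem glue_patchEdge {t : Bool} {φ : Fin 18 → Node} (hφ : Function.Injective φ)
    (μ : Sym2 Node → ℕ) (κ : Fin 21 → ℕ) (e : Fin 21) :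
    glue t φ μ κ (patchEdge t φ e) = κ e := by
  have h : ∃ e', patchEdge t φ e' = patchEdge t φ e := ⟨e, rfl⟩
  rw [glue, dif_pos h, patchEdge_injective t hφ h.choose_spec]

theorem glue_of_forall_ne {t : Bool} {φ : Fin 18 → Node} (μ : Sym2 Node → ℕ) (κ : Fin 21 → ℕ)
    {E : Sym2 Node} (h : ∀ e, patchEdge t φ e ≠ E) : glue t φ μ κ E = μ E := by
  rw [glue, dif_neg]; simpa using h

/-! ### Splitting a configuration into its outer part and its patch part. -/

section Decompose

variable {t : Bool} {U : Set Vec} {O : Set Node} {Eo : Set (Sym2 Node)} {φ : Fin 18 → Node}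

theorem glue_of_mem (h : Patching t U O Eo φ) (μ : Sym2 Node → ℕ) (κ : Fin 21 → ℕ)
    {E : Sym2 Node} (hE : E ∈ Eo) : glue t φ μ κ E = μ E :=
  glue_of_forall_ne μ κ fun e he => h.patchEdge_notMem e (he ▸ hE)

theorem glue_eq_self (h : Patching t U O Eo φ) {m : Sym2 Node → ℕ}
    (hm : ∀ E ∉ (graph U).edgeSet, m E = 0) :
    glue t φ (Eo.indicator m) (fun e => m (patchEdge t φ e)) = m := by
  classical
  funext E
  by_cases hE : ∃ e, patchEdge t φ e = E
  · obtain ⟨e, rfl⟩ := hE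
    rw [glue_patchEdge h.inj]
  · push Not at hE
    rw [glue_of_forall_ne _ _ hE]
    by_cases hEo : E ∈ Eo
    · rw [Set.indicator_of_mem hEo]
    · rw [Set.indicator_of_notMem hEo, hm]
      intro hcon
      rcases h.edge_cases hcon with h1 | ⟨e, he⟩
      exacts [hEo h1, hE e he]

theorem indicator_glue (h : Patching t U O Eo φ) {μ : Sym2 Node → ℕ} (hμ : ∀ E ∉ Eo, μ E = 0)
    (κ : Fin 21 → ℕ) : Eo.indicator (glue t φ μ κ) = μ := by
  classical
  funext E
  by_cases hE : E ∈ Eo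
  · rw [Set.indicator_of_mem hE, glue_of_mem h _ _ hE]
  · rw [Set.indicator_of_notMem hE, hμ E hE]

/-- Outer edges have only outer endpoints, so the unique edge of a cover at an inner node belongs to
the patch. -/
theorem isPatchCover_patchPart (h : Patching t U O Eo φ) {M : Set (Sym2 Node)}
    (hM : IsDimerCover U M) : IsPatchCover t (patchPart t φ M) := by
  rw [isPatchCover_iff]
  intro a
  have ha : φ (a.castLE (by norm_num)) ∈ nodes U := by
    rw [h.nodes_eq]
    exact Or.inr ⟨_, a.2, rfl⟩
  obtain ⟨E, ⟨hE, haE⟩, hu⟩ := hM.2 _ ha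
  rcases h.edge_cases (hM.1 hE) with hEo | ⟨e, rfl⟩
  · exact absurd (h.mem_outer _ hEo _ haE) (h.inner _ a.2)
  · refine ⟨e, ⟨patchPart_eq_true.2 hE, (mem_patchEdge h.inj).1 haE⟩, fun e' he' => ?_⟩
    exact patchEdge_injective t h.inj
      (hu _ ⟨patchPart_eq_true.1 he'.1, (mem_patchEdge h.inj).2 he'.2⟩)

theorem indicator_add_patchEdge (M₁ M₂ : Set (Sym2 Node)) (e : Fin 21) :
    (M₁.indicator 1 + M₂.indicator 1 : Sym2 Node → ℕ) (patchEdge t φ e) =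
      cfg (patchPart t φ M₁) (patchPart t φ M₂) e := by
  classical
  simp only [Pi.add_apply, cfg, patchPart, Set.indicator_apply, Pi.one_apply]
  by_cases h1 : patchEdge t φ e ∈ M₁ <;> by_cases h2 : patchEdge t φ e ∈ M₂ <;> simp [h1, h2]

theorem isPatchConfig_of_isDoubleDimer (h : Patching t U O Eo φ) {m : Sym2 Node → ℕ}
    (hm : IsDoubleDimer U m) : IsPatchConfig t fun e => m (patchEdge t φ e) := by
  obtain ⟨M₁, M₂, h₁, h₂, rfl⟩ := hm
  exact ⟨_, _, isPatchCover_patchPart h h₁, isPatchCover_patchPart h h₂,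
    funext fun e => indicator_add_patchEdge M₁ M₂ e⟩

theorem IsDoubleDimer.eq_zero {U : Set Vec} {m : Sym2 Node → ℕ} (hm : IsDoubleDimer U m)
    {E : Sym2 Node} (hE : E ∉ (graph U).edgeSet) : m E = 0 := by
  classical
  obtain ⟨M₁, M₂, h₁, h₂, rfl⟩ := hm
  simp [Set.indicator_of_notMem (fun h => hE (h₁.1 h)), Set.indicator_of_notMem (fun h => hE (h₂.1 h))]

end Decompose

/-- Two patches which can be exchanged. -/
structure PatchPair (t t' : Bool) (U U' : Set Vec) (O : Set Node) (Eo : Set (Sym2 Node))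
    (φ φ' : Fin 18 → Node) : Prop where
  left : Patching t U O Eo φ
  right : Patching t' U' O Eo φ'
  ext_eq : ∀ k : Fin 6, φ (Fin.natAdd 12 k) = φ' (Fin.natAdd 12 k)

/-! ### Exchanging the patch in covers and in double-dimer configurations. -/

section Exchange

variable {t t' : Bool} {U U' : Set Vec} {O : Set Node} {Eo : Set (Sym2 Node)}
  {φ φ' : Fin 18 → Node}

theorem PatchPair.symm (h : PatchPair t t' U U' O Eo φ φ') : PatchPair t' t U' U O Eo φ' φ :=
  ⟨h.right, h.left, fun k => (h.ext_eq k).symm⟩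

/-- Exchange the patch in a set of edges. -/
def exchange (t' : Bool) (Eo : Set (Sym2 Node)) (φ' : Fin 18 → Node) (M : Set (Sym2 Node))
    (N : Fin 21 → Bool) : Set (Sym2 Node) :=
  (M ∩ Eo) ∪ {E | ∃ e, N e = true ∧ patchEdge t' φ' e = E}

theorem leg_mem_outer (h : Patching t U O Eo φ) (k : Fin 6) :
    φ (Fin.natAdd 12 k) ∈ patchEdge t φ (leg k) :=
  (mem_patchEdge h.inj).2 ((inc_leg _ _ _).2 (Or.inr rfl))

/-- An outer node meets the patch only through legs, and the new patch uses the same legs as the old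
one; hence such a node is covered by the same outer edge as before, or by the corresponding leg. -/
theorem isDimerCover_exchange (h : PatchPair t t' U U' O Eo φ φ') {M : Set (Sym2 Node)}
    (hM : IsDimerCover U M) {N : Fin 21 → Bool} (hN : IsPatchCover t' N)
    (hl : ∀ k, N (leg k) = patchPart t φ M (leg k)) :
    IsDimerCover U' (exchange t' Eo φ' M N) := by
  constructor
  · rw [h.right.edges_eq]
    rintro E (hE | ⟨e, -, rfl⟩)
    · exact Or.inl hE.2
    · exact Or.inr ⟨e, rfl⟩
  intro x hx
  rw [h.right.nodes_eq] at hx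
  rcases hx with hx | ⟨a, ha, rfl⟩
  · have hxU : x ∈ nodes U := by rw [h.left.nodes_eq]; exact Or.inl hx
    obtain ⟨E, ⟨hE, hxE⟩, hu⟩ := hM.2 x hxU
    rcases h.left.edge_cases (hM.1 hE) with hEo | ⟨e, rfl⟩
    · refine ⟨E, ⟨Or.inl ⟨hE, hEo⟩, hxE⟩, ?_⟩
      rintro E' ⟨hE' | ⟨e, he, rfl⟩, hxE'⟩
      · exact hu _ ⟨hE'.1, hxE'⟩
      · exfalso
        obtain ⟨k, rfl, hk⟩ := h.right.exists_leg hx hxE'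
        rw [hl, patchPart_eq_true] at he
        have := hu _ ⟨he, by rw [hk, ← h.ext_eq]; exact leg_mem_outer h.left k⟩
        exact h.left.patchEdge_notMem (leg k) (this ▸ hEo)
    · obtain ⟨k, rfl, hk⟩ := h.left.exists_leg hx hxE
      have hNk : N (leg k) = true := by rw [hl, patchPart_eq_true]; exact hE
      refine ⟨patchEdge t' φ' (leg k), ⟨Or.inr ⟨_, hNk, rfl⟩, ?_⟩, ?_⟩
      · rw [hk, h.ext_eq]; exact leg_mem_outer h.right k
      · rintro E' ⟨hE' | ⟨e, he, rfl⟩, hxE'⟩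
        · exfalso
          have := hu _ ⟨hE'.1, hxE'⟩
          exact h.left.patchEdge_notMem (leg k) (this ▸ hE'.2)
        · obtain ⟨k', rfl, hk'⟩ := h.right.exists_leg hx hxE'
          rw [hk, h.ext_eq] at hk'
          have : k = k' := Fin.natAdd_injective _ _ (h.right.inj hk')
          rw [this]
  · obtain ⟨e, ⟨he, hea⟩, hu⟩ := (isPatchCover_iff.1 hN) ⟨a.1, ha⟩
    refine ⟨patchEdge t' φ' e, ⟨Or.inr ⟨e, he, rfl⟩, (mem_patchEdge h.right.inj).2 hea⟩, ?_⟩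
    rintro E' ⟨hE' | ⟨e', he', rfl⟩, haE'⟩
    · exact absurd (h.right.mem_outer _ hE'.2 _ haE') (h.right.inner a ha)
    · rw [hu e' ⟨he', (mem_patchEdge h.right.inj).1 haE'⟩]

/-- Equal leg multiplicities alone would not suffice: both covers have to be exchanged with their
individual legs preserved. By `exists_decomposition_of_key` the key permits this for every
decomposition of the old configuration. -/
theorem isDoubleDimer_glue (h : PatchPair t t' U U' O Eo φ φ') {m : Sym2 Node → ℕ}
    (hm : IsDoubleDimer U m) {κ : Fin 21 → ℕ} (hκ : IsPatchConfig t' κ)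
    (hkey : key t (fun e => m (patchEdge t φ e)) = key t' κ) :
    IsDoubleDimer U' (glue t' φ' (Eo.indicator m) κ) := by
  classical
  obtain ⟨M₁, M₂, h₁, h₂, rfl⟩ := hm
  have hcfg : (fun e => (M₁.indicator 1 + M₂.indicator 1 : Sym2 Node → ℕ) (patchEdge t φ e)) =
      cfg (patchPart t φ M₁) (patchPart t φ M₂) :=
    funext fun e => indicator_add_patchEdge M₁ M₂ e
  rw [hcfg] at hkey
  obtain ⟨N₁, N₂, hN₁, hN₂, rfl, hl₁, hl₂⟩ := exists_decomposition_of_key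
    (isPatchCover_patchPart h.left h₁) (isPatchCover_patchPart h.left h₂) hκ hkey
  refine ⟨_, _, isDimerCover_exchange h h₁ hN₁ hl₁, isDimerCover_exchange h h₂ hN₂ hl₂, ?_⟩
  funext E
  by_cases hE : ∃ e, patchEdge t' φ' e = E
  · obtain ⟨e, rfl⟩ := hE
    rw [glue_patchEdge h.right.inj]
    have aux : ∀ (M : Set (Sym2 Node)) (N : Fin 21 → Bool),
        patchEdge t' φ' e ∈ exchange t' Eo φ' M N ↔ N e = true := by
      intro M N
      constructor
      · rintro (hE | ⟨e', he', h'⟩)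
        · exact absurd hE.2 (h.right.patchEdge_notMem e)
        · rwa [← patchEdge_injective t' h.right.inj h']
      · exact fun he => Or.inr ⟨e, he, rfl⟩
    simp only [Pi.add_apply, Set.indicator_apply, aux, cfg, Pi.one_apply]
    cases N₁ e <;> cases N₂ e <;> simp
  · push Not at hE
    rw [glue_of_forall_ne _ _ hE]
    have aux : ∀ (M : Set (Sym2 Node)) (N : Fin 21 → Bool),
        E ∈ exchange t' Eo φ' M N ↔ E ∈ M ∧ E ∈ Eo := by
      intro M N
      constructor
      · rintro (hE | ⟨e', he', h'⟩)
        · exact hE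
        · exact absurd h' (hE e')
      · exact fun he => Or.inl he
    simp only [Pi.add_apply, Set.indicator_apply, aux, Pi.one_apply]
    by_cases hEo : E ∈ Eo <;> simp [hEo]

/-! ### Connectivity -/

theorem glue_adj_cases (h : Patching t U O Eo φ) {μ : Sym2 Node → ℕ} (hμ : ∀ E ∉ Eo, μ E = 0)
    {κ : Fin 21 → ℕ} {x y : Node} (hxy : (singleGraph (glue t φ μ κ)).Adj x y) :
    (x ∈ O ∧ y ∈ O ∧ x ≠ y ∧ μ s(x, y) = 1 ∧ s(x, y) ∈ Eo) ∨
      ∃ e a b, κ e = 1 ∧ Inc t e a ∧ Inc t e b ∧ a ≠ b ∧ φ a = x ∧ φ b = y := by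
  obtain ⟨hne, h1⟩ := hxy
  by_cases hE : ∃ e, patchEdge t φ e = s(x, y)
  · obtain ⟨e, he⟩ := hE
    rw [← he, glue_patchEdge h.inj] at h1
    obtain ⟨a, rfl, ha⟩ := exists_of_mem_patchEdge (he ▸ Sym2.mem_mk_left x y)
    obtain ⟨b, rfl, hb⟩ := exists_of_mem_patchEdge (he ▸ Sym2.mem_mk_right (φ a) y)
    exact Or.inr ⟨e, a, b, h1, ha, hb, fun hab => hne (by rw [hab]), rfl, rfl⟩
  · push Not at hE
    rw [glue_of_forall_ne _ _ hE] at h1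
    have hEo : s(x, y) ∈ Eo := by
      by_contra hcon
      rw [hμ _ hcon] at h1
      exact zero_ne_one h1
    exact Or.inl ⟨h.mem_outer _ hEo _ (Sym2.mem_mk_left x y),
      h.mem_outer _ hEo _ (Sym2.mem_mk_right x y), hne, h1, hEo⟩

theorem glue_adj_of_inc (h : Patching t U O Eo φ) {μ : Sym2 Node → ℕ} {κ : Fin 21 → ℕ}
    {e : Fin 21} {a b : Fin 18} (he : κ e = 1) (ha : Inc t e a) (hb : Inc t e b) (hab : a ≠ b) :
    (singleGraph (glue t φ μ κ)).Adj (φ a) (φ b) := by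
  refine ⟨h.inj.ne hab, ?_⟩
  have : s(φ a, φ b) = patchEdge t φ e := by
    symm
    rw [(Sym2.mem_and_mem_iff (h.inj.ne hab)).1 ⟨(mem_patchEdge h.inj).2 ha,
      (mem_patchEdge h.inj).2 hb⟩]
  rw [this, glue_patchEdge h.inj, he]

theorem reachable_of_linked (h : Patching t U O Eo φ) {μ : Sym2 Node → ℕ} {κ : Fin 21 → ℕ}
    {a b : Fin 18} (hab : Linked t κ a b) :
    (singleGraph (glue t φ μ κ)).Reachable (φ a) (φ b) := by
  induction hab with
  | refl => exact SimpleGraph.Reachable.refl _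
  | @tail b c _ hbc ih =>
    obtain ⟨e, -, he, hb, hc⟩ := hbc
    by_cases hne : b = c
    · rw [← hne]; exact ih
    · exact ih.trans (glue_adj_of_inc h he hb hc hne).reachable

theorem hexNode_ne (k : Fin 6) : hexNode k ≠ Fin.natAdd 12 k := by
  revert k; decide

theorem leg_adj (h : Patching t U O Eo φ) {μ : Sym2 Node → ℕ} {κ : Fin 21 → ℕ} {k : Fin 6}
    (hk : κ (leg k) = 1) : (singleGraph (glue t φ μ κ)).Adj (φ (Fin.natAdd 12 k)) (φ (hexNode k)) :=
  glue_adj_of_inc h hk ((inc_leg _ _ _).2 (Or.inr rfl)) ((inc_leg _ _ _).2 (Or.inl rfl))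
    (hexNode_ne k).symm

/-- Induction along paths in a graph. -/
theorem reachable_induction {V : Type*} {G : SimpleGraph V} {x : V} {P : V → Prop} (hx : P x)
    (hstep : ∀ y z, G.Reachable x y → G.Adj y z → P y → P z) {y : V} (hy : G.Reachable x y) :
    P y := by
  have hy' := hy
  rw [SimpleGraph.reachable_iff_reflTransGen] at hy'
  induction hy' with
  | refl => exact hx
  | tail h1 h2 ih =>
    have h3 := (SimpleGraph.reachable_iff_reflTransGen _ _).2 h1
    exact hstep _ _ h3 h2 (ih h3)

/-- A path of the first configuration is followed step by step. Outside it is copied; inside the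
patch one only remembers the leg of entry, and on leaving, the equality of keys provides a
connection of the two legs in the other patch. -/
theorem reachable_exchange (h : PatchPair t t' U U' O Eo φ φ') {μ : Sym2 Node → ℕ}
    (hμ : ∀ E ∉ Eo, μ E = 0) {κ κ' : Fin 21 → ℕ} (hκ : IsPatchConfig t κ)
    (hκ' : IsPatchConfig t' κ') (hkey : key t κ = key t' κ') {x y : Node} (hx : x ∈ O)
    (hy : y ∈ O) (hxy : (singleGraph (glue t φ μ κ)).Reachable x y) :
    (singleGraph (glue t' φ' μ κ')).Reachable x y := by
  have main : ∀ z, (singleGraph (glue t φ μ κ)).Reachable x z →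
      (z ∈ O → (singleGraph (glue t' φ' μ κ')).Reachable x z) ∧
      ∀ a : Fin 18, a.1 < 12 → φ a = z → ∃ i : Fin 6, κ (leg i) = 1 ∧
        Linked t κ (hexNode i) a ∧
        (singleGraph (glue t' φ' μ κ')).Reachable x (φ' (Fin.natAdd 12 i)) := by
    intro z hz
    refine reachable_induction (P := fun z =>
      (z ∈ O → (singleGraph (glue t' φ' μ κ')).Reachable x z) ∧
      ∀ a : Fin 18, a.1 < 12 → φ a = z → ∃ i : Fin 6, κ (leg i) = 1 ∧
        Linked t κ (hexNode i) a ∧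
        (singleGraph (glue t' φ' μ κ')).Reachable x (φ' (Fin.natAdd 12 i))) ?_ ?_ hz
    · refine ⟨fun _ => SimpleGraph.Reachable.refl _, ?_⟩
      rintro a ha rfl
      exact absurd hx (h.left.inner a ha)
    · rintro y z - hyz ⟨ih1, ih2⟩
      rcases glue_adj_cases h.left hμ hyz with ⟨hy, hz, hne, hm, hEo⟩ | ⟨e, a, b, he, ha, hb, hab, rfl, rfl⟩
      · constructor
        · intro _
          refine (ih1 hy).trans (SimpleGraph.Adj.reachable ⟨hne, ?_⟩)
          rw [glue_of_mem h.right _ _ hEo, hm]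
        · rintro a ha rfl
          exact absurd hz (h.left.inner a ha)
      · constructor
        · intro hbO
          have hb12 : 12 ≤ b.1 := by
            by_contra hcon
            exact h.left.inner b (by omega) hbO
          obtain ⟨k, rfl, rfl⟩ := inc_outer hb hb12
          rw [inc_leg] at ha
          have ha : a = hexNode k := ha.resolve_right hab
          subst ha
          -- The path entered by the leg `i` and leaves by the leg `k`. Both are single and linked
          -- inside the first patch, hence also inside the second.
          obtain ⟨i, hi, hl, hr⟩ := ih2 (hexNode k) (by simp [hexNode]; omega) rfl
          have hl' := linked_of_key hκ hκ' hkey hi he hl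
          have hi' := (leg_eq_one_of_key hkey i).1 hi
          have hk' := (leg_eq_one_of_key hkey k).1 he
          rw [h.ext_eq k]
          exact (hr.trans (leg_adj h.right hi').reachable).trans
            ((reachable_of_linked h.right hl').trans (leg_adj h.right hk').symm.reachable)
        · intro c hc hcb
          have : c = b := h.left.inj hcb
          subst this
          by_cases he15 : e.1 < 15
          · obtain ⟨i, hi, hl, hr⟩ := ih2 a (inc_lt he15 ha) rfl
            exact ⟨i, hi, hl.tail ⟨e, he15, he, ha, hb⟩, hr⟩
          · obtain ⟨k, rfl⟩ := eq_leg_of_le (by omega : 15 ≤ e.1)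
            have hb' : c = hexNode k := by
              rcases (inc_leg _ _ _).1 hb with h1 | h1
              · exact h1
              · rw [h1] at hc; simp at hc
            have ha' : a = Fin.natAdd 12 k := by
              rcases (inc_leg _ _ _).1 ha with h1 | h1
              · exact absurd (h1.trans hb'.symm) hab
              · exact h1
            subst ha' hb'
            refine ⟨k, he, Relation.ReflTransGen.refl, ?_⟩
            rw [← h.ext_eq]
            exact ih1 (h.left.outer _ (by simp))
  exact (main y hxy).1 hy

theorem exists_adj_exchange (h : PatchPair t t' U U' O Eo φ φ') {μ : Sym2 Node → ℕ}
    (hμ : ∀ E ∉ Eo, μ E = 0) {κ κ' : Fin 21 → ℕ} (hkey : key t κ = key t' κ') {x : Node}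
    (hx : x ∈ O) (hxy : ∃ y, (singleGraph (glue t φ μ κ)).Adj x y) :
    ∃ y, (singleGraph (glue t' φ' μ κ')).Adj x y := by
  obtain ⟨y, hxy⟩ := hxy
  rcases glue_adj_cases h.left hμ hxy with ⟨-, -, hne, hm, hEo⟩ | ⟨e, a, b, he, ha, -, -, rfl, -⟩
  · exact ⟨y, hne, by rw [glue_of_mem h.right _ _ hEo, hm]⟩
  · have ha12 : 12 ≤ a.1 := by
      by_contra hcon
      exact h.left.inner a (by omega) hx
    obtain ⟨k, rfl, rfl⟩ := inc_outer ha ha12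
    rw [h.ext_eq]
    exact ⟨_, leg_adj h.right ((leg_eq_one_of_key hkey k).1 he)⟩

end Exchange

/-! ### Loops and patches -/

/-- The node sets of the loops of `m`. -/
def loopSets (m : Sym2 Node → ℕ) : Set (Set Node) :=
  {T | ∃ x, T = {y | (singleGraph m).Reachable x y} ∧ T.Finite ∧ T.Nontrivial}

theorem supp_mk_eq (m : Sym2 Node → ℕ) (x : Node) :
    ((singleGraph m).connectedComponentMk x).supp = {y | (singleGraph m).Reachable x y} := by
  ext y
  rw [SimpleGraph.ConnectedComponent.mem_supp_iff, SimpleGraph.ConnectedComponent.eq]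
  exact ⟨fun h => h.symm, fun h => h.symm⟩

theorem image_supp_loops (m : Sym2 Node → ℕ) :
    SimpleGraph.ConnectedComponent.supp '' loops m = loopSets m := by
  ext T
  constructor
  · rintro ⟨C, hC, rfl⟩
    induction C using SimpleGraph.ConnectedComponent.ind with
    | h x => exact ⟨x, supp_mk_eq m x, hC⟩
  · rintro ⟨x, rfl, h1, h2⟩
    exact ⟨(singleGraph m).connectedComponentMk x, ⟨by rwa [supp_mk_eq], by rwa [supp_mk_eq]⟩,
      supp_mk_eq m x⟩

theorem loopCount_eq (m : Sym2 Node → ℕ) : loopCount m = (loopSets m).ncard := by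
  rw [← image_supp_loops, loopCount,
    Set.ncard_image_of_injective _ SimpleGraph.ConnectedComponent.supp_injective]

theorem loops_finite_iff (m : Sym2 Node → ℕ) : (loops m).Finite ↔ (loopSets m).Finite := by
  rw [← image_supp_loops,
    Set.finite_image_iff SimpleGraph.ConnectedComponent.supp_injective.injOn]

theorem exists_adj_of_reachable {V : Type*} {G : SimpleGraph V} {x y : V} (h : G.Reachable x y)
    (hne : x ≠ y) : ∃ z, G.Adj x z := by
  rw [SimpleGraph.reachable_iff_reflTransGen] at h
  rcases h.cases_head with h | ⟨z, hz, -⟩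
  exacts [absurd h hne, ⟨z, hz⟩]

theorem nontrivial_iff_exists_adj {V : Type*} {G : SimpleGraph V} {x : V} :
    {y | G.Reachable x y}.Nontrivial ↔ ∃ y, G.Adj x y := by
  constructor
  · rintro ⟨y, hy, z, hz, hyz⟩
    by_cases h : x = y
    · exact exists_adj_of_reachable hz fun h' => hyz (h.symm.trans h')
    · exact exists_adj_of_reachable hy h
  · rintro ⟨y, hy⟩
    exact ⟨x, SimpleGraph.Reachable.refl _, y, hy.reachable, hy.ne⟩

theorem setOf_reachable_eq {V : Type*} {G : SimpleGraph V} {x y : V} (h : G.Reachable x y) :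
    {z | G.Reachable x z} = {z | G.Reachable y z} :=
  Set.ext fun _ => ⟨fun hz => h.symm.trans hz, fun hz => h.trans hz⟩

/-- The traces on `O` of the loops of `m` which meet `O`. -/
def loopTraces (O : Set Node) (m : Sym2 Node → ℕ) : Set (Set Node) :=
  {T | ∃ x ∈ O, T = {y | y ∈ O ∧ (singleGraph m).Reachable x y} ∧ T.Finite ∧
    ∃ y, (singleGraph m).Adj x y}

section Exchange

variable {t t' : Bool} {U U' : Set Vec} {O : Set Node} {Eo : Set (Sym2 Node)}
  {φ φ' : Fin 18 → Node} {μ : Sym2 Node → ℕ} {κ κ' : Fin 21 → ℕ}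

theorem loopTraces_subset (h : PatchPair t t' U U' O Eo φ φ') (hμ : ∀ E ∉ Eo, μ E = 0)
    (hκ : IsPatchConfig t κ) (hκ' : IsPatchConfig t' κ') (hkey : key t κ = key t' κ') :
    loopTraces O (glue t φ μ κ) ⊆ loopTraces O (glue t' φ' μ κ') := by
  rintro T ⟨x, hx, rfl, hT, hadj⟩
  refine ⟨x, hx, ?_, hT, exists_adj_exchange h hμ hkey hx hadj⟩
  ext y
  exact and_congr_right fun hy => ⟨reachable_exchange h hμ hκ hκ' hkey hx hy,
    reachable_exchange h.symm hμ hκ' hκ hkey.symm hx hy⟩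

/-- Connectivity of outer nodes, and whether such a node has a single edge at all, depend only on
the outer part and the key. -/
theorem loopTraces_exchange (h : PatchPair t t' U U' O Eo φ φ') (hμ : ∀ E ∉ Eo, μ E = 0)
    (hκ : IsPatchConfig t κ) (hκ' : IsPatchConfig t' κ') (hkey : key t κ = key t' κ') :
    loopTraces O (glue t φ μ κ) = loopTraces O (glue t' φ' μ κ') :=
  (loopTraces_subset h hμ hκ hκ' hkey).antisymm (loopTraces_subset h.symm hμ hκ' hκ hkey.symm)

theorem mem_of_reachable_glue (h : Patching t U O Eo φ) (hμ : ∀ E ∉ Eo, μ E = 0) {x y : Node}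
    (hxy : (singleGraph (glue t φ μ κ)).Reachable x y) (hx : x ∈ O ∨ x ∈ Set.range φ) :
    y ∈ O ∨ y ∈ Set.range φ := by
  refine reachable_induction (P := fun y => y ∈ O ∨ y ∈ Set.range φ) hx ?_ hxy
  rintro y z - hyz -
  rcases glue_adj_cases h hμ hyz with h1 | ⟨e, a, b, -, -, -, -, -, rfl⟩
  exacts [Or.inl h1.2.1, Or.inr ⟨b, rfl⟩]

theorem mem_of_adj_glue (h : Patching t U O Eo φ) (hμ : ∀ E ∉ Eo, μ E = 0) {x y : Node}
    (hxy : (singleGraph (glue t φ μ κ)).Adj x y) : x ∈ O ∨ x ∈ Set.range φ := by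
  rcases glue_adj_cases h hμ hxy with h1 | ⟨e, a, b, -, -, -, -, rfl, -⟩
  exacts [Or.inl h1.1, Or.inr ⟨a, rfl⟩]

theorem linked_lt {a b : Fin 18} (hab : Linked t κ a b) (ha : a.1 < 12) : b.1 < 12 := by
  induction hab with
  | refl => exact ha
  | tail _ hbc _ =>
    obtain ⟨e, he, -, -, hc⟩ := hbc
    exact inc_lt he hc

/-- A component of the patch without single legs is a component of the whole configuration. -/
theorem image_linked (h : Patching t U O Eo φ) (hμ : ∀ E ∉ Eo, μ E = 0) {a : Fin 18}
    (ha : a.1 < 12) (hT : ∀ k : Fin 6, κ (leg k) = 1 → ¬ Linked t κ a (hexNode k)) :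
    φ '' {b | Linked t κ a b} = {y | (singleGraph (glue t φ μ κ)).Reachable (φ a) y} := by
  apply Set.Subset.antisymm
  · rintro _ ⟨b, hb, rfl⟩
    exact reachable_of_linked h hb
  · intro y hy
    refine reachable_induction (P := fun y => y ∈ φ '' {b | Linked t κ a b})
      ⟨a, Relation.ReflTransGen.refl, rfl⟩ ?_ hy
    rintro _ z - hyz ⟨b, hb, rfl⟩
    rcases glue_adj_cases h hμ hyz with h1 | ⟨e, b', c, he, hb', hc, hbc, hbb, rfl⟩
    · exact absurd h1.1 (h.inner _ (linked_lt hb ha))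
    · have := h.inj hbb
      subst this
      by_cases he15 : e.1 < 15
      · exact ⟨c, hb.tail ⟨e, he15, he, hb', hc⟩, rfl⟩
      · obtain ⟨k, rfl⟩ := eq_leg_of_le (by omega : 15 ≤ e.1)
        exfalso
        rcases (inc_leg _ _ _).1 hb' with h1 | h1
        · exact hT k he (h1 ▸ hb)
        · have := linked_lt hb ha
          rw [h1] at this
          simp at this

/-- A loop which avoids the outside uses no single leg, so it is a linked component of the patch.
Conversely a component without single legs cannot be left, and it is finite because the patch is. -/
theorem image_innerLoops (h : Patching t U O Eo φ) (hμ : ∀ E ∉ Eo, μ E = 0) :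
    Set.image φ '' innerLoops t κ = {T ∈ loopSets (glue t φ μ κ) | T ∩ O = ∅} := by
  ext T
  constructor
  · rintro ⟨_, ⟨a, ha, rfl, hn, hT⟩, rfl⟩
    refine ⟨⟨φ a, image_linked h hμ ha hT, Set.toFinite _, hn.image h.inj⟩, ?_⟩
    rw [Set.eq_empty_iff_forall_notMem]
    rintro _ ⟨⟨b, hb, rfl⟩, hbO⟩
    exact h.inner _ (linked_lt hb ha) hbO
  · rintro ⟨⟨x, rfl, -, hn⟩, hO⟩
    have hxO : ∀ y, (singleGraph (glue t φ μ κ)).Reachable x y → y ∉ O := fun y hy hyO =>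
      (Set.eq_empty_iff_forall_notMem.1 hO) y ⟨hy, hyO⟩
    obtain ⟨z, hz⟩ := nontrivial_iff_exists_adj.1 hn
    rcases glue_adj_cases h hμ hz with h1 | ⟨e, a, c, he, ha, hc, hac, rfl, rfl⟩
    · exact absurd h1.1 (hxO _ (SimpleGraph.Reachable.refl _))
    · have ha12 : a.1 < 12 := by
        by_contra hcon
        exact hxO _ (SimpleGraph.Reachable.refl _) (h.outer a (by omega))
      have hT : ∀ k : Fin 6, κ (leg k) = 1 → ¬ Linked t κ a (hexNode k) := fun k hk hl =>
        hxO _ ((reachable_of_linked h hl).trans (leg_adj h hk).symm.reachable)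
          (h.outer _ (by simp))
      have himg := image_linked h hμ ha12 hT
      refine ⟨{b | Linked t κ a b}, ⟨a, ha12, rfl, ?_, hT⟩, himg⟩
      rw [← himg] at hn
      exact (Set.image_nontrivial h.inj).1 hn

/-- A loop which meets the outside may be based at an outer node. -/
theorem image_trace (h : Patching t U O Eo φ) (hμ : ∀ E ∉ Eo, μ E = 0) :
    (fun T => T ∩ O) '' {T ∈ loopSets (glue t φ μ κ) | T ∩ O ≠ ∅} =
      loopTraces O (glue t φ μ κ) := by
  ext T
  constructor
  · rintro ⟨_, ⟨⟨x, rfl, hf, hn⟩, hO⟩, rfl⟩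
    obtain ⟨y, hy, hyO⟩ := Set.nonempty_iff_ne_empty.2 hO
    rw [setOf_reachable_eq hy] at hf hn ⊢
    exact ⟨y, hyO, Set.ext fun z => and_comm, hf.inter_of_left _, nontrivial_iff_exists_adj.1 hn⟩
  · rintro ⟨x, hx, rfl, hf, hadj⟩
    refine ⟨{y | (singleGraph (glue t φ μ κ)).Reachable x y}, ⟨⟨x, rfl, ?_,
      nontrivial_iff_exists_adj.2 hadj⟩, ?_⟩, Set.ext fun z => and_comm⟩
    -- A component with finite trace is finite, since beyond its trace it contains only nodes of the
    -- patch.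
    · refine (hf.union (Set.finite_range φ)).subset fun y hy => ?_
      rcases mem_of_reachable_glue h hμ hy (Or.inl hx) with h1 | h1
      exacts [Or.inl ⟨h1, hy⟩, Or.inr h1]
    · exact Set.nonempty_iff_ne_empty.1 ⟨x, SimpleGraph.Reachable.refl _, hx⟩

theorem injOn_trace (m : Sym2 Node → ℕ) (O : Set Node) :
    Set.InjOn (fun T => T ∩ O) {T ∈ loopSets m | T ∩ O ≠ ∅} := by
  rintro _ ⟨⟨x, rfl, -, -⟩, hO⟩ _ ⟨⟨x', rfl, -, -⟩, -⟩ heq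
  obtain ⟨y, hy, hyO⟩ := Set.nonempty_iff_ne_empty.2 hO
  have : y ∈ {z | (singleGraph m).Reachable x' z} ∩ O := by
    have h1 : y ∈ {z | (singleGraph m).Reachable x z} ∩ O := ⟨hy, hyO⟩
    exact (Set.ext_iff.1 heq y).1 h1
  exact setOf_reachable_eq ((show (singleGraph m).Reachable x y from hy).trans
    (show (singleGraph m).Reachable x' y from this.1).symm)

/-- The loops of a configuration either meet the outside of the patch or lie in the patch. -/
theorem loopCount_glue (h : Patching t U O Eo φ) (hμ : ∀ E ∉ Eo, μ E = 0)
    (hκ : IsPatchConfig t κ) (hfin : (loops (glue t φ μ κ)).Finite) :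
    loopCount (glue t φ μ κ) = (loopTraces O (glue t φ μ κ)).ncard + loopNum t (sgl κ) := by
  rw [loops_finite_iff] at hfin
  obtain ⟨hc, hn, -⟩ := hκ.tests
  rw [loopNum_eq hc hn, ← image_trace h hμ, (injOn_trace _ _).ncard_image,
    ← Set.ncard_image_of_injective (innerLoops t κ) h.inj.image_injective, image_innerLoops h hμ,
    loopCount_eq, ← Set.ncard_union_eq (Set.disjoint_left.2 fun T h1 h2 => h1.2 h2.2)
      (hfin.subset fun T hT => hT.1) (hfin.subset fun T hT => hT.1)]
  congr 1
  ext T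
  simp only [Set.mem_union, Set.mem_ofPred_eq]
  tauto

end Exchange

/-! ### A characterization of taut configurations -/

/-- By `hinf` every node of the initial graph lies on an infinite path of the initial configuration,
so a matching of infinite paths outside a finite set amounts to equality of the connectivity
relations there. This formulation behaves well under local changes. -/
theorem isTaut_iff (hinf : ∀ x ∈ nodes orthant,
      {y | (singleGraph initialConfig).Reachable x y}.Infinite) {U : Set Vec} {m : Sym2 Node → ℕ} :
    IsTaut U m ↔ IsDoubleDimer U m ∧ ∃ S : Set Node, S.Finite ∧
      (∀ E : Sym2 Node, (∃ x ∈ E, x ∉ S) → m E = initialConfig E) ∧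
      ∀ x ∉ S, ∀ y ∉ S, (singleGraph m).Reachable x y ↔
        (singleGraph initialConfig).Reachable x y := by
  have hadj : ∀ x y, (singleGraph initialConfig).Adj x y →
      {y | (singleGraph initialConfig).Reachable x y}.Infinite := by
    intro x y h
    apply hinf
    have h1 : s(x, y) ∈ (graph orthant).edgeSet := by
      by_contra hcon
      have : initialConfig s(x, y) = 0 := Set.indicator_of_notMem (fun hE => hcon hE.1) _
      rw [h.2] at this
      exact one_ne_zero this
    exact ((graph orthant).mem_edgeSet.1 h1).1
  refine and_congr_right fun _ => exists_congr fun S => and_congr_right fun hS =>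
    and_congr_right fun hE => ?_
  have hadj' : ∀ x ∉ S, ∀ y, (singleGraph m).Adj x y ↔ (singleGraph initialConfig).Adj x y :=
    fun x hx y => and_congr_right fun _ => by rw [hE _ ⟨x, Sym2.mem_mk_left x y, hx⟩]
  constructor
  · rintro ⟨φ, hφ⟩ x hx y hy
    by_cases hxy : x = y
    · rw [hxy]
      exact iff_of_true (SimpleGraph.Reachable.refl _) (SimpleGraph.Reachable.refl _)
    by_cases hx' : ∃ z, (singleGraph initialConfig).Adj x z
    · obtain ⟨z, hz⟩ := hx'
      -- The path of the initial configuration through `x` contains `x` outside `S`; so does the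
      -- matching path of `m`, which is therefore the component of `x` in `m`. Comparing the two
      -- outside `S` decides about `y`.
      set C₀ : infinitePaths initialConfig :=
        ⟨(singleGraph initialConfig).connectedComponentMk x, by
          change Set.Infinite _
          rw [supp_mk_eq]; exact hadj x z hz⟩ with hC₀
      have h1 := hφ (φ.symm C₀)
      rw [Equiv.apply_symm_apply] at h1
      have h2 : x ∈ (φ.symm C₀).1.supp := by
        have : x ∈ C₀.1.supp \ S := ⟨SimpleGraph.ConnectedComponent.connectedComponentMk_mem, hx⟩
        rw [← h1] at this
        exact this.1
      have h3 : (φ.symm C₀).1 = (singleGraph m).connectedComponentMk x := h2.symm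
      rw [h3, supp_mk_eq, hC₀, supp_mk_eq] at h1
      have h4 := Set.ext_iff.1 h1 y
      exact ⟨fun h => (h4.1 ⟨h, hy⟩).1, fun h => (h4.2 ⟨h, hy⟩).1⟩
    · refine iff_of_false (fun h => hx' ?_) (fun h => hx' (exists_adj_of_reachable h hxy))
      obtain ⟨z, hz⟩ := exists_adj_of_reachable h hxy
      exact ⟨z, (hadj' x hx z).1 hz⟩
  · intro hR
    -- An infinite component cannot be contained in `S`. A representative outside `S` is used to
    -- transport the component to the other configuration.
    have hex : ∀ {m : Sym2 Node → ℕ} (C : infinitePaths m), ∃ x, x ∈ C.1.supp ∧ x ∉ S := by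
      intro m C
      obtain ⟨x, hx⟩ := (Set.Infinite.sdiff C.2 hS).nonempty
      exact ⟨x, hx⟩
    choose f hf hfS using @hex
    have hcomp : ∀ {m : Sym2 Node → ℕ} (C : infinitePaths m) {x : Node}, x ∈ C.1.supp →
        C.1.supp = {y | (singleGraph m).Reachable x y} := by
      intro m C x hx
      have h3 : C.1 = (singleGraph m).connectedComponentMk x := hx.symm
      rw [h3, supp_mk_eq]
    have hcompl : ∀ x ∉ S, {y | (singleGraph m).Reachable x y} \ S =
        {y | (singleGraph initialConfig).Reachable x y} \ S := by
      intro x hx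
      ext y
      exact ⟨fun h => ⟨(hR x hx y h.2).1 h.1, h.2⟩, fun h => ⟨(hR x hx y h.2).2 h.1, h.2⟩⟩
    have hinf' : ∀ x ∉ S, {y | (singleGraph m).Reachable x y}.Infinite ↔
        {y | (singleGraph initialConfig).Reachable x y}.Infinite := by
      intro x hx
      have aux : ∀ A : Set Node, A.Infinite ↔ (A \ S).Infinite := fun A =>
        ⟨fun h => h.sdiff hS, fun h => h.mono Set.sdiff_subset⟩
      rw [aux, hcompl x hx, ← aux]
    let F : infinitePaths m → infinitePaths initialConfig := fun C =>
      ⟨(singleGraph initialConfig).connectedComponentMk (f C), by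
        change Set.Infinite _
        rw [supp_mk_eq, ← hinf' _ (hfS C), ← hcomp C (hf C)]
        exact C.2⟩
    have hF : ∀ C, (F C).1.supp = {y | (singleGraph initialConfig).Reachable (f C) y} :=
      fun C => supp_mk_eq _ _
    refine ⟨Equiv.ofBijective F ⟨?_, ?_⟩, ?_⟩
    · intro C C' hCC
      have h1 : (singleGraph initialConfig).Reachable (f C) (f C') :=
        SimpleGraph.ConnectedComponent.exact (congrArg Subtype.val hCC)
      have h2 := (hR _ (hfS C) _ (hfS C')).2 h1
      apply Subtype.ext
      apply SimpleGraph.ConnectedComponent.supp_injective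
      rw [hcomp C (hf C), hcomp C' (hf C'), setOf_reachable_eq h2]
    · intro C₀
      set C : infinitePaths m := ⟨(singleGraph m).connectedComponentMk (f C₀), by
        change Set.Infinite _
        rw [supp_mk_eq, hinf' _ (hfS C₀), ← hcomp C₀ (hf C₀)]
        exact C₀.2⟩ with hC
      refine ⟨C, ?_⟩
      apply Subtype.ext
      apply SimpleGraph.ConnectedComponent.supp_injective
      rw [hF, hcomp C₀ (hf C₀)]
      apply setOf_reachable_eq
      rw [← hR _ (hfS C) _ (hfS C₀)]
      have h1 := hf C
      have h2 : C.1.supp = _ := supp_mk_eq m (f C₀)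
      rw [h2] at h1
      exact SimpleGraph.Reachable.symm h1
    · intro C
      change C.1.supp \ S = (F C).1.supp \ S
      rw [hF, hcomp C (hf C), hcompl _ (hfS C)]

/-- A loop with a node outside `S` would contain the infinitely many nodes outside `S` of a path of
the initial configuration. Hence all loops are subsets of the finite set `S`. -/
theorem IsTaut.loops_finite (hinf : ∀ x ∈ nodes orthant,
      {y | (singleGraph initialConfig).Reachable x y}.Infinite) {U : Set Vec} {m : Sym2 Node → ℕ}
    (hm : IsTaut U m) : (loops m).Finite := by
  obtain ⟨-, S, hS, hE, hR⟩ := (isTaut_iff hinf).1 hm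
  rw [loops_finite_iff]
  refine hS.finite_subsets.subset ?_
  rintro _ ⟨x, rfl, hf, hn⟩ y hy
  by_contra hyS
  rw [setOf_reachable_eq hy] at hf hn
  obtain ⟨z, hz⟩ := nontrivial_iff_exists_adj.1 hn
  have hz' : (singleGraph initialConfig).Adj y z :=
    ⟨hz.1, by rw [← hE _ ⟨y, Sym2.mem_mk_left y z, hyS⟩]; exact hz.2⟩
  have h1 : s(y, z) ∈ (graph orthant).edgeSet := by
    by_contra hcon
    have : initialConfig s(y, z) = 0 := Set.indicator_of_notMem (fun hE => hcon hE.1) _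
    rw [hz'.2] at this
    exact one_ne_zero this
  refine ((hinf y ((graph orthant).mem_edgeSet.1 h1).1).sdiff hS) (hf.subset ?_)
  exact fun w hw => (hR y hyS w hw.2).2 hw.1

/-- Enlarging the exceptional set by both patches leaves only nodes for which `reachable_exchange`
compares the connectivity before and after. -/
theorem isTaut_exchange (hinf : ∀ x ∈ nodes orthant,
      {y | (singleGraph initialConfig).Reachable x y}.Infinite) {t t' : Bool} {U U' : Set Vec}
    {O : Set Node} {Eo : Set (Sym2 Node)} {φ φ' : Fin 18 → Node}
    (h : PatchPair t t' U U' O Eo φ φ') {m : Sym2 Node → ℕ} (hm : IsTaut U m) {κ : Fin 21 → ℕ}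
    (hκ : IsPatchConfig t' κ) (hkey : key t (fun e => m (patchEdge t φ e)) = key t' κ) :
    IsTaut U' (glue t' φ' (Eo.indicator m) κ) := by
  classical
  rw [isTaut_iff hinf] at hm ⊢
  obtain ⟨hD, S, hS, hE, hR⟩ := hm
  refine ⟨isDoubleDimer_glue h hD hκ hkey, S ∪ Set.range φ ∪ Set.range φ',
    (hS.union (Set.finite_range _)).union (Set.finite_range _), ?_, ?_⟩
  · rintro E ⟨x, hxE, hx⟩
    simp only [Set.mem_union, not_or] at hx
    have h1 : ∀ e, patchEdge t' φ' e ≠ E := by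
      rintro e rfl
      obtain ⟨a, rfl, -⟩ := exists_of_mem_patchEdge hxE
      exact hx.2 ⟨a, rfl⟩
    have h2 : ∀ e, patchEdge t φ e ≠ E := by
      rintro e rfl
      obtain ⟨a, rfl, -⟩ := exists_of_mem_patchEdge hxE
      exact hx.1.2 ⟨a, rfl⟩
    rw [glue_of_forall_ne _ _ h1, ← hE E ⟨x, hxE, hx.1.1⟩]
    have := congrFun (glue_eq_self h.left (fun E hE => hD.eq_zero hE)) E
    rwa [glue_of_forall_ne _ _ h2] at this
  · intro x hx y hy
    simp only [Set.mem_union, not_or] at hx hy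
    rw [← hR x hx.1.1 y hy.1.1]
    have hμ : ∀ E ∉ Eo, Eo.indicator m E = 0 := fun E hE => Set.indicator_of_notMem hE _
    have hκm := isPatchConfig_of_isDoubleDimer h.left hD
    have hself := glue_eq_self h.left (fun E hE => hD.eq_zero hE)
    have key : (singleGraph (glue t' φ' (Eo.indicator m) κ)).Reachable x y ↔
        (singleGraph (glue t φ (Eo.indicator m) fun e => m (patchEdge t φ e))).Reachable x y := by
      by_cases hxy : x = y
      · rw [hxy]
        exact iff_of_true (SimpleGraph.Reachable.refl _) (SimpleGraph.Reachable.refl _)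
      -- A node outside the patch which is connected to a different node has a single edge and so is
      -- an outer node; isolated points of the type `Node` are excluded in this way.
      have aux : ∀ {t : Bool} {U : Set Vec} {φ : Fin 18 → Node} {κ : Fin 21 → ℕ} {x y : Node},
          Patching t U O Eo φ → x ≠ y → x ∉ Set.range φ →
          (singleGraph (glue t φ (Eo.indicator m) κ)).Reachable x y → x ∈ O := by
        intro t U φ κ x y h hxy hx hr
        obtain ⟨z, hz⟩ := exists_adj_of_reachable hr hxy
        exact (mem_of_adj_glue h hμ hz).resolve_right hx
      constructor
      · intro hr
        exact reachable_exchange h.symm hμ hκ hκm hkey.symm (aux h.right hxy hx.2 hr)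
          (aux h.right (Ne.symm hxy) hy.2 hr.symm) hr
      · intro hr
        exact reachable_exchange h hμ hκm hκ hkey (aux h.left hxy hx.1.2 hr)
          (aux h.left (Ne.symm hxy) hy.1.2 hr.symm) hr
    rw [key, hself]

/-! ### Weights and patches -/

/-- The edges which could belong to the boundary of the face with a given label. -/
def faceCond : Label → Set (Sym2 Node)
  | .vertex v => {E | ∀ x ∈ E, v ∈ x.2.ends}
  | .face Q => {E | ∀ x ∈ E, x.1 = Q}

theorem faceEdges_eq (U : Set Vec) (l : Label) :
    faceEdges U l = (graph U).edgeSet ∩ faceCond l := by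
  cases l <;> rfl

/-- The legs on the boundary of a face of the patch. -/
def legFace : Fin 10 → Finset (Fin 21) :=
  ![{15, 16}, {16, 17}, {17, 18}, {18, 19}, {19, 20}, {20, 15}, ∅, ∅, ∅, ∅]

/-- A patch together with the labels `lam` of its faces and the labels `L` of the other faces. -/
structure FacePatching (t : Bool) (U : Set Vec) (O : Set Node) (Eo : Set (Sym2 Node))
    (φ : Fin 18 → Node) (L : Set Label) (lam : Fin 10 → Label) : Prop
    extends Patching t U O Eo φ where
  lam_inj : Function.Injective lam
  labels_eq : labels U = L ∪ Set.range lam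
  lam_notMem : ∀ i, lam i ∉ L
  face_iff : ∀ i e, patchEdge t φ e ∈ faceCond (lam i) ↔ e ∈ patchFace t i ∪ legFace i
  face_inner : ∀ i : Fin 10, 6 ≤ i.1 → ∀ E ∈ Eo, E ∉ faceCond (lam i)
  face_outer : ∀ l ∈ L, ∀ e, patchEdge t φ e ∉ faceCond l
  face_finite : ∀ i, (Eo ∩ faceCond (lam i)).Finite

/-- The contribution of the outer edges to the exponent of a face. -/
def outerExp (Eo : Set (Sym2 Node)) (μ : Sym2 Node → ℕ) (l : Label) : ℤ :=
  ((Eo ∩ faceCond l).ncard : ℤ) - ∑ᶠ E ∈ Eo ∩ faceCond l, (μ E : ℤ)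

/-! ### Exponents and weights split at a patch. -/

section Exponents

variable {t : Bool} {U : Set Vec} {O : Set Node} {Eo : Set (Sym2 Node)} {φ : Fin 18 → Node}
  {L : Set Label} {lam : Fin 10 → Label}

theorem faceEdges_patch (h : FacePatching t U O Eo φ L lam) (i : Fin 10) :
    faceEdges U (lam i) = (Eo ∩ faceCond (lam i)) ∪
      patchEdge t φ '' ((patchFace t i ∪ legFace i : Finset (Fin 21)) : Set (Fin 21)) := by
  rw [faceEdges_eq, h.edges_eq, Set.union_inter_distrib_right]
  congr 1
  ext E
  constructor
  · rintro ⟨⟨e, rfl⟩, he⟩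
    exact ⟨e, Finset.mem_coe.2 ((h.face_iff i e).1 he), rfl⟩
  · rintro ⟨e, he, rfl⟩
    exact ⟨⟨e, rfl⟩, (h.face_iff i e).2 (Finset.mem_coe.1 he)⟩

theorem card_face (t : Bool) (i : Fin 10) :
    (patchFace t i ∪ legFace i).card = patchExp t i + 2 := by
  revert t i; decide

theorem disjoint_face (t : Bool) (i : Fin 10) : Disjoint (patchFace t i) (legFace i) := by
  revert t i; decide

/-- The boundary of a patch face consists of outer edges, legs and inner edges. The number of the
last two kinds together is `patchExp + 2`, which absorbs the constant `-2`. -/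
theorem faceExponent_patch (h : FacePatching t U O Eo φ L lam) (μ : Sym2 Node → ℕ)
    (κ : Fin 21 → ℕ) (i : Fin 10) : faceExponent U (glue t φ μ κ) (lam i) =
      (outerExp Eo μ (lam i) - ∑ e ∈ legFace i, (κ e : ℤ)) +
        ((patchExp t i : ℤ) - ∑ e ∈ patchFace t i, (κ e : ℤ)) := by
  have hd : Disjoint (Eo ∩ faceCond (lam i))
      (patchEdge t φ '' ((patchFace t i ∪ legFace i : Finset (Fin 21)) : Set (Fin 21))) := by
    rw [Set.disjoint_left]
    rintro E hE ⟨e, -, rfl⟩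
    exact h.patchEdge_notMem e hE.1
  have hinj := patchEdge_injective t h.inj
  have h1 : ∑ᶠ E ∈ Eo ∩ faceCond (lam i), ((glue t φ μ κ E : ℕ) : ℤ) =
      ∑ᶠ E ∈ Eo ∩ faceCond (lam i), (μ E : ℤ) :=
    finsum_mem_congr rfl fun E hE => by rw [glue_of_mem h.toPatching _ _ hE.1]
  rw [faceExponent, faceEdges_patch h, finsum_mem_union hd (h.face_finite i) (Set.toFinite _),
    Set.ncard_union_eq hd (h.face_finite i) (Set.toFinite _),
    Set.ncard_image_of_injective _ hinj, Set.ncard_coe_finset, card_face,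
    finsum_mem_image hinj.injOn, finsum_mem_coe_finset, h1]
  simp only [glue_patchEdge h.inj]
  rw [Finset.sum_union (disjoint_face t i), outerExp]
  push_cast
  ring

theorem faceExponent_outer (h : FacePatching t U O Eo φ L lam) (μ : Sym2 Node → ℕ)
    (κ : Fin 21 → ℕ) {l : Label} (hl : l ∈ L) :
    faceExponent U (glue t φ μ κ) l = outerExp Eo μ l - 2 := by
  have h0 : faceEdges U l = Eo ∩ faceCond l := by
    rw [faceEdges_eq, h.edges_eq, Set.union_inter_distrib_right]
    apply Set.union_eq_self_of_subset_right
    rintro _ ⟨⟨e, rfl⟩, he⟩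
    exact absurd he (h.face_outer l hl e)
  have h1 : ∑ᶠ E ∈ Eo ∩ faceCond l, ((glue t φ μ κ E : ℕ) : ℤ) =
      ∑ᶠ E ∈ Eo ∩ faceCond l, (μ E : ℤ) :=
    finsum_mem_congr rfl fun E hE => by rw [glue_of_mem h.toPatching _ _ hE.1]
  rw [faceExponent, h0, h1, outerExp]
  ring

variable {F : Type*} [Field F]

/-- The part of the weight of a configuration which comes from outside the patch. -/
def outerWeight (Eo : Set (Sym2 Node)) (L : Set Label) (lam : Fin 10 → Label) (A : Label → F)
    (μ : Sym2 Node → ℕ) (κ : Fin 21 → ℕ) : F :=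
  (∏ᶠ l ∈ L, A l ^ (outerExp Eo μ l - 2)) *
    ∏ i, A (lam i) ^ (outerExp Eo μ (lam i) - ∑ e ∈ legFace i, (κ e : ℤ))

/-- The product over the faces in the formula for `A(0,0,0)`. -/
def faceWeight (U : Set Vec) (A : Label → F) (m : Sym2 Node → ℕ) : F :=
  ∏ᶠ l ∈ labels U, A l ^ faceExponent U m l

/-- The product over the outer labels is infinite as written; finiteness of the nonzero exponents is
what allows the ten patch labels to be split off. -/
theorem faceWeight_glue (h : FacePatching t U O Eo φ L lam) {A : Label → F}
    (hA : ∀ i, A (lam i) ≠ 0) (μ : Sym2 Node → ℕ) (κ : Fin 21 → ℕ)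
    (hfin : {l | l ∈ labels U ∧ faceExponent U (glue t φ μ κ) l ≠ 0}.Finite) :
    faceWeight U A (glue t φ μ κ) =
      outerWeight Eo L lam A μ κ * patchWeight t (fun i => A (lam i)) κ := by
  have hd : Disjoint L (Set.range lam) := by
    rw [Set.disjoint_left]
    rintro l hl ⟨i, rfl⟩
    exact h.lam_notMem i hl
  rw [faceWeight, h.labels_eq, finprod_mem_union' hd _ ((Set.finite_range lam).inter_of_left _),
    finprod_mem_range h.lam_inj,
    finprod_eq_prod_of_fintype (fun i => A (lam i) ^ faceExponent U (glue t φ μ κ) (lam i)), outerWeight, patchWeight, mul_assoc,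
    ← Finset.prod_mul_distrib]
  · congr 1
    · exact finprod_mem_congr rfl fun l hl => by rw [faceExponent_outer h _ _ hl]
    · refine Finset.prod_congr rfl fun i _ => ?_
      rw [faceExponent_patch h, zpow_add₀ (hA i)]
  · refine hfin.subset ?_
    rintro l ⟨hl, hl'⟩
    refine ⟨by rw [h.labels_eq]; exact Or.inl hl, fun h0 => hl' ?_⟩
    simp [h0]

end Exponents

/-- Two patches with labels which can be exchanged. -/
structure FacePatchPair (t t' : Bool) (U U' : Set Vec) (O : Set Node) (Eo : Set (Sym2 Node))
    (φ φ' : Fin 18 → Node) (L : Set Label) (lam lam' : Fin 10 → Label) : Prop where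
  left : FacePatching t U O Eo φ L lam
  right : FacePatching t' U' O Eo φ' L lam'
  ext_eq : ∀ k : Fin 6, φ (Fin.natAdd 12 k) = φ' (Fin.natAdd 12 k)
  lam_eq : ∀ i : Fin 10, i.1 < 6 → lam i = lam' i

/-! ### Exchanging the patch in the sum over taut configurations. -/

section Sum

variable {t t' : Bool} {U U' : Set Vec} {O : Set Node} {Eo : Set (Sym2 Node)}
  {φ φ' : Fin 18 → Node} {L : Set Label} {lam lam' : Fin 10 → Label}
  {F : Type*} [Field F]

theorem FacePatchPair.toPatchPair (h : FacePatchPair t t' U U' O Eo φ φ' L lam lam') :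
    PatchPair t t' U U' O Eo φ φ' := ⟨h.left.toPatching, h.right.toPatching, h.ext_eq⟩

theorem FacePatching.refl (h : FacePatching t U O Eo φ L lam) :
    FacePatchPair t t U U O Eo φ φ L lam lam := ⟨h, h, fun _ => rfl, fun _ _ => rfl⟩

theorem outerExp_inner (h : FacePatching t U O Eo φ L lam) (μ : Sym2 Node → ℕ) {i : Fin 10}
    (hi : 6 ≤ i.1) : outerExp Eo μ (lam i) = 0 := by
  have : Eo ∩ faceCond (lam i) = ∅ :=
    Set.eq_empty_iff_forall_notMem.2 fun E hE => h.face_inner i hi E hE.1 hE.2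
  rw [outerExp, this]
  simp

theorem legFace_inner {i : Fin 10} (hi : 6 ≤ i.1) : legFace i = ∅ := by
  revert i; decide

theorem legFace_spec {i : Fin 10} {e : Fin 21} (he : e ∈ legFace i) : ∃ k, e = leg k := by
  revert i e; decide

/-- The four interior faces receive nothing from outer edges or legs. At the corners of the hexagon,
whose labels are common, only leg multiplicities enter. -/
theorem outerWeight_exchange (h : FacePatchPair t t' U U' O Eo φ φ' L lam lam') (A : Label → F)
    (μ : Sym2 Node → ℕ) {κ κ' : Fin 21 → ℕ} (hκ : ∀ k, κ (leg k) = κ' (leg k)) :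
    outerWeight Eo L lam A μ κ = outerWeight Eo L lam' A μ κ' := by
  rw [outerWeight, outerWeight]
  congr 1
  refine Finset.prod_congr rfl fun i _ => ?_
  by_cases hi : i.1 < 6
  · rw [h.lam_eq i hi, Finset.sum_congr rfl fun e he => ?_]
    obtain ⟨k, rfl⟩ := legFace_spec he
    rw [hκ]
  · rw [outerExp_inner h.left _ (by omega), outerExp_inner h.right _ (by omega),
      legFace_inner (by omega)]
    simp

variable (hinf : ∀ x ∈ nodes orthant, {y | (singleGraph initialConfig).Reachable x y}.Infinite)
include hinf

theorem exists_taut_exchange (h : PatchPair t t' U U' O Eo φ φ') {m : Sym2 Node → ℕ}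
    (hm : IsTaut U m) : ∃ m', IsTaut U' m' ∧ Eo.indicator m' = Eo.indicator m ∧
      key t' (fun e => m' (patchEdge t' φ' e)) = key t fun e => m (patchEdge t φ e) := by
  classical
  obtain ⟨κ, hκ, hkey⟩ :=
    exists_patchConfig_of_key (isPatchConfig_of_isDoubleDimer h.left hm.1) t'
  refine ⟨_, isTaut_exchange hinf h hm hκ hkey.symm, indicator_glue h.right
    (fun E hE => Set.indicator_of_notMem hE _) _, ?_⟩
  simp only [glue_patchEdge h.right.inj, hkey]

/-- A taut configuration on the new graph is determined by the outer part of a taut configuration on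
the old graph and by one of finitely many patch configurations. -/
theorem tautConfigs_finite_exchange (h : PatchPair t t' U U' O Eo φ φ')
    (hfin : (tautConfigs U).Finite) : (tautConfigs U').Finite := by
  classical
  refine (Set.Finite.image2 (fun m κ => glue t' φ' (Eo.indicator m) κ) hfin
    (patchConfigs t').finite_toSet).subset ?_
  intro m' hm'
  obtain ⟨m, hm, hi, -⟩ := exists_taut_exchange hinf h.symm hm'
  refine ⟨m, hm, _, Finset.mem_coe.2
    (mem_patchConfigs.2 (isPatchConfig_of_isDoubleDimer h.right hm'.1)), ?_⟩
  simp only [hi]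
  exact glue_eq_self h.right fun E hE => hm'.1.eq_zero hE

/-- The taut configurations and the exponents of their weights are finite in number. -/
def HasFiniteExponents (U : Set Vec) : Prop :=
  ∀ m ∈ tautConfigs U, {l | l ∈ labels U ∧ faceExponent U m l ≠ 0}.Finite

/-- At the outer labels the exponents are those of a taut configuration on the old graph with the
same outer part; only ten labels are left. -/
theorem hasFiniteExponents_exchange (h : FacePatchPair t t' U U' O Eo φ φ' L lam lam')
    (hfin : HasFiniteExponents U) : HasFiniteExponents U' := by
  classical
  intro m' hm'
  obtain ⟨m, hm, hi, -⟩ := exists_taut_exchange hinf h.toPatchPair.symm hm'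
  refine ((hfin m hm).union (Set.finite_range lam')).subset ?_
  rintro l ⟨hl, hl'⟩
  rw [h.right.labels_eq] at hl
  rcases hl with hl | hl
  · refine Or.inl ⟨by rw [h.left.labels_eq]; exact Or.inl hl, ?_⟩
    have e1 := faceExponent_outer h.left (Eo.indicator m) (fun e => m (patchEdge t φ e)) hl
    have e2 := faceExponent_outer h.right (Eo.indicator m') (fun e => m' (patchEdge t' φ' e)) hl
    rw [glue_eq_self h.left.toPatching fun E hE => hm.1.eq_zero hE, hi] at e1
    rw [glue_eq_self h.right.toPatching fun E hE => hm'.1.eq_zero hE, ← e1] at e2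
    rwa [e2] at hl'
  · exact Or.inr hl

open Classical in
/-- The sum of the weights of the taut configurations with given outer part and key. -/
theorem sum_fiber (h : FacePatching t U O Eo φ L lam) {A : Label → F} (hA : ∀ i, A (lam i) ≠ 0)
    (hfin : (tautConfigs U).Finite) (hexp : HasFiniteExponents U) {m₀ : Sym2 Node → ℕ}
    (hm₀ : IsTaut U m₀) :
    ∑ m ∈ hfin.toFinset.filter fun m => (Eo.indicator m, key t fun e => m (patchEdge t φ e)) =
        (Eo.indicator m₀, key t fun e => m₀ (patchEdge t φ e)),
      2 ^ loopCount m * faceWeight U A m =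
    2 ^ (loopTraces O m₀).ncard *
      outerWeight Eo L lam A (Eo.indicator m₀) (fun e => m₀ (patchEdge t φ e)) *
      keySum t (fun i => A (lam i)) (key t fun e => m₀ (patchEdge t φ e)) := by
  have hμ : ∀ E ∉ Eo, Eo.indicator m₀ E = 0 := fun E hE => Set.indicator_of_notMem hE _
  have hpair := h.refl
  have hκ₀ := isPatchConfig_of_isDoubleDimer h.toPatching hm₀.1
  rw [keySum, Finset.mul_sum]
  symm
  -- With the outer part fixed, taut configurations with the given key correspond to patch
  -- configurations with this key: replacing the patch of `m₀` by any of them preserves tautness.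
  refine Finset.sum_bij' (fun κ _ => glue t φ (Eo.indicator m₀) κ)
    (fun m _ e => m (patchEdge t φ e)) ?_ ?_ ?_ ?_ ?_
  · intro κ hκ
    rw [Finset.mem_filter, mem_patchConfigs] at hκ
    rw [Finset.mem_filter, Set.Finite.mem_toFinset]
    refine ⟨isTaut_exchange hinf hpair.toPatchPair hm₀ hκ.1 hκ.2.symm, ?_⟩
    simp only [glue_patchEdge h.inj, hκ.2, indicator_glue h.toPatching hμ]
  · intro m hm
    rw [Finset.mem_filter, Set.Finite.mem_toFinset, Prod.mk.injEq] at hm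
    rw [Finset.mem_filter, mem_patchConfigs]
    exact ⟨isPatchConfig_of_isDoubleDimer h.toPatching hm.1.1, hm.2.2⟩
  · intro κ _
    funext e
    exact glue_patchEdge h.inj _ _ _
  · intro m hm
    rw [Finset.mem_filter, Set.Finite.mem_toFinset, Prod.mk.injEq] at hm
    rw [← hm.2.1]
    exact glue_eq_self h.toPatching fun E hE => hm.1.1.eq_zero hE
  · intro κ hκ
    rw [Finset.mem_filter, mem_patchConfigs] at hκ
    have htaut := isTaut_exchange hinf hpair.toPatchPair hm₀ hκ.1 hκ.2.symm
    have h1 := loopTraces_exchange hpair.toPatchPair hμ hκ₀ hκ.1 hκ.2.symm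
    rw [glue_eq_self h.toPatching fun E hE => hm₀.1.eq_zero hE] at h1
    rw [loopCount_glue h.toPatching hμ hκ.1 (htaut.loops_finite hinf), ← h1,
      faceWeight_glue h hA _ _ (hexp _ htaut),
      outerWeight_exchange hpair A _ (leg_eq_of_key hκ.1 hκ₀ hκ.2), pow_add]
    ring

/-- The sum over the taut configurations does not change when a patch is exchanged. -/
theorem tautSum_exchange (h : FacePatchPair false true U U' O Eo φ φ' L lam lam') [CharZero F]
    {A : Label → F} (hA : ∀ i, A (lam i) ≠ 0) (hA' : ∀ i, A (lam' i) ≠ 0)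
    (hrec : PatchRecurrence (fun i => A (lam i)) fun i => A (lam' i))
    (hfin : (tautConfigs U).Finite) (hexp : HasFiniteExponents U) :
    ∑ᶠ m ∈ tautConfigs U, 2 ^ loopCount m * faceWeight U A m =
      ∑ᶠ m ∈ tautConfigs U', 2 ^ loopCount m * faceWeight U' A m := by
  classical
  have hfin' := tautConfigs_finite_exchange hinf h.toPatchPair hfin
  have hexp' := hasFiniteExponents_exchange hinf h hexp
  rw [finsum_mem_eq_finite_toFinset_sum _ hfin, finsum_mem_eq_finite_toFinset_sum _ hfin']
  set K : (Sym2 Node → ℕ) → (Sym2 Node → ℕ) × ℕ :=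
    fun m => (Eo.indicator m, key false fun e => m (patchEdge false φ e)) with hK
  set K' : (Sym2 Node → ℕ) → (Sym2 Node → ℕ) × ℕ :=
    fun m => (Eo.indicator m, key true fun e => m (patchEdge true φ' e)) with hK'
  -- The same pairs of an outer part and a key occur for both solids, so the two sums may be
  -- compared fibre by fibre.
  have himg : hfin.toFinset.image K = hfin'.toFinset.image K' := by
    ext k
    simp only [Finset.mem_image, Set.Finite.mem_toFinset]
    constructor
    · rintro ⟨m, hm, rfl⟩
      obtain ⟨m', hm', h1, h2⟩ := exists_taut_exchange hinf h.toPatchPair hm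
      exact ⟨m', hm', Prod.ext h1 h2⟩
    · rintro ⟨m, hm, rfl⟩
      obtain ⟨m', hm', h1, h2⟩ := exists_taut_exchange hinf h.toPatchPair.symm hm
      exact ⟨m', hm', Prod.ext h1 h2⟩
  rw [← Finset.sum_fiberwise_of_maps_to (g := K) (t := hfin.toFinset.image K)
      fun m hm => Finset.mem_image_of_mem K hm,
    ← Finset.sum_fiberwise_of_maps_to (g := K') (t := hfin'.toFinset.image K')
      fun m hm => Finset.mem_image_of_mem K' hm, ← himg]
  refine Finset.sum_congr rfl fun k hk => ?_
  have hk' := hk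
  rw [himg] at hk'
  obtain ⟨m, hm, rfl⟩ := Finset.mem_image.1 hk
  obtain ⟨m', hm', hmm⟩ := Finset.mem_image.1 hk'
  rw [Set.Finite.mem_toFinset] at hm hm'
  have e1 := sum_fiber hinf h.left hA hfin hexp hm
  have e2 := sum_fiber hinf h.right hA' hfin' hexp' hm'
  have hmm' := hmm
  rw [hK, hK', Prod.mk.injEq] at hmm'
  obtain ⟨h1, h2⟩ := hmm'
  have hκ := isPatchConfig_of_isDoubleDimer h.left.toPatching hm.1
  have hκ' := isPatchConfig_of_isDoubleDimer h.right.toPatching hm'.1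
  have h3 := loopTraces_exchange h.toPatchPair (μ := Eo.indicator m)
    (fun E hE => Set.indicator_of_notMem hE _) hκ hκ' h2.symm
  rw [glue_eq_self h.left.toPatching fun E hE => hm.1.eq_zero hE, ← h1,
    glue_eq_self h.right.toPatching fun E hE => hm'.1.eq_zero hE] at h3
  have h4 := outerWeight_exchange h A (Eo.indicator m) (leg_eq_of_key hκ hκ' h2.symm)
  have h5 := keySum_false_eq_true hA hA' hrec (key_mem_keyList hκ)
  calc _ = _ := e1
    _ = _ := by rw [h3, h4, h5, h1, h2]
    _ = _ := e2.symm
    _ = _ := by rw [← hmm]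

end Sum

/-! ### Squares, edges and translations -/

instance : DecidableEq Square := fun P Q =>
  decidable_of_iff (P.normal = Q.normal ∧ P.base = Q.base) Square.ext_iff.symm

instance : DecidableEq LEdge := fun a b =>
  decidable_of_iff (a.dir = b.dir ∧ a.base = b.base) LEdge.ext_iff.symm

theorem e_apply (i j : Fin 3) : e i j = if j = i then 1 else 0 := by
  simp [e, Pi.single_apply]

theorem e_same (i : Fin 3) : e i i = 1 := by simp [e]

theorem e_of_ne {i j : Fin 3} (h : j ≠ i) : e i j = 0 := by simp [e, h]

/-- The third direction. -/
def third (i j : Fin 3) : Fin 3 := -(i + j)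

theorem third_ne_left {i j : Fin 3} (h : i ≠ j) : third i j ≠ i := by revert i j; decide

theorem third_ne_right {i j : Fin 3} (h : i ≠ j) : third i j ≠ j := by revert i j; decide

theorem eq_of_ne_ne {i j k : Fin 3} (hij : i ≠ j) (hik : k ≠ i) (hjk : k ≠ j) :
    k = third i j := by revert i j k; decide

theorem third_comm (i j : Fin 3) : third i j = third j i := by revert i j; decide

theorem third_third {i j : Fin 3} (h : i ≠ j) : third i (third i j) = j := by revert i j; decide

theorem vec_ext {i j : Fin 3} (h : i ≠ j) {u w : Vec} (h1 : u i = w i) (h2 : u j = w j)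
    (h3 : u (third i j) = w (third i j)) : u = w := by
  funext k
  by_cases hki : k = i
  · rw [hki, h1]
  · by_cases hkj : k = j
    · rw [hkj, h2]
    · rw [eq_of_ne_ne h hki hkj, h3]

/-- The two ends differ by one in the direction of the edge, so this direction is not the normal and
the base of the edge has the lower value there. Freedom remains only in the third direction. -/
theorem isSide_iff (a : LEdge) (Q : Square) : a.IsSide Q ↔ a.dir ≠ Q.normal ∧
    (a.base = Q.base ∨ a.base = Q.base + e (third a.dir Q.normal)) := by
  constructor
  · intro h
    have h1 := h (show a.base ∈ a.ends from Or.inl rfl)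
    have h2 := h (show a.base + e a.dir ∈ a.ends from Or.inr rfl)
    have hd : a.dir ≠ Q.normal := by
      intro hd
      have h3 := h1.1
      have h4 := h2.1
      rw [Pi.add_apply, hd, e_same] at h4
      omega
    refine ⟨hd, ?_⟩
    have h3 : a.base a.dir = Q.base a.dir := by
      have h3 := h1.2 _ hd
      have h4 := h2.2 _ hd
      rw [Pi.add_apply, e_same] at h4
      omega
    rcases h1.2 _ (third_ne_right hd) with h4 | h4
    · exact Or.inl (vec_ext hd h3 h1.1 h4)
    · refine Or.inr (vec_ext hd ?_ ?_ ?_)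
      · rw [Pi.add_apply, e_of_ne (third_ne_left hd).symm, h3, add_zero]
      · rw [Pi.add_apply, e_of_ne (third_ne_right hd).symm, h1.1, add_zero]
      · rw [Pi.add_apply, e_same, h4]
  · rintro ⟨hd, h⟩
    have key : ∀ i, i ≠ Q.normal → i = a.dir ∨ i = third a.dir Q.normal := by
      intro i hi
      by_cases h : i = a.dir
      · exact Or.inl h
      · exact Or.inr (eq_of_ne_ne hd h hi)
    have ht := third_ne_left hd
    have ht' := third_ne_right hd
    rintro w (rfl | rfl)
    · rcases h with h | h
      · rw [h]; exact ⟨rfl, fun i _ => Or.inl rfl⟩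
      · rw [h]
        refine ⟨by simp [e_of_ne ht'.symm], fun i hi => ?_⟩
        rcases key i hi with rfl | rfl
        · left; simp [e_of_ne ht.symm]
        · right; simp [e_same]
    · rcases h with h | h
      · rw [h]
        refine ⟨by simp [e_of_ne hd.symm], fun i hi => ?_⟩
        rcases key i hi with rfl | h'
        · right; simp [e_same]
        · left; rw [h']; simp [e_of_ne ht]
      · rw [h]
        refine ⟨by simp [e_of_ne ht'.symm, e_of_ne hd.symm], fun i hi => ?_⟩
        rcases key i hi with rfl | h'
        · right; simp [e_same, e_of_ne ht.symm]
        · right; rw [h']; simp [e_of_ne ht, e_same]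

instance (a : LEdge) (Q : Square) : Decidable (a.IsSide Q) := decidable_of_iff _ (isSide_iff a Q).symm

instance (a : LEdge) (w : Vec) : Decidable (w ∈ a.ends) :=
  inferInstanceAs (Decidable (w = a.base ∨ w = a.base + e a.dir))

theorem meet_iff (a b : LEdge) : (a.ends ∩ b.ends).Nonempty ↔
    a.base ∈ b.ends ∨ a.base + e a.dir ∈ b.ends := by
  constructor
  · rintro ⟨w, rfl | rfl, h⟩
    exacts [Or.inl h, Or.inr h]
  · rintro (h | h)
    exacts [⟨_, Or.inl rfl, h⟩, ⟨_, Or.inr rfl, h⟩]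

instance (a b : LEdge) : Decidable (a.ends ∩ b.ends).Nonempty := decidable_of_iff _ (meet_iff a b).symm

/-- The adjacency relation of the graphs `Γ(U)`, without the condition that the nodes belong
to `Γ(U)`. -/
def NodeAdj (x y : Node) : Prop :=
  (x.1 = y.1 ∧ x.2 ≠ y.2 ∧ (x.2.ends ∩ y.2.ends).Nonempty) ∨ (x.2 = y.2 ∧ x.1 ≠ y.1)

instance (x y : Node) : Decidable (NodeAdj x y) := inferInstanceAs (Decidable (_ ∨ _))

theorem NodeAdj.symm {x y : Node} (h : NodeAdj x y) : NodeAdj y x := by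
  rcases h with ⟨h1, h2, h3⟩ | ⟨h1, h2⟩
  · exact Or.inl ⟨h1.symm, h2.symm, by rwa [Set.inter_comm]⟩
  · exact Or.inr ⟨h1.symm, h2.symm⟩

theorem graph_adj {U : Set Vec} {x y : Node} :
    (graph U).Adj x y ↔ x ∈ nodes U ∧ y ∈ nodes U ∧ NodeAdj x y := Iff.rfl

/-- The translate of an edge. -/
def LEdge.shift (v : Vec) (a : LEdge) : LEdge := ⟨a.dir, v + a.base⟩

/-- The translate of a square. -/
def Square.shift (v : Vec) (Q : Square) : Square := ⟨Q.normal, v + Q.base⟩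

/-- The translate of a node. -/
def shiftNode (v : Vec) (x : Node) : Node := (x.1.shift v, x.2.shift v)

/-- The translate of a label. -/
def Label.shift (v : Vec) : Label → Label
  | .vertex w => .vertex (v + w)
  | .face Q => .face (Q.shift v)

theorem LEdge.shift_inj {v : Vec} {a b : LEdge} : a.shift v = b.shift v ↔ a = b := by
  simp [LEdge.ext_iff, LEdge.shift]

theorem Square.shift_inj {v : Vec} {a b : Square} : a.shift v = b.shift v ↔ a = b := by
  simp [Square.ext_iff, Square.shift]

theorem shiftNode_inj {v : Vec} {x y : Node} : shiftNode v x = shiftNode v y ↔ x = y := by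
  simp [shiftNode, Prod.ext_iff, LEdge.shift_inj, Square.shift_inj]

theorem Label.shift_inj {v : Vec} {l l' : Label} : l.shift v = l'.shift v ↔ l = l' := by
  cases l <;> cases l' <;> simp [Label.shift, Square.shift_inj]

theorem mem_ends_shift {v w : Vec} {a : LEdge} : v + w ∈ (a.shift v).ends ↔ w ∈ a.ends := by
  simp only [LEdge.ends, LEdge.shift, Set.mem_insert_iff, Set.mem_singleton_iff, add_assoc,
    add_right_inj]

theorem mem_corners_shift {v w : Vec} {Q : Square} : v + w ∈ (Q.shift v).corners ↔ w ∈ Q.corners := by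
  simp only [Square.corners, Square.shift, Set.mem_ofPred_eq, Pi.add_apply, add_assoc, add_right_inj]

theorem isSide_shift {v : Vec} {a : LEdge} {Q : Square} :
    (a.shift v).IsSide (Q.shift v) ↔ a.IsSide Q := by
  simp only [isSide_iff, LEdge.shift, Square.shift, add_assoc, add_right_inj]

theorem meet_shift {v : Vec} {a b : LEdge} :
    ((a.shift v).ends ∩ (b.shift v).ends).Nonempty ↔ (a.ends ∩ b.ends).Nonempty := by
  rw [meet_iff, meet_iff, ← mem_ends_shift (v := v) (w := a.base),
    ← mem_ends_shift (v := v) (w := a.base + e a.dir), ← add_assoc]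
  rfl

theorem nodeAdj_shift {v : Vec} {x y : Node} :
    NodeAdj (shiftNode v x) (shiftNode v y) ↔ NodeAdj x y := by
  simp only [NodeAdj, shiftNode, Square.shift_inj, LEdge.shift_inj, meet_shift, ne_eq]

/-- The squares around an edge. -/
theorem eq_of_isSide {i r d : Fin 3} (hid : i ≠ d) (hrd : r ≠ d) (hir : i ≠ r) {b : Vec} {Q : Square}
    (h : LEdge.IsSide ⟨d, b⟩ Q) : Q = ⟨i, b⟩ ∨ Q = ⟨r, b⟩ ∨ Q = ⟨i, b - e r⟩ ∨ Q = ⟨r, b - e i⟩ := by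
  obtain ⟨hn, h⟩ := (isSide_iff _ _).1 h
  obtain ⟨n, w⟩ := Q
  simp only at hn h
  have hn' : n = i ∨ n = r := by
    by_contra hcon
    push Not at hcon
    have : ∀ i r d n : Fin 3, i ≠ d → r ≠ d → i ≠ r → d ≠ n → n ≠ i → n ≠ r → False := by decide
    exact this i r d n hid hrd hir hn hcon.1 hcon.2
  have h1 : third d i = r := by
    have : ∀ i r d : Fin 3, i ≠ d → r ≠ d → i ≠ r → third d i = r := by decide
    exact this i r d hid hrd hir
  have h2 : third d r = i := by
    have : ∀ i r d : Fin 3, i ≠ d → r ≠ d → i ≠ r → third d r = i := by decide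
    exact this i r d hid hrd hir
  rcases hn' with rfl | rfl
  · rw [h1] at h
    rcases h with rfl | rfl
    · exact Or.inl rfl
    · exact Or.inr (Or.inr (Or.inl (by simp)))
  · rw [h2] at h
    rcases h with rfl | rfl
    · exact Or.inr (Or.inl rfl)
    · exact Or.inr (Or.inr (Or.inr (by simp)))

theorem ends_subset_corners {a : LEdge} {Q : Square} (h : a.IsSide Q) : a.ends ⊆ Q.corners := h

theorem finite_setOf_isSide (a : LEdge) : {Q | a.IsSide Q}.Finite := by
  refine (Set.finite_range fun p : Fin 3 × Option (Fin 3) =>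
    (⟨p.1, match p.2 with | none => a.base | some r => a.base - e r⟩ : Square)).subset ?_
  intro Q hQ
  obtain ⟨-, h⟩ := (isSide_iff _ _).1 hQ
  rcases h with h | h
  · exact ⟨(Q.normal, none), by rw [h]⟩
  · exact ⟨(Q.normal, some (third a.dir Q.normal)), by simp [h]⟩

theorem finite_setOf_mem_ends (w : Vec) : {a : LEdge | w ∈ a.ends}.Finite := by
  refine (Set.finite_range fun p : Fin 3 × Bool =>
    (⟨p.1, bif p.2 then w else w - e p.1⟩ : LEdge)).subset ?_
  rintro a (rfl | rfl)
  · exact ⟨(a.dir, true), rfl⟩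
  · exact ⟨(a.dir, false), by simp⟩

theorem finite_faceCond_vertex (w : Vec) :
    {E | E ∈ faceCond (.vertex w) ∧ ∀ x ∈ E, x.2.IsSide x.1}.Finite := by
  have h1 : {x : Node | w ∈ x.2.ends ∧ x.2.IsSide x.1}.Finite := by
    refine ((finite_setOf_mem_ends w).biUnion fun a _ =>
      (finite_setOf_isSide a).image fun Q => ((Q, a) : Node)).subset ?_
    rintro ⟨Q, a⟩ ⟨h1, h2⟩
    exact Set.mem_biUnion h1 ⟨Q, h2, rfl⟩
  refine ((h1.prod h1).image fun p => s(p.1, p.2)).subset ?_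
  rintro E ⟨h1, h2⟩
  induction E using Sym2.ind with
  | h x y =>
    exact ⟨(x, y), ⟨⟨h1 x (Sym2.mem_mk_left x y), h2 x (Sym2.mem_mk_left x y)⟩,
      ⟨h1 y (Sym2.mem_mk_right x y), h2 y (Sym2.mem_mk_right x y)⟩⟩, rfl⟩

instance : DecidableEq Label := fun l l' =>
  match l, l' with
  | .vertex v, .vertex w => decidable_of_iff (v = w) (by simp)
  | .face P, .face Q => decidable_of_iff (P = Q) (by simp)
  | .vertex _, .face _ => isFalse (by simp)
  | .face _, .vertex _ => isFalse (by simp)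

/-! ### The two patches at a removable cube -/

/-- The sides of the hexagon around the cube with lowest corner `0`: the `k`-th one goes from
`e (hexBase k)` in the direction `hexDir k`. -/
def hexBase : Fin 6 → Fin 3 := ![0, 0, 1, 1, 2, 2]

/-- The directions of the sides of the hexagon, see `hexBase`. -/
def hexDir : Fin 6 → Fin 3 := ![2, 1, 0, 2, 1, 0]

/-- The direction not involved in a side of the hexagon. -/
def hexRest : Fin 6 → Fin 3 := ![1, 2, 2, 0, 0, 1]

/-- The sides of the hexagon around the cube `0`. -/
def hexEdge (k : Fin 6) : LEdge := ⟨hexDir k, e (hexBase k)⟩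

/-- The square of the cube `0` in the patch on the `k`-th side of the hexagon. -/
def hexSquare (t : Bool) (k : Fin 6) : Square :=
  bif t then ⟨hexRest k, 0⟩ else ⟨hexBase k, e (hexBase k)⟩

/-- The next side in this square. -/
def spokeEdge (t : Bool) (k : Fin 6) : LEdge :=
  bif t then ⟨hexBase k, 0⟩ else ⟨hexRest k, e (hexBase k) + e (hexDir k)⟩

/-- The nodes inside a patch of the cube `0`. -/
def innerNode (t : Bool) (a : Fin 12) : Node :=
  let k : Fin 6 := ⟨a.1 % 6, Nat.mod_lt _ (by norm_num)⟩
  (hexSquare t k, if a.1 < 6 then hexEdge k else spokeEdge t k)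

/-- The labels of the faces of a patch of the cube `0`. -/
def innerLabel (t : Bool) : Fin 10 → Label :=
  Fin.append (m := 6) (n := 4)
    ![.vertex (e 0), .vertex (e 0 + e 1), .vertex (e 1), .vertex (e 1 + e 2), .vertex (e 2),
      .vertex (e 0 + e 2)]
    (bif t then ![.face ⟨2, 0⟩, .face ⟨0, 0⟩, .face ⟨1, 0⟩, .vertex 0]
      else ![.face ⟨0, e 0⟩, .face ⟨1, e 1⟩, .face ⟨2, e 2⟩, .vertex (e 0 + e 1 + e 2)])

open Classical in
/-- The square of the surface of `U` on the other side of the `k`-th side of the hexagon. -/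
def outerSquare (U : Set Vec) (v : Vec) (k : Fin 6) : Square :=
  if v + e (hexBase k) - e (hexRest k) ∈ U then ⟨hexRest k, v + e (hexBase k)⟩
  else ⟨hexBase k, v + e (hexBase k) - e (hexRest k)⟩

/-- The nodes of the patches of the cube `v`. -/
def patchNode (t : Bool) (U : Set Vec) (v : Vec) : Fin 18 → Node :=
  Fin.append (m := 12) (n := 6) (fun a => shiftNode v (innerNode t a))
    (fun k => (outerSquare U v k, (hexEdge k).shift v))

/-- The labels of the faces of the patches of the cube `v`. -/
def patchLabel (t : Bool) (v : Vec) (i : Fin 10) : Label := (innerLabel t i).shift v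

/-- The squares which belong to the surfaces before and after the removal of the cube `v`. -/
def commonSquares (U : Set Vec) (v : Vec) : Set Square := {Q | Q ∈ surface U ∧ Q.base ≠ v}

/-- The nodes which belong to the graphs before and after the removal of the cube `v`. -/
def commonNodes (U : Set Vec) (v : Vec) : Set Node :=
  {x | x.1 ∈ commonSquares U v ∧ x.2.IsSide x.1}

/-- The edges which belong to the graphs before and after the removal of the cube `v`. -/
def commonEdges (U : Set Vec) (v : Vec) : Set (Sym2 Node) :=
  {E | ∃ x ∈ commonNodes U v, ∃ y ∈ commonNodes U v, NodeAdj x y ∧ s(x, y) = E}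

/-- The solid before the removal of `v`, if `t = false`, and afterwards, if `t = true`. -/
def patchSolid (t : Bool) (U : Set Vec) (v : Vec) : Set Vec := bif t then U else insert v U

/-- The cube `v` has just been removed from `insert v U`. -/
structure IsCorner (U : Set Vec) (v : Vec) : Prop where
  lower : IsLowerSet U
  notMem : v ∉ U
  sub_mem : ∀ i, v - e i ∈ U

theorem e_nonneg (i : Fin 3) : 0 ≤ e i := by
  intro j
  rw [e_apply]
  split_ifs <;> simp

/-! ### Surfaces and graphs before and after the removal of a cube. -/

section Corner

variable {U : Set Vec} {v : Vec}

/-- Such a cube is below one of the predecessors `v - e i`. -/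
theorem IsCorner.mem_of_lt (h : IsCorner U v) {u : Vec} (hu : u ≤ v) (hne : u ≠ v) : u ∈ U := by
  have : ∃ i, u i < v i := by
    by_contra hcon
    push Not at hcon
    exact hne (le_antisymm hu hcon)
  obtain ⟨i, hi⟩ := this
  refine h.lower (fun j => ?_) (h.sub_mem i)
  rw [Pi.sub_apply, e_apply]
  split_ifs with hj
  · rw [hj]; exact Int.le_sub_one_of_lt hi
  · rw [sub_zero]; exact hu j

theorem IsCorner.notMem_of_le (h : IsCorner U v) {u : Vec} (hu : v ≤ u) : u ∉ U :=
  fun hcon => h.notMem (h.lower hu hcon)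

theorem surface_top (h : IsCorner U v) :
    surface (insert v U) = commonSquares U v ∪ {Q | Q.base = v + e Q.normal} := by
  ext Q
  simp only [surface, commonSquares, Set.mem_union, Set.mem_ofPred_eq, Set.mem_insert_iff, not_or]
  constructor
  · rintro ⟨h1 | h1, h2, h3⟩
    · right; rw [← h1]; simp
    · exact Or.inl ⟨⟨h1, h3⟩, h2⟩
  · rintro (⟨⟨h1, h2⟩, h3⟩ | h1)
    · exact ⟨Or.inr h1, h3, h2⟩
    · rw [h1]
      refine ⟨Or.inl (by simp), ?_, h.notMem_of_le ?_⟩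
      · intro hcon
        have := congrFun hcon Q.normal
        rw [Pi.add_apply, e_same] at this
        omega
      · exact le_add_of_nonneg_right (e_nonneg _)

theorem surface_bottom (h : IsCorner U v) :
    surface U = commonSquares U v ∪ {Q | Q.base = v} := by
  ext Q
  simp only [commonSquares, Set.mem_union, Set.mem_ofPred_eq]
  constructor
  · intro hQ
    by_cases h1 : Q.base = v
    · exact Or.inr h1
    · exact Or.inl ⟨hQ, h1⟩
  · rintro (h1 | h1)
    · exact h1.1
    · rw [surface, Set.mem_ofPred_eq, h1]
      exact ⟨h.sub_mem _, h.notMem⟩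

/-- The squares of a patch at the cube `0`. -/
def IsPatchSquare (t : Bool) (Q : Square) : Prop := Q.base = bif t then 0 else e Q.normal

instance (t : Bool) (Q : Square) : Decidable (IsPatchSquare t Q) :=
  inferInstanceAs (Decidable (_ = _))

theorem surface_patchSolid (h : IsCorner U v) (t : Bool) : surface (patchSolid t U v) =
    commonSquares U v ∪ {Q | ∃ P, IsPatchSquare t P ∧ P.shift v = Q} := by
  cases t
  · refine (surface_top h).trans ?_
    congr 1
    ext Q
    constructor
    · exact fun hQ => ⟨⟨Q.normal, e Q.normal⟩, rfl, Square.ext rfl (by exact Eq.symm hQ)⟩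
    · rintro ⟨P, hP, rfl⟩
      have hP : P.base = e P.normal := hP
      simp [Square.shift, hP]
  · refine (surface_bottom h).trans ?_
    congr 1
    ext Q
    constructor
    · exact fun hQ => ⟨⟨Q.normal, 0⟩, rfl, Square.ext rfl (by
        simp only [Square.shift, add_zero]; exact Eq.symm hQ)⟩
    · rintro ⟨P, hP, rfl⟩
      have hP : P.base = 0 := hP
      simp [Square.shift, hP]

theorem patchSquare_notMem (h : IsCorner U v) {t : Bool} {P : Square} (hP : IsPatchSquare t P) :
    P.shift v ∉ commonSquares U v := by
  rintro ⟨h1, h2⟩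
  cases t
  · have hP : P.base = e P.normal := hP
    have h3 := h1.1
    simp only [Square.shift, hP, add_sub_cancel_right] at h3
    exact h.notMem h3
  · have hP : P.base = 0 := hP
    apply h2
    simp [Square.shift, hP]

/-- A side of a patch square is given by the normal of the square, the direction of the side and a
choice between two parallel sides; the finitely many cases are checked. -/
theorem exists_innerNode {t : Bool} {P : Square} (hP : IsPatchSquare t P) {a : LEdge}
    (ha : a.IsSide P) : ∃ b : Fin 12, innerNode t b = (P, a) := by
  have key : ∀ (t : Bool) (n d : Fin 3) (c : Bool), d ≠ n → ∃ b : Fin 12, innerNode t b =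
      (⟨n, bif t then 0 else e n⟩,
        ⟨d, (bif t then 0 else e n) + bif c then e (third d n) else 0⟩) := by
    decide +kernel
  obtain ⟨n, w⟩ := P
  obtain ⟨d, b⟩ := a
  have hw : w = bif t then 0 else e n := hP
  obtain ⟨hd, hb⟩ := (isSide_iff _ _).1 ha
  simp only at hd hb
  rcases hb with rfl | rfl
  · obtain ⟨x, hx⟩ := key t n d false hd
    refine ⟨x, hx.trans ?_⟩
    rw [hw]
    simp
  · obtain ⟨x, hx⟩ := key t n d true hd
    refine ⟨x, hx.trans ?_⟩
    rw [hw]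
    rfl

theorem isPatchSquare_innerNode (t : Bool) (a : Fin 12) :
    IsPatchSquare t (innerNode t a).1 ∧ (innerNode t a).2.IsSide (innerNode t a).1 := by
  revert t a; decide +kernel

theorem patchNode_castAdd (t : Bool) (U : Set Vec) (v : Vec) (a : Fin 12) :
    patchNode t U v (Fin.castAdd 6 a) = shiftNode v (innerNode t a) := Fin.append_left _ _ _

theorem patchNode_natAdd (t : Bool) (U : Set Vec) (v : Vec) (k : Fin 6) :
    patchNode t U v (Fin.natAdd 12 k) = (outerSquare U v k, (hexEdge k).shift v) :=
  Fin.append_right _ _ _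

theorem exists_castAdd {a : Fin 18} (ha : a.1 < 12) : ∃ b : Fin 12, a = Fin.castAdd 6 b :=
  ⟨⟨a.1, ha⟩, Fin.ext rfl⟩

theorem exists_natAdd {a : Fin 18} (ha : 12 ≤ a.1) : ∃ k : Fin 6, a = Fin.natAdd 12 k :=
  ⟨⟨a.1 - 12, by omega⟩, Fin.ext (by simp; omega)⟩

theorem patchNode_notMem (h : IsCorner U v) (t : Bool) (a : Fin 12) :
    shiftNode v (innerNode t a) ∉ commonNodes U v :=
  fun hcon => patchSquare_notMem h (isPatchSquare_innerNode t a).1 hcon.1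

theorem hex_ne (k : Fin 6) : hexBase k ≠ hexDir k ∧ hexRest k ≠ hexDir k ∧ hexBase k ≠ hexRest k := by
  revert k; decide

theorem add_sub_ne (v : Vec) {i r : Fin 3} (h : i ≠ r) : v + e i - e r ≠ v := by
  intro hcon
  have := congrFun hcon i
  rw [Pi.sub_apply, Pi.add_apply, e_same, e_of_ne h] at this
  omega

theorem le_add_e (v : Vec) (i : Fin 3) : v ≤ v + e i := le_add_of_nonneg_right (e_nonneg _)

theorem outerSquare_mem (h : IsCorner U v) (k : Fin 6) : outerSquare U v k ∈ commonSquares U v := by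
  obtain ⟨h1, h2, h3⟩ := hex_ne k
  rw [outerSquare]
  split_ifs with hc
  · refine ⟨⟨hc, h.notMem_of_le (le_add_e _ _)⟩, fun hcon => ?_⟩
    have := congrFun hcon (hexBase k)
    simp only [Pi.add_apply, e_same] at this
    omega
  · refine ⟨⟨?_, hc⟩, add_sub_ne v h3⟩
    have : v + e (hexBase k) - e (hexRest k) - e (hexBase k) = v - e (hexRest k) := by abel
    simp only [this]
    exact h.sub_mem _

theorem isSide_outerSquare (U : Set Vec) (v : Vec) (k : Fin 6) :
    ((hexEdge k).shift v).IsSide (outerSquare U v k) := by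
  obtain ⟨h1, h2, h3⟩ := hex_ne k
  rw [outerSquare]
  split_ifs with hc
  · rw [isSide_iff]
    exact ⟨h2.symm, Or.inl rfl⟩
  · rw [isSide_iff]
    refine ⟨h1.symm, Or.inr ?_⟩
    have : ∀ k, third (hexDir k) (hexBase k) = hexRest k := by decide
    simp only [LEdge.shift, hexEdge, this, sub_add_cancel]

/-- Of the four lattice squares around a side of the hexagon, one belongs to the upper and one to
the lower patch. Of the other two, exactly one is in the surface, according to whether the cube `v +
e (hexBase k) - e (hexRest k)` lies in `U`. -/
theorem eq_outerSquare (h : IsCorner U v) {k : Fin 6} {Q : Square} (hQ : Q ∈ commonSquares U v)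
    (hs : ((hexEdge k).shift v).IsSide Q) : Q = outerSquare U v k := by
  obtain ⟨h1, h2, h3⟩ := hex_ne k
  rw [outerSquare]
  rcases eq_of_isSide h1 h2 h3 hs with rfl | rfl | rfl | rfl
  · have := hQ.1.1
    simp only [hexEdge, add_sub_cancel_right] at this
    exact absurd this h.notMem
  · rw [if_pos (show v + e (hexBase k) - e (hexRest k) ∈ U from hQ.1.1)]
    rfl
  · rw [if_neg (show v + e (hexBase k) - e (hexRest k) ∉ U from hQ.1.2)]
    rfl
  · exact absurd (show v + e (hexBase k) - e (hexBase k) = v by simp) hQ.2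

/-- Squares around an upper spoke would need a cube at or above `v` in `U`. Around a lower spoke,
two squares have base `v`, and for the other two the cube that should be absent is a predecessor of
`v`, hence in `U`. -/
theorem not_isSide_spokeEdge (h : IsCorner U v) {t : Bool} {k : Fin 6} {Q : Square}
    (hQ : Q ∈ commonSquares U v) : ¬ ((spokeEdge t k).shift v).IsSide Q := by
  obtain ⟨h1, h2, h3⟩ := hex_ne k
  intro hs
  cases t
  · rcases eq_of_isSide h2.symm h3 h1.symm hs with rfl | rfl | rfl | rfl
    · refine h.notMem_of_le ?_ hQ.1.1
      have : v + (e (hexBase k) + e (hexDir k)) - e (hexDir k) = v + e (hexBase k) := by abel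
      simp only [spokeEdge, cond_false, this]
      exact le_add_e _ _
    · refine h.notMem_of_le ?_ hQ.1.1
      have : v + (e (hexBase k) + e (hexDir k)) - e (hexBase k) = v + e (hexDir k) := by abel
      simp only [spokeEdge, cond_false, this]
      exact le_add_e _ _
    · refine h.notMem ?_
      have : v = v + (e (hexBase k) + e (hexDir k)) - e (hexBase k) - e (hexDir k) := by abel
      rw [this]
      exact hQ.1.1
    · refine h.notMem ?_
      have : v = v + (e (hexBase k) + e (hexDir k)) - e (hexDir k) - e (hexBase k) := by abel
      rw [this]
      exact hQ.1.1
  · rcases eq_of_isSide h1.symm h3.symm h2.symm hs with rfl | rfl | rfl | rfl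
    · exact hQ.2 (by simp [spokeEdge])
    · exact hQ.2 (by simp [spokeEdge])
    · refine hQ.1.2 ?_
      simp only [spokeEdge, cond_true, add_zero]
      exact h.sub_mem _
    · refine hQ.1.2 ?_
      simp only [spokeEdge, cond_true, add_zero]
      exact h.sub_mem _

theorem nodes_patchSolid (h : IsCorner U v) (t : Bool) : nodes (patchSolid t U v) =
    commonNodes U v ∪ {x | ∃ a : Fin 12, shiftNode v (innerNode t a) = x} := by
  ext ⟨Q, a⟩
  rw [nodes, surface_patchSolid h]
  constructor
  · rintro ⟨hQ | ⟨P, hP, rfl⟩, ha⟩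
    · exact Or.inl ⟨hQ, ha⟩
    · have h1 : (LEdge.shift v ⟨a.dir, a.base - v⟩) = a := by simp [LEdge.shift]
      simp only at ha
      rw [← h1, isSide_shift] at ha
      obtain ⟨b, hb⟩ := exists_innerNode hP ha
      refine Or.inr ⟨b, ?_⟩
      rw [hb]
      exact Prod.ext rfl h1
  · rintro (ha | ⟨b, hb⟩)
    · exact ⟨Or.inl ha.1, ha.2⟩
    · rw [← hb]
      obtain ⟨h1, h2⟩ := isPatchSquare_innerNode t b
      exact ⟨Or.inr ⟨_, h1, rfl⟩, isSide_shift.2 h2⟩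

theorem innerNode_injective (t : Bool) : Function.Injective (innerNode t) := by
  have : ∀ t a b, innerNode t a = innerNode t b → a = b := by decide +kernel
  exact this t

theorem hexEdge_injective : Function.Injective hexEdge := by
  have : ∀ a b, hexEdge a = hexEdge b → a = b := by decide
  exact this

theorem exists_edge_of_nodeAdj (t : Bool) (a b : Fin 12)
    (hab : NodeAdj (innerNode t a) (innerNode t b)) :
    ∃ e : Fin 21, Inc t e (Fin.castAdd 6 a) ∧ Inc t e (Fin.castAdd 6 b) := by
  revert t a b; decide +kernel

theorem nodeAdj_of_edge (t : Bool) (e : Fin 21) (a b : Fin 12) (hab : a ≠ b)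
    (ha : Inc t e (Fin.castAdd 6 a)) (hb : Inc t e (Fin.castAdd 6 b)) :
    NodeAdj (innerNode t a) (innerNode t b) := by
  revert t e a b; decide +kernel

theorem innerNode_snd (t : Bool) (a : Fin 12) :
    (∃ k : Fin 6, Fin.castAdd 6 a = hexNode k ∧ (innerNode t a).2 = hexEdge k) ∨
      ∃ k : Fin 6, (innerNode t a).2 = spokeEdge t k := by
  revert t a; decide +kernel

theorem exists_innerNode_hex (t : Bool) (k : Fin 6) :
    ∃ a : Fin 12, Fin.castAdd 6 a = hexNode k ∧ (innerNode t a).2 = hexEdge k := by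
  revert t k; decide +kernel

theorem patching (h : IsCorner U v) (t : Bool) :
    Patching t (patchSolid t U v) (commonNodes U v) (commonEdges U v) (patchNode t U v) where
  inj := by
    intro a b hab
    by_cases ha : a.1 < 12 <;> by_cases hb : b.1 < 12
    · obtain ⟨a, rfl⟩ := exists_castAdd ha
      obtain ⟨b, rfl⟩ := exists_castAdd hb
      rw [patchNode_castAdd, patchNode_castAdd, shiftNode_inj] at hab
      rw [innerNode_injective t hab]
    · obtain ⟨a, rfl⟩ := exists_castAdd ha
      obtain ⟨k, rfl⟩ := exists_natAdd (by omega : 12 ≤ b.1)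
      rw [patchNode_castAdd, patchNode_natAdd] at hab
      exact absurd (hab ▸ ⟨outerSquare_mem h k, isSide_outerSquare U v k⟩) (patchNode_notMem h t a)
    · obtain ⟨b, rfl⟩ := exists_castAdd hb
      obtain ⟨k, rfl⟩ := exists_natAdd (by omega : 12 ≤ a.1)
      rw [patchNode_castAdd, patchNode_natAdd] at hab
      exact absurd (hab ▸ ⟨outerSquare_mem h k, isSide_outerSquare U v k⟩) (patchNode_notMem h t b)
    · obtain ⟨k, rfl⟩ := exists_natAdd (by omega : 12 ≤ a.1)
      obtain ⟨l, rfl⟩ := exists_natAdd (by omega : 12 ≤ b.1)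
      rw [patchNode_natAdd, patchNode_natAdd, Prod.mk.injEq, LEdge.shift_inj] at hab
      rw [hexEdge_injective hab.2]
  inner := by
    intro a ha
    obtain ⟨a, rfl⟩ := exists_castAdd ha
    rw [patchNode_castAdd]
    exact patchNode_notMem h t a
  outer := by
    intro a ha
    obtain ⟨k, rfl⟩ := exists_natAdd ha
    rw [patchNode_natAdd]
    exact ⟨outerSquare_mem h k, isSide_outerSquare U v k⟩
  nodes_eq := by
    rw [nodes_patchSolid h]
    congr 1
    ext x
    constructor
    · rintro ⟨a, rfl⟩
      exact ⟨Fin.castAdd 6 a, a.2, patchNode_castAdd t U v a⟩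
    · rintro ⟨a, ha, rfl⟩
      obtain ⟨a, rfl⟩ := exists_castAdd ha
      exact ⟨a, (patchNode_castAdd t U v a).symm⟩
  mem_outer := by
    rintro _ ⟨x, hx, y, hy, -, rfl⟩ z hz
    rcases Sym2.mem_iff.1 hz with rfl | rfl
    exacts [hx, hy]
  edges_eq := by
    have hpe : ∀ {e : Fin 21} {a b : Fin 18}, Inc t e a → Inc t e b → a ≠ b →
        patchEdge t (patchNode t U v) e = s(patchNode t U v a, patchNode t U v b) := by
      rintro e a b (rfl | rfl) (rfl | rfl) hab
      · exact absurd rfl hab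
      · rfl
      · exact Sym2.eq_swap
      · exact absurd rfl hab
    -- An edge at an inner node is a patch edge. To another inner node this is a finite check; to an
    -- outer node it must cross a side of the hexagon, since spokes bound no common square, and then
    -- `eq_outerSquare` identifies its end.
    have aux : ∀ (a : Fin 12) (y : Node), y ∈ nodes (patchSolid t U v) →
        NodeAdj (shiftNode v (innerNode t a)) y →
        ∃ e, patchEdge t (patchNode t U v) e = s(shiftNode v (innerNode t a), y) := by
      intro a y hy hay
      rw [nodes_patchSolid h] at hy
      rcases hy with hy | ⟨b, rfl⟩
      · rcases hay with ⟨h1, -, -⟩ | ⟨h1, -⟩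
        · refine absurd ?_ (patchSquare_notMem h (isPatchSquare_innerNode t a).1)
          rw [show (innerNode t a).1.shift v = y.1 from h1]
          exact hy.1
        · rcases innerNode_snd t a with ⟨k, hk, hk'⟩ | ⟨k, hk⟩
          · refine ⟨leg k, ?_⟩
            have h2 : y = (outerSquare U v k, (hexEdge k).shift v) := by
              refine Prod.ext ?_ ?_
              · refine eq_outerSquare h hy.1 ?_
                have := hy.2
                rw [← h1] at this
                simpa only [shiftNode, hk'] using this
              · rw [← h1, ← hk']; rfl
            rw [hpe ((inc_leg t k _).2 (Or.inl rfl)) ((inc_leg t k _).2 (Or.inr rfl)) (hexNode_ne k),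
              ← hk, patchNode_castAdd, patchNode_natAdd, h2]
          · exfalso
            apply not_isSide_spokeEdge h (t := t) (k := k) hy.1
            have := hy.2
            rw [← h1] at this
            simpa only [shiftNode, hk] using this
      · have hab : a ≠ b := by
          rintro rfl
          rcases hay with ⟨-, h1, -⟩ | ⟨-, h1⟩ <;> exact h1 rfl
        obtain ⟨e, h1, h2⟩ := exists_edge_of_nodeAdj t a b (nodeAdj_shift.1 hay)
        refine ⟨e, ?_⟩
        rw [hpe h1 h2 ((Fin.castAdd_injective 12 6).ne hab), patchNode_castAdd, patchNode_castAdd]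
    ext E
    induction E using Sym2.ind with
    | h x y =>
      rw [SimpleGraph.mem_edgeSet, graph_adj]
      constructor
      · rintro ⟨hx, hy, hxy⟩
        have hx' := hx
        have hy' := hy
        rw [nodes_patchSolid h] at hx' hy'
        rcases hx' with hx' | ⟨a, rfl⟩
        · rcases hy' with hy' | ⟨b, rfl⟩
          · exact Or.inl ⟨x, hx', y, hy', hxy, rfl⟩
          · rw [Sym2.eq_swap]
            exact Or.inr (aux b x hx hxy.symm)
        · exact Or.inr (aux a y hy hxy)
      · intro hE
        have key : ∀ {x' y' : Node}, s(x', y') = s(x, y) → x' ∈ nodes (patchSolid t U v) →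
            y' ∈ nodes (patchSolid t U v) → NodeAdj x' y' →
            x ∈ nodes (patchSolid t U v) ∧ y ∈ nodes (patchSolid t U v) ∧ NodeAdj x y := by
          intro x' y' heq h1 h2 h3
          rcases Sym2.eq_iff.1 heq with ⟨rfl, rfl⟩ | ⟨rfl, rfl⟩
          exacts [⟨h1, h2, h3⟩, ⟨h2, h1, h3.symm⟩]
        rw [nodes_patchSolid h] at key ⊢
        rcases hE with ⟨x', hx', y', hy', hxy', heq⟩ | ⟨e, he⟩
        · exact key heq (Or.inl hx') (Or.inl hy') hxy'
        · by_cases he15 : e.1 < 15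
          · obtain ⟨a, ha⟩ := exists_castAdd (src_lt t e)
            obtain ⟨b, hb⟩ := exists_castAdd (inc_lt he15 (Or.inr rfl : Inc t e (tgt t e)))
            rw [patchEdge, ha, hb, patchNode_castAdd, patchNode_castAdd] at he
            refine key he (Or.inr ⟨a, rfl⟩) (Or.inr ⟨b, rfl⟩) (nodeAdj_shift.2 ?_)
            refine nodeAdj_of_edge t e a b ?_ (Or.inl ha) (Or.inr hb)
            rintro rfl
            have : ∀ (t : Bool) (e : Fin 21), src t e ≠ tgt t e := by decide
            exact this t e (ha.trans hb.symm)
          · obtain ⟨k, rfl⟩ := eq_leg_of_le (by omega : 15 ≤ e.1)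
            rw [hpe ((inc_leg t k _).2 (Or.inl rfl)) ((inc_leg t k _).2 (Or.inr rfl)) (hexNode_ne k),
              patchNode_natAdd] at he
            obtain ⟨a, ha, ha'⟩ : ∃ a : Fin 12, Fin.castAdd 6 a = hexNode k ∧
                (innerNode t a).2 = hexEdge k := exists_innerNode_hex t k
            rw [← ha, patchNode_castAdd] at he
            have hO : (outerSquare U v k, (hexEdge k).shift v) ∈ commonNodes U v :=
              ⟨outerSquare_mem h k, isSide_outerSquare U v k⟩
            refine key he (Or.inr ⟨a, rfl⟩) (Or.inl hO) (Or.inr ⟨?_, ?_⟩)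
            · rw [← ha']; rfl
            · intro hcon
              apply patchNode_notMem h t a
              refine ⟨?_, isSide_shift.2 (isPatchSquare_innerNode t a).2⟩
              rw [hcon]
              exact hO.1

end Corner

/-! ### The labels of the two patches at a removable cube -/

instance (Q : Square) (w : Vec) : Decidable (w ∈ Q.corners) :=
  inferInstanceAs (Decidable (w Q.normal = Q.base Q.normal ∧
    ∀ i, i ≠ Q.normal → w i = Q.base i ∨ w i = Q.base i + 1))

theorem exists_of_mem_corners {Q : Square} {w : Vec} (h : w ∈ Q.corners) : ∃ c c' : Bool,
    w = Q.base + ((bif c then e (Q.normal + 1) else 0) + bif c' then e (Q.normal + 2) else 0) := by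
  have h1 : ∀ n : Fin 3, n + 1 ≠ n ∧ n + 2 ≠ n ∧ n + 1 ≠ n + 2 ∧ n + 2 ≠ n + 1 ∧
    n ≠ n + 1 ∧ n ≠ n + 2 ∧ third n (n + 1) = n + 2 := by decide
  obtain ⟨a1, a2, a3, a4, a5, a6, a7⟩ := h1 Q.normal
  have key : ∀ i, i ≠ Q.normal → ∃ c : Bool, w i = Q.base i + bif c then 1 else 0 := by
    intro i hi
    rcases h.2 i hi with h' | h'
    exacts [⟨false, by simpa using h'⟩, ⟨true, h'⟩]
  obtain ⟨c, hc⟩ := key _ a1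
  obtain ⟨c', hc'⟩ := key _ a2
  refine ⟨c, c', vec_ext a5 ?_ ?_ ?_⟩
  · rw [h.1]
    cases c <;> cases c' <;> simp [e_of_ne, *]
  · rw [hc]
    cases c <;> cases c' <;> simp [e_of_ne, e_same, *]
  · rw [a7, hc']
    cases c <;> cases c' <;> simp [e_of_ne, e_same, *]

/-- The edges of the nodes of a patch. -/
def nodeEdge (t : Bool) : Fin 18 → LEdge :=
  Fin.append (m := 12) (n := 6) (fun a => (innerNode t a).2) hexEdge

/-- The squares of the inner nodes of a patch. -/
def nodeSquare (t : Bool) : Fin 18 → Option Square :=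
  Fin.append (m := 12) (n := 6) (fun a => some (innerNode t a).1) fun _ => none

/-- An edge of the patch is on the boundary of a face. -/
def FaceInc (t : Bool) (i : Fin 10) (e : Fin 21) : Prop :=
  match innerLabel t i with
  | .vertex w => w ∈ (nodeEdge t (src t e)).ends ∧ w ∈ (nodeEdge t (tgt t e)).ends
  | .face P => nodeSquare t (src t e) = some P ∧ nodeSquare t (tgt t e) = some P

instance (t : Bool) (i : Fin 10) (e : Fin 21) : Decidable (FaceInc t i e) := by
  rw [FaceInc]
  cases innerLabel t i <;> exact inferInstanceAs (Decidable (_ ∧ _))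

theorem faceInc_iff (t : Bool) (i : Fin 10) (e : Fin 21) :
    FaceInc t i e ↔ e ∈ patchFace t i ∪ legFace i := by
  revert t i e; decide +kernel

/-- The vertex of the cube `0` in the interior of a patch. -/
def innerVertex (t : Bool) : Vec := bif t then 0 else e 0 + e 1 + e 2

/-- The faces of a patch. -/
def InnerLabelSpec (t : Bool) (i : Fin 10) : Label → Prop
  | .vertex w => ((i.1 < 6 ∧ innerLabel (!t) i = .vertex w) ∨ (i = 9 ∧ w = innerVertex t)) ∧
      ∃ n : Fin 3, w ∈ (⟨n, bif t then 0 else e n⟩ : Square).corners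
  | .face P => 6 ≤ i.1 ∧ IsPatchSquare t P

instance (t : Bool) (i : Fin 10) (l : Label) : Decidable (InnerLabelSpec t i l) := by
  cases l
  · exact inferInstanceAs (Decidable ((_ ∨ _) ∧ _))
  · exact inferInstanceAs (Decidable (_ ∧ _))

theorem innerLabelSpec (t : Bool) (i : Fin 10) : InnerLabelSpec t i (innerLabel t i) := by
  revert t i; decide +kernel

theorem exists_innerLabel_vertex (t : Bool) (n : Fin 3) (c c' : Bool) : ∃ i, innerLabel t i =
    .vertex ((bif t then 0 else e n) +
      ((bif c then e (n + 1) else 0) + bif c' then e (n + 2) else 0)) := by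
  revert t n c c'; decide +kernel

theorem exists_innerLabel_face (t : Bool) (n : Fin 3) :
    ∃ i, innerLabel t i = .face ⟨n, bif t then 0 else e n⟩ := by
  revert t n; decide +kernel

theorem innerLabel_injective (t : Bool) : Function.Injective (innerLabel t) := by
  have : ∀ t a b, innerLabel t a = innerLabel t b → a = b := by decide +kernel
  exact this t

section Corner

variable {U : Set Vec} {v : Vec}

theorem nodeEdge_spec (t : Bool) (U : Set Vec) (v : Vec) (a : Fin 18) :
    (patchNode t U v a).2 = (nodeEdge t a).shift v := by
  by_cases ha : a.1 < 12
  · obtain ⟨a, rfl⟩ := exists_castAdd ha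
    rw [patchNode_castAdd, nodeEdge, Fin.append_left]
    rfl
  · obtain ⟨k, rfl⟩ := exists_natAdd (by omega : 12 ≤ a.1)
    rw [patchNode_natAdd, nodeEdge, Fin.append_right]

theorem nodeSquare_spec (h : IsCorner U v) {t : Bool} {P : Square} (hP : IsPatchSquare t P)
    (a : Fin 18) : (patchNode t U v a).1 = P.shift v ↔ nodeSquare t a = some P := by
  by_cases ha : a.1 < 12
  · obtain ⟨a, rfl⟩ := exists_castAdd ha
    rw [patchNode_castAdd, nodeSquare, Fin.append_left, Option.some_inj]
    exact Square.shift_inj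
  · obtain ⟨k, rfl⟩ := exists_natAdd (by omega : 12 ≤ a.1)
    rw [patchNode_natAdd, nodeSquare, Fin.append_right]
    refine iff_of_false (fun hcon => ?_) (by simp)
    simp only at hcon
    exact patchSquare_notMem h hP (hcon ▸ outerSquare_mem h k)

/-- The vertices and squares of the part of the surface away from the cube `v`. -/
def squareLabels (C : Set Square) : Set Label :=
  {l | match l with
    | .vertex w => ∃ Q ∈ C, w ∈ Q.corners
    | .face Q => Q ∈ C}

theorem labels_eq_squareLabels (U : Set Vec) : labels U = squareLabels (surface U) := rfl

/-- The labels outside of the patches. -/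
def commonLabels (U : Set Vec) (v : Vec) : Set Label :=
  {l | l ∈ squareLabels (commonSquares U v) ∧ ∀ t i, patchLabel t v i ≠ l}

theorem base_le_of_mem_corners {Q : Square} {w : Vec} (h : w ∈ Q.corners) : Q.base ≤ w := by
  intro i
  by_cases hi : i = Q.normal
  · rw [hi, h.1]
  · rcases h.2 i hi with h' | h'
    · exact h'.ge
    · exact h'.symm ▸ Int.le_add_one le_rfl

/-- A surface square at the top vertex of the cube would have below it a cube of `U` that is at
least `v`. A square at the lowest vertex with base different from `v` has its base strictly below
`v`, hence in `U`, which no surface square allows. -/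
theorem innerVertex_notMem (h : IsCorner U v) (t : Bool) {Q : Square} (hQ : Q ∈ commonSquares U v) :
    v + innerVertex t ∉ Q.corners := by
  intro hw
  cases t
  · refine h.notMem_of_le (fun i => ?_) hQ.1.1
    have key : ∀ i : Fin 3, innerVertex false i = 1 := by decide +kernel
    have h1 : ∀ i, (v + innerVertex false) i = v i + 1 := fun i => by rw [Pi.add_apply, key]
    rw [Pi.sub_apply, e_apply]
    by_cases hi : i = Q.normal
    · have := hw.1
      rw [h1] at this
      rw [if_pos hi, hi, ← this]
      simp
    · rw [if_neg hi, sub_zero]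
      rcases hw.2 i hi with h' | h' <;> rw [h1] at h'
      · exact (Int.le_add_one le_rfl).trans h'.le
      · exact Int.le_of_add_le_add_right h'.le
  · rw [innerVertex, cond_true, add_zero] at hw
    exact hQ.1.2 (h.mem_of_lt (base_le_of_mem_corners hw) hQ.2)

theorem labels_patchSolid (h : IsCorner U v) (t : Bool) :
    labels (patchSolid t U v) = commonLabels U v ∪ Set.range (patchLabel t v) := by
  rw [labels_eq_squareLabels, surface_patchSolid h]
  ext l
  constructor
  · intro hl
    cases l with
    | vertex w =>
      obtain ⟨Q, hQ | ⟨P, hP, rfl⟩, hw⟩ := hl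
      -- A vertex on the common part of the surface which is a label of either patch is not a
      -- central vertex, so it is a corner of the hexagon and a label of both patches.
      · by_cases hc : ∀ t i, patchLabel t v i ≠ .vertex w
        · exact Or.inl ⟨⟨Q, hQ, hw⟩, hc⟩
        · push Not at hc
          obtain ⟨t', i, hi⟩ := hc
          have hs := innerLabelSpec t' i
          cases hl : innerLabel t' i with
          | face P =>
            rw [patchLabel, hl] at hi
            exact absurd hi (by simp [Label.shift])
          | vertex w' =>
            rw [hl] at hs
            rw [patchLabel, hl] at hi
            have hw' : v + w' = w := by simpa [Label.shift] using hi
            rcases hs.1 with ⟨-, h2⟩ | ⟨-, h2⟩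
            · right
              by_cases htt : t = t'
              · exact ⟨i, by rw [patchLabel, htt, hl, hi]⟩
              · have : t = !t' := Bool.eq_not_of_ne htt
                exact ⟨i, by rw [patchLabel, this, h2, hi]⟩
            · rw [← hw', h2] at hw
              exact absurd hw (innerVertex_notMem h t' hQ)
      · right
        obtain ⟨w, rfl⟩ : ∃ w', w = v + w' := ⟨w - v, by simp⟩
        rw [mem_corners_shift] at hw
        obtain ⟨c, c', hcc⟩ := exists_of_mem_corners hw
        obtain ⟨i, hi⟩ := exists_innerLabel_vertex t P.normal c c'
        refine ⟨i, ?_⟩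
        rw [patchLabel, hi, Label.shift, hcc, show P.base = _ from hP]
    | face Q =>
      rcases hl with hQ | ⟨P, hP, rfl⟩
      · refine Or.inl ⟨hQ, fun t' i hi => ?_⟩
        have hs := innerLabelSpec t' i
        cases hl : innerLabel t' i with
        | vertex w =>
          rw [patchLabel, hl] at hi
          exact absurd hi (by simp [Label.shift])
        | face P =>
          rw [hl] at hs
          rw [patchLabel, hl] at hi
          have : P.shift v = Q := by simpa [Label.shift] using hi
          exact patchSquare_notMem h hs.2 (this ▸ hQ)
      · right
        obtain ⟨i, hi⟩ := exists_innerLabel_face t P.normal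
        refine ⟨i, ?_⟩
        rw [patchLabel, hi, Label.shift, ← show P.base = _ from hP]
  · rintro (⟨hl, -⟩ | ⟨i, rfl⟩)
    · cases l with
      | vertex w => obtain ⟨Q, hQ, hw⟩ := hl; exact ⟨Q, Or.inl hQ, hw⟩
      | face Q => exact Or.inl hl
    · have hs := innerLabelSpec t i
      rw [patchLabel]
      cases hl : innerLabel t i with
      | vertex w =>
        rw [hl] at hs
        obtain ⟨-, n, hn⟩ := hs
        exact ⟨Square.shift v ⟨n, bif t then 0 else e n⟩, Or.inr ⟨⟨n, bif t then 0 else e n⟩, rfl, rfl⟩,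
          mem_corners_shift.2 hn⟩
      | face P =>
        rw [hl] at hs
        exact Or.inr ⟨P, hs.2, rfl⟩

theorem facePatching (h : IsCorner U v) (t : Bool) :
    FacePatching t (patchSolid t U v) (commonNodes U v) (commonEdges U v) (patchNode t U v)
      (commonLabels U v) (patchLabel t v) where
  toPatching := patching h t
  lam_inj := fun i j hij => innerLabel_injective t (Label.shift_inj.1 hij)
  labels_eq := labels_patchSolid h t
  lam_notMem := fun i hi => hi.2 t i rfl
  face_iff := by
    intro i e
    rw [← faceInc_iff, FaceInc, patchLabel]
    have hs := innerLabelSpec t i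
    cases hl : innerLabel t i with
    | vertex w =>
      simp only [Label.shift, faceCond, Set.mem_ofPred_eq, patchEdge, Sym2.mem_iff,
        forall_eq_or_imp, forall_eq, nodeEdge_spec, mem_ends_shift]
    | face P =>
      rw [hl] at hs
      simp only [Label.shift, faceCond, Set.mem_ofPred_eq, patchEdge, Sym2.mem_iff,
        forall_eq_or_imp, forall_eq, nodeSquare_spec h hs.2]
  face_inner := by
    rintro i hi _ ⟨x, hx, y, -, -, rfl⟩ hE
    have hs := innerLabelSpec t i
    rw [patchLabel] at hE
    cases hl : innerLabel t i with
    | vertex w =>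
      rw [hl] at hs hE
      rcases hs.1 with h1 | ⟨-, rfl⟩
      · omega
      · exact innerVertex_notMem h t hx.1
          (ends_subset_corners hx.2 (hE x (Sym2.mem_mk_left x y)))
    | face P =>
      rw [hl] at hs hE
      have h1 : x.1 = P.shift v := hE x (Sym2.mem_mk_left x y)
      exact patchSquare_notMem h hs.2 (h1 ▸ hx.1)
  face_outer := by
    intro l hl e he
    obtain ⟨a, ha⟩ := exists_castAdd (src_lt t e)
    have hsrc : patchNode t U v (src t e) = shiftNode v (innerNode t a) := by
      rw [ha, patchNode_castAdd]
    have hmem : patchNode t U v (src t e) ∈ patchEdge t (patchNode t U v) e := Sym2.mem_mk_left _ _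
    rw [hsrc] at hmem
    obtain ⟨h1, h2⟩ := isPatchSquare_innerNode t a
    cases l with
    | vertex w =>
      have h3 : w ∈ ((innerNode t a).2.shift v).ends := he _ hmem
      obtain ⟨w, rfl⟩ : ∃ w', w = v + w' := ⟨w - v, by simp⟩
      rw [mem_ends_shift] at h3
      obtain ⟨c, c', hcc⟩ := exists_of_mem_corners (ends_subset_corners h2 h3)
      obtain ⟨i, hi⟩ := exists_innerLabel_vertex t (innerNode t a).1.normal c c'
      refine hl.2 t i ?_
      rw [patchLabel, hi, Label.shift, hcc, show (innerNode t a).1.base = _ from h1]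
    | face Q =>
      have h3 : (innerNode t a).1.shift v = Q := he _ hmem
      obtain ⟨i, hi⟩ := exists_innerLabel_face t (innerNode t a).1.normal
      refine hl.2 t i ?_
      rw [patchLabel, hi, Label.shift, ← show (innerNode t a).1.base = _ from h1, ← h3]
  face_finite := by
    intro i
    rw [patchLabel]
    cases hl : innerLabel t i with
    | vertex w =>
      refine (finite_faceCond_vertex (v + w)).subset ?_
      rintro _ ⟨⟨x, hx, y, hy, -, rfl⟩, hE⟩
      refine ⟨hE, fun z hz => ?_⟩
      rcases Sym2.mem_iff.1 hz with rfl | rfl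
      exacts [hx.2, hy.2]
    | face P =>
      have hs := innerLabelSpec t i
      rw [hl] at hs
      convert Set.finite_empty
      rw [Set.eq_empty_iff_forall_notMem]
      rintro _ ⟨⟨x, hx, y, -, -, rfl⟩, hE⟩
      have h1 : x.1 = P.shift v := hE x (Sym2.mem_mk_left x y)
      exact patchSquare_notMem h hs.2 (h1 ▸ hx.1)

theorem facePatchPair (h : IsCorner U v) :
    FacePatchPair false true (insert v U) U (commonNodes U v) (commonEdges U v)
      (patchNode false U v) (patchNode true U v) (commonLabels U v) (patchLabel false v)
      (patchLabel true v) where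
  left := facePatching h false
  right := facePatching h true
  ext_eq := fun k => by rw [patchNode_natAdd, patchNode_natAdd]
  lam_eq := by
    intro i hi
    have key : ∀ i : Fin 10, i.1 < 6 → innerLabel false i = innerLabel true i := by decide +kernel
    rw [patchLabel, patchLabel, key i hi]

/-- The dictionary between the cyclic numbering of the patch and the cube: the corners of the
hexagon carry `h1, h12, h2, h23, h3, h13`, the upper squares `hx1, hy2, hz3`, and the lower squares
`hz, hx, hy`, in the order in which they meet the sides. -/
theorem patchRecurrence_iff {F : Type*} [Field F] {A : Label → F} :
    PatchRecurrence (fun i => A (patchLabel false v i)) (fun i => A (patchLabel true v i)) ↔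
      HexahedronAt A v := by
  have e0 : ∀ t, patchLabel t v 0 = .vertex (v + e 0) := by intro t; rfl
  have e1 : ∀ t, patchLabel t v 1 = .vertex (v + e 0 + e 1) := by
    intro t; rw [add_assoc]; rfl
  have e2 : ∀ t, patchLabel t v 2 = .vertex (v + e 1) := by intro t; rfl
  have e3 : ∀ t, patchLabel t v 3 = .vertex (v + e 1 + e 2) := by
    intro t; rw [add_assoc]; rfl
  have e4 : ∀ t, patchLabel t v 4 = .vertex (v + e 2) := by intro t; rfl
  have e5 : ∀ t, patchLabel t v 5 = .vertex (v + e 0 + e 2) := by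
    intro t; rw [add_assoc]; rfl
  have f6 : patchLabel false v 6 = .face ⟨0, v + e 0⟩ := rfl
  have f7 : patchLabel false v 7 = .face ⟨1, v + e 1⟩ := rfl
  have f8 : patchLabel false v 8 = .face ⟨2, v + e 2⟩ := rfl
  have f9 : patchLabel false v 9 = .vertex (v + e 0 + e 1 + e 2) := by
    rw [add_assoc, add_assoc, ← add_assoc (e 0)]; rfl
  have g6 : patchLabel true v 6 = .face ⟨2, v⟩ := by
    conv_rhs => rw [← add_zero v]
    rfl
  have g7 : patchLabel true v 7 = .face ⟨0, v⟩ := by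
    conv_rhs => rw [← add_zero v]
    rfl
  have g8 : patchLabel true v 8 = .face ⟨1, v⟩ := by
    conv_rhs => rw [← add_zero v]
    rfl
  have g9 : patchLabel true v 9 = .vertex v := by
    conv_rhs => rw [← add_zero v]
    rfl
  have key : ∀ i : Fin 10, i.1 < 6 → innerLabel false i = innerLabel true i := by decide +kernel
  rw [PatchRecurrence, and_iff_right fun k hk => by simp only [patchLabel, key k hk]]
  simp only [e0, e1, e2, e3, e4, e5, f6, f7, f8, f9, g6, g7, g8, g9]
  constructor
  · rintro ⟨h1, h2, h3, h4⟩
    refine ⟨?_, ?_, ?_, ?_⟩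
    · linear_combination h1
    · linear_combination h2
    · linear_combination h3
    · linear_combination h4
  · rintro ⟨h1, h2, h3, h4⟩
    refine ⟨?_, ?_, ?_, ?_⟩
    · linear_combination h1
    · linear_combination h2
    · linear_combination h3
    · linear_combination h4

end Corner

/-! ### Coordinates on the cubic corner graph -/

/-- Coordinates for the nodes of `Γ(U₀)`: the square is orthogonal to `e n`, the side has
direction `e d` and has the coordinate `x` there; in the third direction the square begins at `y`
and the side is at `y` or, if `h` is true, at `y + 1`. -/
@[ext] structure Coord where
  n : Fin 3
  d : Fin 3
  x : ℤ
  y : ℤ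
  h : Bool

/-- The bit `h` as an integer. -/
def bit (h : Bool) : ℤ := bif h then 1 else 0

@[simp] theorem bit_true : bit true = 1 := rfl

@[simp] theorem bit_false : bit false = 0 := rfl

/-- The vector with coordinates `x` and `y` in the directions `i` and `j`. -/
def vec2 (i j : Fin 3) (x y : ℤ) : Vec := fun k => if k = i then x else if k = j then y else 0

theorem vec2_left (i j : Fin 3) (x y : ℤ) : vec2 i j x y i = x := by simp [vec2]

theorem vec2_right {i j : Fin 3} (h : j ≠ i) (x y : ℤ) : vec2 i j x y j = y := by simp [vec2, h]

theorem vec2_other {i j k : Fin 3} (h : k ≠ i) (h' : k ≠ j) (x y : ℤ) : vec2 i j x y k = 0 := by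
  simp [vec2, h, h']

theorem vec2_swap {i j : Fin 3} (h : i ≠ j) (x y : ℤ) : vec2 i j x y = vec2 j i y x := by
  funext k
  by_cases h1 : k = i
  · subst h1; simp [vec2, h]
  · by_cases h2 : k = j
    · subst h2; simp [vec2, h1]
    · simp [vec2, h1, h2]

theorem vec2_inj {i j : Fin 3} (h : j ≠ i) {x y x' y' : ℤ} :
    vec2 i j x y = vec2 i j x' y' ↔ x = x' ∧ y = y' := by
  constructor
  · intro heq
    have h1 := congrFun heq i
    have h2 := congrFun heq j
    rw [vec2_left, vec2_left] at h1
    rw [vec2_right h, vec2_right h] at h2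
    exact ⟨h1, h2⟩
  · rintro ⟨rfl, rfl⟩; rfl

theorem vec2_add_left {i j : Fin 3} (h : j ≠ i) (x y : ℤ) :
    vec2 i j x y + e i = vec2 i j (x + 1) y := by
  funext k
  rw [Pi.add_apply, e_apply]
  by_cases h1 : k = i
  · subst h1; simp [vec2]
  · by_cases h2 : k = j
    · subst h2; simp [vec2, h1]
    · simp [vec2, h1, h2]

theorem vec2_add_right {i j : Fin 3} (h : j ≠ i) (x y : ℤ) :
    vec2 i j x y + e j = vec2 i j x (y + 1) := by
  rw [vec2_swap h.symm, vec2_add_left h.symm, vec2_swap h]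

namespace Coord

/-- The direction which is neither that of the side nor orthogonal to the square. -/
def p (c : Coord) : Fin 3 := third c.n c.d

/-- The square of a node. -/
def square (c : Coord) : Square := ⟨c.n, vec2 c.d c.p c.x c.y⟩

/-- The side of a node. -/
def side (c : Coord) : LEdge := ⟨c.d, vec2 c.d c.p c.x (c.y + bit c.h)⟩

/-- The node with given coordinates. -/
def node (c : Coord) : Node := (c.square, c.side)

/-- The coordinates belong to a node of `Γ(U₀)`. -/
structure Valid (c : Coord) : Prop where
  ne : c.n ≠ c.d
  x_neg : c.x < 0
  y_neg : c.y < 0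

/-- The neighbour in the same square across a corner different from the nearest and farthest. -/
def quad (c : Coord) : Coord := ⟨c.n, c.p, c.y, c.x, !c.h⟩

/-- The neighbour in the same square across the nearest or the farthest corner. -/
def flat (c : Coord) : Coord := ⟨c.n, c.p, c.y, c.x, c.h⟩

/-- The neighbour on the same lattice edge. -/
def leg (c : Coord) : Coord :=
  bif c.h then (if c.y = -1 then ⟨c.p, c.d, c.x, -1, true⟩ else ⟨c.n, c.d, c.x, c.y + 1, false⟩)
  else ⟨c.n, c.d, c.x, c.y - 1, true⟩

variable {c c' : Coord}

theorem Valid.p_ne_n (hc : c.Valid) : c.p ≠ c.n := third_ne_left hc.ne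

theorem Valid.p_ne_d (hc : c.Valid) : c.p ≠ c.d := third_ne_right hc.ne

theorem third_n_p (hc : c.Valid) : third c.n c.p = c.d := third_third hc.ne

theorem third_p_d (hc : c.Valid) : third c.p c.d = c.n := by
  rw [p, third_comm c.n, third_comm, third_third hc.ne.symm]

theorem third_d_n (c : Coord) : third c.d c.n = c.p := third_comm _ _

theorem valid_quad (hc : c.Valid) : c.quad.Valid := ⟨hc.p_ne_n.symm, hc.y_neg, hc.x_neg⟩

theorem valid_flat (hc : c.Valid) : c.flat.Valid := ⟨hc.p_ne_n.symm, hc.y_neg, hc.x_neg⟩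

theorem valid_leg (hc : c.Valid) : c.leg.Valid := by
  have := hc.y_neg
  rw [leg]
  cases c.h
  · exact ⟨hc.ne, hc.x_neg, by simp only [cond_false]; omega⟩
  · simp only [cond_true]
    split_ifs with hy
    · exact ⟨hc.p_ne_d, hc.x_neg, by simp⟩
    · exact ⟨hc.ne, hc.x_neg, by simp only; omega⟩

theorem node_mem (hc : c.Valid) : c.node ∈ nodes orthant := by
  have hn : c.n ≠ c.d := hc.ne
  have hp := hc.p_ne_n
  refine ⟨⟨fun i => ?_, fun hcon => ?_⟩, ?_⟩
  · change vec2 c.d c.p c.x c.y i - e c.n i < 0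
    by_cases h1 : i = c.d
    · subst h1; rw [vec2_left, e_of_ne hn.symm]; linarith [hc.x_neg]
    · by_cases h2 : i = c.p
      · rw [h2, vec2_right hc.p_ne_d, e_of_ne hp]; linarith [hc.y_neg]
      · have : i = c.n := by
          by_contra h3
          exact h2 (eq_of_ne_ne hc.ne h3 h1)
        rw [this, vec2_other hn hp.symm, e_same]; norm_num
  · have h1 : vec2 c.d c.p c.x c.y c.n < 0 := hcon c.n
    rw [vec2_other hn hp.symm] at h1
    exact lt_irrefl _ h1
  · change c.side.IsSide c.square
    rw [isSide_iff]
    refine ⟨hc.ne.symm, ?_⟩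
    change vec2 c.d c.p c.x (c.y + bit c.h) = vec2 c.d c.p c.x c.y ∨
      vec2 c.d c.p c.x (c.y + bit c.h) = vec2 c.d c.p c.x c.y + e (third c.d c.n)
    rw [third_d_n, vec2_add_right hc.p_ne_d]
    cases c.h
    · left; simp
    · right; rfl

theorem square_base_of_mem {Q : Square} (hQ : Q ∈ surface orthant) :
    Q.base Q.normal = 0 ∧ ∀ i, i ≠ Q.normal → Q.base i < 0 := by
  have h1 : ∀ i, i ≠ Q.normal → Q.base i < 0 := by
    intro i hi
    have h2 : Q.base i - e Q.normal i < 0 := hQ.1 i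
    rwa [e_of_ne hi, sub_zero] at h2
  refine ⟨?_, h1⟩
  have h2 : Q.base Q.normal - e Q.normal Q.normal < 0 := hQ.1 _
  rw [e_same] at h2
  by_contra h3
  refine hQ.2 fun i => ?_
  by_cases hi : i = Q.normal
  · rw [hi]; omega
  · exact h1 i hi

theorem exists_of_mem_nodes {z : Node} (hz : z ∈ nodes orthant) : ∃ c : Coord, c.Valid ∧ c.node = z := by
  obtain ⟨⟨n, b⟩, ⟨d, b'⟩⟩ := z
  obtain ⟨hQ, hs⟩ := hz
  obtain ⟨h0, h1⟩ := square_base_of_mem hQ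
  obtain ⟨hd, hb⟩ := (isSide_iff _ _).1 hs
  simp only at h0 h1 hd hb
  have hpn : third n d ≠ n := third_ne_left (Ne.symm hd)
  have hpd : third n d ≠ d := third_ne_right (Ne.symm hd)
  have hbase : b = vec2 d (third n d) (b d) (b (third n d)) := by
    refine vec_ext (Ne.symm hd) ?_ ?_ ?_
    · rw [h0, vec2_other (Ne.symm hd) hpn.symm]
    · rw [vec2_left]
    · rw [vec2_right hpd]
  rw [third_comm] at hb
  rcases hb with hb | hb
  · refine ⟨⟨n, d, b d, b (third n d), false⟩, ⟨Ne.symm hd, h1 d hd, h1 _ hpn⟩, ?_⟩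
    refine Prod.ext (Square.ext rfl hbase.symm) (LEdge.ext rfl ?_)
    change vec2 d (third n d) (b d) (b (third n d) + 0) = b'
    rw [hb, add_zero]
    exact hbase.symm
  · refine ⟨⟨n, d, b d, b (third n d), true⟩, ⟨Ne.symm hd, h1 d hd, h1 _ hpn⟩, ?_⟩
    refine Prod.ext (Square.ext rfl hbase.symm) (LEdge.ext rfl ?_)
    change vec2 d (third n d) (b d) (b (third n d) + 1) = b'
    rw [hb, ← vec2_add_right hpd, ← hbase]

theorem bit_injective {h h' : Bool} (hh : bit h = bit h') : h = h' := by
  revert h h'; decide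

theorem node_injective (hc : c.Valid) (h : c.node = c'.node) : c = c' := by
  obtain ⟨n, d, x, y, b⟩ := c
  obtain ⟨n', d', x', y', b'⟩ := c'
  have h1 : n = n' := congrArg (fun z : Node => z.1.normal) h
  have h2 : d = d' := congrArg (fun z : Node => z.2.dir) h
  subst h1 h2
  have h3 : vec2 d (third n d) x y = vec2 d (third n d) x' y' :=
    congrArg (fun z : Node => z.1.base) h
  have h4 : vec2 d (third n d) x (y + bit b) = vec2 d (third n d) x' (y' + bit b') :=
    congrArg (fun z : Node => z.2.base) h
  rw [vec2_inj (third_ne_right hc.ne)] at h3 h4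
  obtain ⟨rfl, rfl⟩ := h3
  have := bit_injective (add_left_cancel h4.2)
  rw [this]

theorem square_quad (hc : c.Valid) : c.quad.square = c.square := by
  rw [square, square]
  change (⟨c.n, vec2 c.p (third c.n c.p) c.y c.x⟩ : Square) = _
  rw [third_n_p hc, vec2_swap hc.p_ne_d]

theorem square_flat (hc : c.Valid) : c.flat.square = c.square := square_quad hc

theorem side_quad (hc : c.Valid) : c.quad.side = ⟨c.p, vec2 c.d c.p (c.x + bit !c.h) c.y⟩ := by
  rw [side]
  change (⟨c.p, vec2 c.p (third c.n c.p) c.y (c.x + bit !c.h)⟩ : LEdge) = _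
  rw [third_n_p hc, vec2_swap hc.p_ne_d]

theorem side_flat (hc : c.Valid) : c.flat.side = ⟨c.p, vec2 c.d c.p (c.x + bit c.h) c.y⟩ := by
  rw [side]
  change (⟨c.p, vec2 c.p (third c.n c.p) c.y (c.x + bit c.h)⟩ : LEdge) = _
  rw [third_n_p hc, vec2_swap hc.p_ne_d]

theorem side_leg (hc : c.Valid) : c.leg.side = c.side := by
  rw [leg, side, side]
  cases hh : c.h
  · simp [p]
  · simp only [cond_true]
    split_ifs with hy
    · simp only [p, bit_true]
      have : third (third c.n c.d) c.d = c.n := third_p_d hc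
      rw [this, hy]
      congr 1
      funext i
      simp [vec2]
    · simp [p]

theorem square_leg_ne (hc : c.Valid) : c.leg.square ≠ c.square := by
  intro hcon
  have h1 := congrArg Square.normal hcon
  have h2 := congrArg (fun Q : Square => Q.base c.p) hcon
  rw [leg] at h1 h2
  cases hh : c.h
  · simp only [hh, cond_false, square, p] at h2
    have := hc.p_ne_d
    rw [p] at this
    rw [vec2_right this, vec2_right this] at h2
    omega
  · simp only [hh, cond_true] at h1 h2
    split_ifs at h1 h2 with hy
    · exact hc.p_ne_n h1
    · simp only [square, p] at h2
      have := hc.p_ne_d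
      rw [p] at this
      rw [vec2_right this, vec2_right this] at h2
      omega

theorem nodeAdj_quad (hc : c.Valid) : NodeAdj c.node c.quad.node := by
  have h1 : c.quad.side = _ := side_quad hc
  refine Or.inl ⟨(square_quad hc).symm, fun h => hc.p_ne_d ?_, ?_⟩
  · exact (congrArg LEdge.dir h).symm
  · rw [meet_iff]
    change vec2 c.d c.p c.x (c.y + bit c.h) ∈ c.quad.side.ends ∨
      vec2 c.d c.p c.x (c.y + bit c.h) + e c.d ∈ c.quad.side.ends
    rw [h1]
    cases c.h
    · right
      left
      rw [vec2_add_left hc.p_ne_d]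
      simp
    · left
      right
      change _ = vec2 c.d c.p _ _ + e c.p
      rw [vec2_add_right hc.p_ne_d]
      simp

theorem nodeAdj_flat (hc : c.Valid) : NodeAdj c.node c.flat.node := by
  have h1 : c.flat.side = _ := side_flat hc
  refine Or.inl ⟨(square_flat hc).symm, fun h => hc.p_ne_d ?_, ?_⟩
  · exact (congrArg LEdge.dir h).symm
  · rw [meet_iff]
    change vec2 c.d c.p c.x (c.y + bit c.h) ∈ c.flat.side.ends ∨
      vec2 c.d c.p c.x (c.y + bit c.h) + e c.d ∈ c.flat.side.ends
    rw [h1]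
    cases c.h
    · left
      left
      simp
    · right
      right
      change _ = vec2 c.d c.p _ _ + e c.p
      rw [vec2_add_left hc.p_ne_d, vec2_add_right hc.p_ne_d]
      simp

theorem nodeAdj_leg (hc : c.Valid) : NodeAdj c.node c.leg.node :=
  Or.inr ⟨(side_leg hc).symm, fun h => square_leg_ne hc (Eq.symm h)⟩

/-- In a square, the neighbouring sides have the other direction and differ by the bit `h`. Across a
lattice edge there is one other square, in the same plane unless the edge lies on a coordinate axis,
where `y = -1` and `h` is true. -/
theorem eq_of_nodeAdj (hc : c.Valid) (hc' : c'.Valid) (h : NodeAdj c.node c'.node) :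
    c' = c.quad ∨ c' = c.flat ∨ c' = c.leg := by
  obtain ⟨n, d, x, y, b⟩ := c
  obtain ⟨n', d', x', y', b'⟩ := c'
  obtain ⟨hne, hx, hy⟩ := hc
  obtain ⟨hne', hx', hy'⟩ := hc'
  simp only at hne hx hy hne' hx' hy'
  have hpn : third n d ≠ n := third_ne_left hne
  have hpd : third n d ≠ d := third_ne_right hne
  rcases h with ⟨h1, h2, h3⟩ | ⟨h1, h2⟩
  · have h4 : n = n' := congrArg Square.normal h1
    subst h4
    have h5 : vec2 d (third n d) x y = vec2 d' (third n d') x' y' := congrArg Square.base h1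
    by_cases hd : d' = d
    · exfalso
      subst hd
      rw [vec2_inj hpd] at h5
      obtain ⟨rfl, rfl⟩ := h5
      have hb : b ≠ b' := by
        rintro rfl; exact h2 rfl
      obtain ⟨w, hw, hw'⟩ := h3
      have key : ∀ c : Bool, w ∈ (⟨d', vec2 d' (third n d') x (y + bit c)⟩ : LEdge).ends →
          w (third n d') = y + bit c := by
        rintro c (rfl | rfl)
        · exact vec2_right hpd _ _
        · rw [Pi.add_apply, e_of_ne hpd, add_zero]
          exact vec2_right hpd _ _
      exact hb (bit_injective (add_left_cancel ((key b hw).symm.trans (key b' hw'))))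
    · have hd' : d' = third n d := eq_of_ne_ne hne hne'.symm hd
      subst hd'
      rw [third_third hne, vec2_swap hpd.symm, vec2_inj hpd.symm] at h5
      obtain ⟨rfl, rfl⟩ := h5
      by_cases hb : b' = b
      · subst hb; exact Or.inr (Or.inl rfl)
      · have : b' = !b := Bool.eq_not_of_ne hb
        subst this; exact Or.inl rfl
  · right; right
    have h3 : d = d' := congrArg LEdge.dir h1
    subst h3
    have h4 : vec2 d (third n d) x (y + bit b) = vec2 d (third n' d) x' (y' + bit b') :=
      congrArg LEdge.base h1
    by_cases hn : n' = n
    · subst hn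
      rw [vec2_inj hpd] at h4
      obtain ⟨rfl, h5⟩ := h4
      have hb : b ≠ b' := by
        rintro rfl
        have : y = y' := add_right_cancel h5
        subst this
        exact h2 rfl
      rw [leg]
      cases b <;> cases b'
      · exact absurd rfl hb
      · simp only [bit_false, bit_true] at h5
        simp only [cond_false, Coord.mk.injEq, true_and, and_true]
        omega
      · simp only [bit_false, bit_true] at h5
        have : y ≠ -1 := by omega
        simp only [cond_true, if_neg this, Coord.mk.injEq, true_and, and_true]
        omega
      · exact absurd rfl hb
    · have hn' : n' = third d n := eq_of_ne_ne hne.symm hne' hn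
      have hn'' : n' = third n d := hn'.trans (third_comm _ _)
      have h6 : third n' d = n := by
        rw [hn'', third_comm n, third_comm, third_third hne.symm]
      rw [h6] at h4
      have h7 := congrFun h4 d
      have h8 := congrFun h4 (third n d)
      have h9 := congrFun h4 n
      rw [vec2_left, vec2_left] at h7
      rw [vec2_right hpd, vec2_other hpd hpn] at h8
      rw [vec2_other hne hpn.symm, vec2_right hne] at h9
      rw [leg]
      cases b <;> cases b' <;> simp only [bit_false, bit_true] at h8 h9
      · omega
      · omega
      · omega
      · have : y = -1 := by omega
        simp only [cond_true, if_pos this, Coord.mk.injEq, p, and_true, true_and]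
        exact ⟨hn'', h7.symm, by omega⟩

theorem graph_adj_iff (hc : c.Valid) {z : Node} : (graph orthant).Adj c.node z ↔
    z = c.quad.node ∨ z = c.flat.node ∨ z = c.leg.node := by
  constructor
  · rintro ⟨-, hz, h⟩
    obtain ⟨c', hc', rfl⟩ := exists_of_mem_nodes hz
    rcases eq_of_nodeAdj hc hc' h with rfl | rfl | rfl <;> simp
  · rintro (rfl | rfl | rfl)
    · exact ⟨node_mem hc, node_mem (valid_quad hc), nodeAdj_quad hc⟩
    · exact ⟨node_mem hc, node_mem (valid_flat hc), nodeAdj_flat hc⟩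
    · exact ⟨node_mem hc, node_mem (valid_leg hc), nodeAdj_leg hc⟩

end Coord

namespace Coord

variable {c c' : Coord}

/-! ### The initial configuration in coordinates -/

theorem quad_quad (hc : c.Valid) : c.quad.quad = c :=
  Coord.ext rfl (third_n_p hc) rfl rfl (Bool.not_not _)

theorem flat_flat (hc : c.Valid) : c.flat.flat = c := Coord.ext rfl (third_n_p hc) rfl rfl rfl

theorem leg_mk_false (n d : Fin 3) (x y : ℤ) :
    (⟨n, d, x, y, false⟩ : Coord).leg = ⟨n, d, x, y - 1, true⟩ := rfl

theorem leg_mk_axis (n d : Fin 3) (x : ℤ) :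
    (⟨n, d, x, -1, true⟩ : Coord).leg = ⟨third n d, d, x, -1, true⟩ := rfl

theorem leg_mk_true (n d : Fin 3) (x : ℤ) {y : ℤ} (hy : y ≠ -1) :
    (⟨n, d, x, y, true⟩ : Coord).leg = ⟨n, d, x, y + 1, false⟩ := if_neg hy

theorem leg_leg (hc : c.Valid) : c.leg.leg = c := by
  obtain ⟨n, d, x, y, h⟩ := c
  have h1 : third (third n d) d = n := third_p_d (c := ⟨n, d, x, y, h⟩) hc
  have hy : y < 0 := hc.y_neg
  cases h
  · rw [leg_mk_false, leg_mk_true _ _ _ (by omega), sub_add_cancel]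
  · by_cases hy1 : y = -1
    · subst hy1; rw [leg_mk_axis, leg_mk_axis, h1]
    · rw [leg_mk_true _ _ _ hy1, leg_mk_false, add_sub_cancel_right]

theorem base_mem_ends (hc : c.Valid) : c.square.base ∈ c.side.ends ↔ c.h = false := by
  obtain ⟨n, d, x, y, h⟩ := c
  have hp : third n d ≠ d := third_ne_right hc.ne
  change vec2 d (third n d) x y = vec2 d (third n d) x (y + bit h) ∨
    vec2 d (third n d) x y = vec2 d (third n d) x (y + bit h) + e d ↔ h = false
  rw [vec2_add_left hp, vec2_inj hp, vec2_inj hp]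
  cases h <;> simp

theorem top_mem_ends (hc : c.Valid) : c.square.top ∈ c.side.ends ↔ c.h = true := by
  obtain ⟨n, d, x, y, h⟩ := c
  have hne : n ≠ d := hc.ne
  have hp : third n d ≠ d := third_ne_right hne
  have hpn : third n d ≠ n := third_ne_left hne
  have htop : (Coord.mk n d x y h).square.top = vec2 d (third n d) (x + 1) (y + 1) := by
    refine vec_ext hne ?_ ?_ ?_
    · rw [vec2_other hne hpn.symm]
      simp only [Square.top, square, if_true]
      exact vec2_other hne hpn.symm _ _
    · rw [vec2_left]
      refine (if_neg (show d ≠ n from hne.symm)).trans ?_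
      congr 1
      exact vec2_left _ _ _ _
    · rw [vec2_right hp]
      refine (if_neg (show third n d ≠ n from hpn)).trans ?_
      congr 1
      exact vec2_right hp _ _
  rw [htop]
  change vec2 d (third n d) (x + 1) (y + 1) = vec2 d (third n d) x (y + bit h) ∨
    vec2 d (third n d) (x + 1) (y + 1) = vec2 d (third n d) x (y + bit h) + e d ↔ h = true
  rw [vec2_add_left hp, vec2_inj hp, vec2_inj hp]
  cases h <;> simp

theorem mem_edgeSet_quad (hc : c.Valid) : s(c.node, c.quad.node) ∈ (graph orthant).edgeSet :=
  (graph_adj_iff hc).2 (Or.inl rfl)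

theorem mem_edgeSet_flat (hc : c.Valid) : s(c.node, c.flat.node) ∈ (graph orthant).edgeSet :=
  (graph_adj_iff hc).2 (Or.inr (Or.inl rfl))

theorem mem_edgeSet_leg (hc : c.Valid) : s(c.node, c.leg.node) ∈ (graph orthant).edgeSet :=
  (graph_adj_iff hc).2 (Or.inr (Or.inr rfl))

theorem forall_mem_mk {α : Type*} {x y : α} {P : α → Prop} : (∀ z ∈ s(x, y), P z) ↔ P x ∧ P y := by
  simp [Sym2.mem_iff]

/-- A side contains the farthest corner of its square when `h` is false and the nearest one when `h`
is true. The map `quad` reverses `h`, so its edge faces neither of them. -/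
theorem initialConfig_quad (hc : c.Valid) : initialConfig s(c.node, c.quad.node) = 1 := by
  classical
  rw [initialConfig, Set.indicator_of_mem, Pi.one_apply]
  refine ⟨mem_edgeSet_quad hc, fun Q hQ => ?_⟩
  have h1 : c.square = Q := (forall_mem_mk.1 hQ.2).1
  subst h1
  constructor
  · intro h
    obtain ⟨h2, h3⟩ := forall_mem_mk.1 h.2
    have h2 := (base_mem_ends hc).1 h2
    rw [← square_quad hc] at h3
    have h3 := (base_mem_ends (valid_quad hc)).1 h3
    rw [quad, h2] at h3
    exact absurd h3 (by simp)
  · intro h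
    obtain ⟨h2, h3⟩ := forall_mem_mk.1 h.2
    have h2 := (top_mem_ends hc).1 h2
    rw [← square_quad hc] at h3
    have h3 := (top_mem_ends (valid_quad hc)).1 h3
    rw [quad, h2] at h3
    exact absurd h3 (by simp)

theorem initialConfig_leg (hc : c.Valid) : initialConfig s(c.node, c.leg.node) = 1 := by
  classical
  rw [initialConfig, Set.indicator_of_mem, Pi.one_apply]
  refine ⟨mem_edgeSet_leg hc, fun Q hQ => ?_⟩
  obtain ⟨h1, h2⟩ := forall_mem_mk.1 hQ.2
  exact absurd (h2.trans h1.symm) (square_leg_ne hc)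

theorem initialConfig_flat (hc : c.Valid) : initialConfig s(c.node, c.flat.node) = 0 := by
  classical
  refine Set.indicator_of_notMem (fun h => ?_) 1
  have h1 := h.2 c.square ⟨mem_edgeSet_flat hc, forall_mem_mk.2 ⟨rfl, square_flat hc⟩⟩
  cases hh : c.h
  · refine h1.1 ⟨mem_edgeSet_flat hc, forall_mem_mk.2 ⟨(base_mem_ends hc).2 hh, ?_⟩⟩
    rw [← square_flat hc]
    exact (base_mem_ends (valid_flat hc)).2 hh
  · refine h1.2 ⟨mem_edgeSet_flat hc, forall_mem_mk.2 ⟨(top_mem_ends hc).2 hh, ?_⟩⟩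
    rw [← square_flat hc]
    exact (top_mem_ends (valid_flat hc)).2 hh

theorem initialConfig_eq_zero {E : Sym2 Node} (hE : E ∉ (graph orthant).edgeSet) :
    initialConfig E = 0 := by
  classical
  exact Set.indicator_of_notMem (fun h => hE h.1) 1

theorem initial_adj_iff (hc : c.Valid) {z : Node} : (singleGraph initialConfig).Adj c.node z ↔
    z = c.quad.node ∨ z = c.leg.node := by
  constructor
  · rintro ⟨hne, h1⟩
    have h2 : (graph orthant).Adj c.node z := by
      by_contra hcon
      rw [initialConfig_eq_zero hcon] at h1
      exact zero_ne_one h1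
    rcases (graph_adj_iff hc).1 h2 with rfl | rfl | rfl
    · exact Or.inl rfl
    · rw [initialConfig_flat hc] at h1
      exact absurd h1 zero_ne_one
    · exact Or.inr rfl
  · rintro (rfl | rfl)
    · exact ⟨(graph_adj_iff hc |>.2 (Or.inl rfl)).ne, initialConfig_quad hc⟩
    · exact ⟨(graph_adj_iff hc |>.2 (Or.inr (Or.inr rfl))).ne, initialConfig_leg hc⟩

/-- The edges from each node to its image under an involution. -/
def matching (f : Coord → Coord) : Set (Sym2 Node) := {E | ∃ c : Coord, c.Valid ∧ s(c.node, (f c).node) = E}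

theorem mk_mem_matching {f : Coord → Coord} (hf : ∀ c : Coord, c.Valid → (f c).Valid)
    (hff : ∀ c : Coord, c.Valid → f (f c) = c) (hc : c.Valid) {z : Node} :
    s(c.node, z) ∈ matching f ↔ z = (f c).node := by
  constructor
  · rintro ⟨c', hc', h⟩
    rcases Sym2.eq_iff.1 h with ⟨h1, rfl⟩ | ⟨rfl, h1⟩
    · rw [node_injective hc' h1]
    · rw [← node_injective (hf c' hc') h1, hff c' hc']
  · rintro rfl
    exact ⟨c, hc, rfl⟩

theorem isDimerCover_matching {f : Coord → Coord} (hf : ∀ c : Coord, c.Valid → (f c).Valid)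
    (hff : ∀ c : Coord, c.Valid → f (f c) = c)
    (hadj : ∀ c : Coord, c.Valid → s(c.node, (f c).node) ∈ (graph orthant).edgeSet) :
    IsDimerCover orthant (matching f) := by
  constructor
  · rintro _ ⟨c, hc, rfl⟩
    exact hadj c hc
  · intro z hz
    obtain ⟨c, hc, rfl⟩ := exists_of_mem_nodes hz
    refine ⟨s(c.node, (f c).node), ⟨⟨c, hc, rfl⟩, Sym2.mem_mk_left _ _⟩, ?_⟩
    rintro E ⟨hE, hz⟩
    obtain ⟨z, rfl⟩ := Sym2.mem_iff_exists.1 hz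
    rw [(mk_mem_matching hf hff hc).1 hE]

theorem quad_node_ne_leg_node (hc : c.Valid) : c.quad.node ≠ c.leg.node := fun h =>
  square_leg_ne hc ((congrArg Prod.fst h).symm.trans (square_quad hc))

theorem flat_node_ne_leg_node (hc : c.Valid) : c.flat.node ≠ c.leg.node := fun h =>
  square_leg_ne hc ((congrArg Prod.fst h).symm.trans (square_flat hc))

theorem flat_node_ne_quad_node (hc : c.Valid) : c.flat.node ≠ c.quad.node := fun h => by
  have := congrArg Coord.h (node_injective (valid_flat hc) h)
  simp [flat, quad] at this

/-- The initial configuration is the union of the perfect matchings formed by the legs and by the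
quadrilateral edges of type `quad`. -/
theorem isDoubleDimer_initialConfig : IsDoubleDimer orthant initialConfig := by
  classical
  have hl := isDimerCover_matching (fun _ => valid_leg) (fun _ => leg_leg) fun _ => mem_edgeSet_leg
  have hq := isDimerCover_matching (fun _ => valid_quad) (fun _ => quad_quad)
    fun _ => mem_edgeSet_quad
  refine ⟨_, _, hl, hq, ?_⟩
  funext E
  by_cases hE : E ∈ (graph orthant).edgeSet
  · induction E using Sym2.ind with
    | h x z =>
      obtain ⟨c, hc, rfl⟩ := exists_of_mem_nodes ((graph orthant).mem_edgeSet.1 hE).1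
      simp only [Pi.add_apply, Set.indicator_apply, Pi.one_apply,
        mk_mem_matching (fun _ => valid_leg) (fun _ => leg_leg) hc,
        mk_mem_matching (fun _ => valid_quad) (fun _ => quad_quad) hc]
      rcases (graph_adj_iff hc).1 hE with rfl | rfl | rfl
      · rw [initialConfig_quad hc, if_neg (quad_node_ne_leg_node hc), if_pos rfl, zero_add]
      · rw [initialConfig_flat hc, if_neg (flat_node_ne_leg_node hc),
          if_neg (flat_node_ne_quad_node hc), zero_add]
      · rw [initialConfig_leg hc, if_pos rfl, if_neg (quad_node_ne_leg_node hc).symm, add_zero]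
  · rw [initialConfig_eq_zero hE, Pi.add_apply, Set.indicator_of_notMem fun h => hE (hl.1 h),
      Set.indicator_of_notMem fun h => hE (hq.1 h), zero_add]

/-! ### Levels and paths of the initial configuration -/

/-- The level of a node. -/
def lev (c : Coord) : ℤ := 2 * (c.x + c.y) + bit c.h

/-- The path of the initial configuration containing a node, given by the direction of the axis
that it crosses, and the coordinate at which it does so. -/
def apex (c : Coord) : Fin 3 × ℤ :=
  if c.x - c.y - bit c.h < 0 then (c.d, c.x - c.y - bit c.h) else (c.p, c.y + bit c.h - c.x - 1)

theorem apex_mk (n d : Fin 3) (x y : ℤ) (h : Bool) : (⟨n, d, x, y, h⟩ : Coord).apex =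
    if x - y - bit h < 0 then (d, x - y - bit h) else (third n d, y + bit h - x - 1) := rfl

theorem bit_cases (h : Bool) : (h = false ∧ bit h = 0) ∨ (h = true ∧ bit h = 1) := by
  cases h <;> simp

theorem bit_not (h : Bool) : bit (!h) = 1 - bit h := by cases h <;> rfl

theorem lev_quad (c : Coord) : c.quad.lev = c.lev + 1 - 2 * bit c.h := by
  simp only [lev, quad, bit_not]; ring

theorem lev_flat (c : Coord) : c.flat.lev = c.lev := by
  simp only [lev, flat]; ring

theorem lev_leg_of_false (h : c.h = false) : c.leg.lev = c.lev - 1 := by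
  simp [lev, leg, h]; ring

theorem lev_leg_of_true (h : c.h = true) (hy : c.y ≠ -1) : c.leg.lev = c.lev + 1 := by
  simp [lev, leg, h, hy]; ring

/-- With `δ = x - y - bit h`, the map `quad` replaces `δ` by `-1 - δ` and exchanges `d` and `p`.
Exactly one of the two values is negative, so the two branches of the definition change places. -/
theorem apex_quad (hc : c.Valid) : c.quad.apex = c.apex := by
  have h1 : c.quad.p = c.d := third_n_p hc
  rw [apex, apex, h1]
  simp only [quad, bit_not]
  split_ifs with h2 h3 h3
  · omega
  · congr 1; ring
  · congr 1; ring
  · omega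

/-- The number `x - y - bit h` does not change away from the axes, where the normal stays the same
as well. At an axis it equals `x`, which is negative, so only `d` and `x` enter. -/
theorem apex_leg (hc : c.Valid) : c.leg.apex = c.apex := by
  obtain ⟨n, d, x, y, h⟩ := c
  have hx := hc.x_neg
  have hy := hc.y_neg
  simp only at hx hy
  cases h
  · rw [leg_mk_false, apex_mk, apex_mk, bit_true, bit_false,
      show x - (y - 1) - 1 = x - y - 0 by ring, show y - 1 + 1 - x - 1 = y + 0 - x - 1 by ring]
  · by_cases hy1 : y = -1
    · subst hy1
      rw [leg_mk_axis, apex_mk, apex_mk, bit_true, if_pos (by omega), if_pos (by omega)]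
    · rw [leg_mk_true _ _ _ hy1, apex_mk, apex_mk, bit_true, bit_false,
        show x - (y + 1) - 0 = x - y - 1 by ring, show y + 1 + 0 - x - 1 = y + 1 - x - 1 by ring]

theorem apex_spec (hc : c.Valid) : c.n ≠ c.apex.1 ∧ c.apex.2 < 0 ∧ c.lev ≤ 2 * c.apex.2 - 1 := by
  have hx := hc.x_neg
  have hy := hc.y_neg
  rw [apex, lev]
  rcases bit_cases c.h with ⟨-, hb⟩ | ⟨-, hb⟩ <;> rw [hb] <;> split_ifs with h <;>
    simp only
  · exact ⟨hc.ne, h, by omega⟩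
  · exact ⟨hc.p_ne_n.symm, by omega, by omega⟩
  · exact ⟨hc.ne, h, by omega⟩
  · exact ⟨hc.p_ne_n.symm, by omega, by omega⟩

/-- The apex gives the absolute position relative to the diagonal, and the parity of the level
separates the two sides of the diagonal. Together with the level this recovers all coordinates: a
path visits each level of a sector at most once. -/
theorem eq_of_apex_eq (hc : c.Valid) (hc' : c'.Valid) (hn : c.n = c'.n) (ha : c.apex = c'.apex)
    (hl : c.lev = c'.lev) : c = c' := by
  obtain ⟨n, d, x, y, h⟩ := c
  obtain ⟨n', d', x', y', h'⟩ := c'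
  simp only at hn
  subst hn
  have hne := hc.ne
  have hne' := hc'.ne
  simp only at hne hne'
  rw [apex_mk, apex_mk] at ha
  simp only [lev] at hl
  have hd : d = d' → x - y - bit h = x' - y' - bit h' →
      (⟨n, d, x, y, h⟩ : Coord) = ⟨n, d', x', y', h'⟩ := by
    rintro rfl hδ
    cases h <;> cases h' <;> simp only [bit_true, bit_false] at hl hδ <;>
      simp only [Coord.mk.injEq, true_and, and_true] <;> omega
  split_ifs at ha with h1 h2 h2 <;> rw [Prod.mk.injEq] at ha
  · exact hd ha.1 ha.2
  · exfalso
    rcases bit_cases h with ⟨-, hb⟩ | ⟨-, hb⟩ <;> rcases bit_cases h' with ⟨-, hb'⟩ | ⟨-, hb'⟩ <;>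
      rw [hb, hb'] at hl ha <;> omega
  · exfalso
    rcases bit_cases h with ⟨-, hb⟩ | ⟨-, hb⟩ <;> rcases bit_cases h' with ⟨-, hb'⟩ | ⟨-, hb'⟩ <;>
      rw [hb, hb'] at hl ha <;> omega
  · refine hd ?_ (by omega)
    have h3 := congrArg (third n) ha.1
    rwa [third_third hne, third_third hne'] at h3

/-- The two nodes at which a path of the initial configuration crosses an axis. -/
def axisNode (n : Fin 3) (l : Fin 3 × ℤ) : Coord := ⟨n, l.1, l.2, -1, true⟩

theorem valid_axisNode {n : Fin 3} {l : Fin 3 × ℤ} (hn : n ≠ l.1) (hl : l.2 < 0) :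
    (axisNode n l).Valid := ⟨hn, hl, by simp [axisNode]⟩

theorem apex_axisNode {n : Fin 3} {l : Fin 3 × ℤ} (hl : l.2 < 0) : (axisNode n l).apex = l := by
  rw [axisNode, apex_mk, bit_true, if_pos (by omega)]
  exact Prod.ext rfl (by simp)

theorem lev_axisNode (n : Fin 3) (l : Fin 3 × ℤ) : (axisNode n l).lev = 2 * l.2 - 1 := by
  simp only [axisNode, lev, bit_true]; ring

theorem leg_axisNode (n : Fin 3) (l : Fin 3 × ℤ) : (axisNode n l).leg = axisNode (third n l.1) l := by
  simp [axisNode, leg, p]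

/-- The next node below on the same path of the initial configuration. -/
def down (c : Coord) : Coord := bif c.h then c.quad else c.leg

/-- The next node above on the same path of the initial configuration. -/
def up (c : Coord) : Coord := bif c.h then c.leg else c.quad

theorem valid_down (hc : c.Valid) : c.down.Valid := by
  rw [down]; cases c.h
  exacts [valid_leg hc, valid_quad hc]

theorem down_spec (hc : c.Valid) : c.down.n = c.n ∧ c.down.apex = c.apex ∧ c.down.lev = c.lev - 1 := by
  rw [down]
  cases h : c.h
  · exact ⟨by simp [leg, h], apex_leg hc, lev_leg_of_false h⟩
  · refine ⟨by simp [quad], apex_quad hc, ?_⟩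
    rw [cond_true, lev_quad, h, bit_true]; ring

theorem valid_up (hc : c.Valid) : c.up.Valid := by
  rw [up]; cases c.h
  exacts [valid_quad hc, valid_leg hc]

theorem adj_up (hc : c.Valid) : (singleGraph initialConfig).Adj c.node c.up.node := by
  rw [initial_adj_iff hc, up]
  cases c.h <;> simp

theorem apex_up (hc : c.Valid) : c.up.apex = c.apex := by
  rw [up]; cases c.h
  exacts [apex_quad hc, apex_leg hc]

theorem up_spec (h : ¬ (c.h = true ∧ c.y = -1)) : c.up.n = c.n ∧ c.up.lev = c.lev + 1 := by
  rw [up]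
  cases hh : c.h
  · refine ⟨by simp [quad], ?_⟩
    rw [cond_false, lev_quad, hh, bit_false]; ring
  · have hy : c.y ≠ -1 := fun hy => h ⟨hh, hy⟩
    exact ⟨by simp [leg, hh, hy], lev_leg_of_true hh hy⟩

theorem eq_axisNode (hc : c.Valid) (h : c.h = true ∧ c.y = -1) : c = axisNode c.n c.apex := by
  have hx := hc.x_neg
  have h1 : c.apex = (c.d, c.x) := by
    rw [apex, h.1, h.2, bit_true, if_pos (by omega)]
    simp
  rw [h1, axisNode]
  exact Coord.ext rfl rfl rfl h.2 h.1

/-- Along a path each step upwards raises the level by one until an axis is reached. Levels are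
bounded above by `apex_spec`, so induction on the negative of the level applies. -/
theorem reachable_axisNode (hc : c.Valid) :
    (singleGraph initialConfig).Reachable c.node (axisNode c.n c.apex).node := by
  obtain ⟨k, hk⟩ : ∃ k : ℕ, -c.lev = k := by
    have h := apex_spec hc
    exact ⟨(-c.lev).toNat, by omega⟩
  induction k using Nat.strong_induction_on generalizing c with
  | _ k ih =>
    by_cases h : c.h = true ∧ c.y = -1
    · rw [← eq_axisNode hc h]
    · obtain ⟨h1, h2⟩ := up_spec h
      have h3 := ih (k - 1) (by have := apex_spec (valid_up hc); omega) (valid_up hc)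
        (by have := apex_spec (valid_up hc); omega)
      rw [h1, apex_up hc] at h3
      exact (adj_up hc).reachable.trans h3

/-- A path consists of two halves in the two sectors adjacent to its axis, joined by the leg which
crosses this axis. -/
theorem reachable_of_apex_eq (hc : c.Valid) (hc' : c'.Valid) (h : c.apex = c'.apex) :
    (singleGraph initialConfig).Reachable c.node c'.node := by
  have h1 := reachable_axisNode hc
  have h2 := reachable_axisNode hc'
  obtain ⟨h3, h4, -⟩ := apex_spec hc
  obtain ⟨h5, -⟩ := apex_spec hc'
  rw [← h] at h2 h5
  by_cases hn : c'.n = c.n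
  · rw [hn] at h2
    exact h1.trans h2.symm
  · have h6 : c'.n = third c.n c.apex.1 := eq_of_ne_ne h3 hn h5
    have h7 : (singleGraph initialConfig).Adj (axisNode c.n c.apex).node
        (axisNode c'.n c.apex).node := by
      rw [initial_adj_iff (valid_axisNode h3 h4), leg_axisNode, h6]
      exact Or.inr rfl
    exact (h1.trans h7.reachable).trans h2.symm

theorem apex_eq_of_reachable (hc : c.Valid) {z : Node}
    (h : (singleGraph initialConfig).Reachable c.node z) :
    ∃ c' : Coord, c'.Valid ∧ c'.node = z ∧ c'.apex = c.apex := by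
  refine reachable_induction (P := fun z => ∃ c' : Coord, c'.Valid ∧ c'.node = z ∧ c'.apex = c.apex)
    ⟨c, hc, rfl, rfl⟩ ?_ h
  rintro _ z - hz ⟨c', hc', rfl, ha⟩
  rcases (initial_adj_iff hc').1 hz with rfl | rfl
  · exact ⟨_, valid_quad hc', rfl, (apex_quad hc').trans ha⟩
  · exact ⟨_, valid_leg hc', rfl, (apex_leg hc').trans ha⟩

theorem reachable_iff_apex_eq (hc : c.Valid) (hc' : c'.Valid) :
    (singleGraph initialConfig).Reachable c.node c'.node ↔ c.apex = c'.apex := by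
  refine ⟨fun h => ?_, reachable_of_apex_eq hc hc'⟩
  obtain ⟨c'', hc'', h1, h2⟩ := apex_eq_of_reachable hc h
  rw [← h2, node_injective hc'' h1]

theorem exists_coord {n : Fin 3} {l : Fin 3 × ℤ} (hn : n ≠ l.1) (hl : l.2 < 0) {f : ℤ}
    (hf : f ≤ 2 * l.2 - 1) : ∃ c : Coord, c.Valid ∧ c.n = n ∧ c.apex = l ∧ c.lev = f := by
  induction f, hf using Int.leInductionDown with
  | base => exact ⟨_, valid_axisNode hn hl, rfl, apex_axisNode hl, lev_axisNode n l⟩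
  | pred f _ ih =>
    obtain ⟨c, hc, h1, h2, h3⟩ := ih
    obtain ⟨h4, h5, h6⟩ := down_spec hc
    exact ⟨c.down, valid_down hc, h4.trans h1, h5.trans h2, by rw [h6, h3]⟩

end Coord

theorem infinite_initialConfig : ∀ x ∈ nodes orthant,
    {y | (singleGraph initialConfig).Reachable x y}.Infinite := by
  intro x hx
  obtain ⟨c, hc, rfl⟩ := Coord.exists_of_mem_nodes hx
  obtain ⟨h1, h2, -⟩ := Coord.apex_spec hc
  have h3 : ∀ k : ℕ, ∃ c' : Coord, c'.Valid ∧ c'.n = c.n ∧ c'.apex = c.apex ∧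
      c'.lev = 2 * c.apex.2 - 1 - k := fun k => Coord.exists_coord h1 h2 (by omega)
  choose f hf hn ha hl using h3
  refine Set.infinite_of_injective_forall_mem (f := fun k => (f k).node) (fun k k' hk => ?_)
    fun k => Coord.reachable_of_apex_eq hc (hf k) (ha k).symm
  have h4 := congrArg Coord.lev (Coord.node_injective (hf k) hk)
  rw [hl, hl] at h4
  omega

theorem isTaut_initialConfig : IsTaut orthant initialConfig := by
  rw [isTaut_iff infinite_initialConfig]
  exact ⟨Coord.isDoubleDimer_initialConfig, ∅, Set.finite_empty, fun _ _ => rfl,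
    fun _ _ _ _ => Iff.rfl⟩

/-! ### Uniqueness of the taut configuration of the cubic corner graph -/

namespace Coord

variable {c c' : Coord} {m : Sym2 Node → ℕ} {N : ℤ}

theorem adj_cases (hD : IsDoubleDimer orthant m) (hc : c.Valid) {z : Node}
    (h : (singleGraph m).Adj c.node z) :
    z = c.quad.node ∨ z = c.flat.node ∨ z = c.leg.node := by
  rw [← graph_adj_iff hc]
  by_contra hcon
  have h1 := hD.eq_zero (E := s(c.node, z)) hcon
  rw [h.2] at h1
  exact one_ne_zero h1

/-- An edge of a double-dimer configuration stays in its sector, changing the level by at most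
one, or crosses an axis. -/
theorem adj_step (hD : IsDoubleDimer orthant m) (hc : c.Valid) {z : Node}
    (h : (singleGraph m).Adj c.node z) : ∃ c' : Coord, c'.Valid ∧ z = c'.node ∧
      ((c'.n = c.n ∧ c'.lev ≤ c.lev + 1) ∨
        (c = axisNode c.n c.apex ∧ c' = axisNode (third c.n c.apex.1) c.apex)) := by
  rcases adj_cases hD hc h with rfl | rfl | rfl
  · refine ⟨_, valid_quad hc, rfl, Or.inl ⟨rfl, ?_⟩⟩
    rw [lev_quad]
    rcases bit_cases c.h with ⟨-, hb⟩ | ⟨-, hb⟩ <;> omega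
  · exact ⟨_, valid_flat hc, rfl, Or.inl ⟨rfl, by rw [lev_flat]; omega⟩⟩
  · refine ⟨_, valid_leg hc, rfl, ?_⟩
    by_cases hx : c.h = true ∧ c.y = -1
    · right
      have h1 := eq_axisNode hc hx
      refine ⟨h1, ?_⟩
      conv_lhs => rw [h1]
      rw [leg_axisNode]
    · left
      cases hh : c.h
      · exact ⟨by simp [leg, hh], by rw [lev_leg_of_false hh]; omega⟩
      · have hy : c.y ≠ -1 := fun hy => hx ⟨hh, hy⟩
        exact ⟨by simp [leg, hh, hy], by rw [lev_leg_of_true hh hy]⟩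

/-- Below the level `N` the paths of `m` and of the initial configuration are the same. -/
def AgreesBelow (m : Sym2 Node → ℕ) (N : ℤ) : Prop :=
  ∀ c c' : Coord, c.Valid → c'.Valid → c.lev ≤ N → c'.lev ≤ N →
    ((singleGraph m).Reachable c.node c'.node ↔ c.apex = c'.apex)

/-- The node `z` is on the path of `m` which agrees with the path `l` of the initial configuration
below the level `N`. -/
def OnPath (m : Sym2 Node → ℕ) (N : ℤ) (l : Fin 3 × ℤ) (z : Node) : Prop :=
  ∃ c : Coord, c.Valid ∧ c.apex = l ∧ c.lev ≤ N ∧ (singleGraph m).Reachable c.node z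

/-! ### Pigeonhole arguments for the paths of a taut configuration. -/

section Path

variable {l l' : Fin 3 × ℤ} {z : Node} (hN : AgreesBelow m N)
include hN

theorem OnPath.unique (h : OnPath m N l z) (h' : OnPath m N l' z) : l = l' := by
  obtain ⟨c, hc, rfl, hl, hr⟩ := h
  obtain ⟨c', hc', rfl, hl', hr'⟩ := h'
  exact (hN c c' hc hc' hl hl').1 (hr.trans hr'.symm)

theorem OnPath.reachable (h : OnPath m N l z) (hc : c.Valid) (ha : c.apex = l) (hl : c.lev ≤ N) :
    (singleGraph m).Reachable c.node z := by
  obtain ⟨c', hc', h1, h2, h3⟩ := h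
  exact ((hN c c' hc hc' hl h2).2 (ha.trans h1.symm)).trans h3

omit hN in
theorem OnPath.trans (h : OnPath m N l z) {z' : Node} (hz : (singleGraph m).Reachable z z') :
    OnPath m N l z' := by
  obtain ⟨c', hc', h1, h2, h3⟩ := h
  exact ⟨c', hc', h1, h2, h3.trans hz⟩

/-- A path crosses an axis. -/
theorem exists_axis (hD : IsDoubleDimer orthant m) (hl : l.2 < 0) : ∃ μ : Fin 3 × ℤ, μ.2 < 0 ∧
    ∀ n, n ≠ μ.1 → OnPath m N l (axisNode n μ).node := by
  by_contra hcon
  have h1 : ∀ k : Fin 3, k + 1 ≠ k ∧ k + 2 ≠ k ∧ k + 2 ≠ k + 1 := by decide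
  obtain ⟨hn, hn', hnn⟩ := h1 l.1
  obtain ⟨c, hc, hcn, hca, hcl⟩ := exists_coord hn hl (min_le_right N (2 * l.2 - 1))
  obtain ⟨c', hc', hcn', hca', hcl'⟩ := exists_coord hn' hl (min_le_right N (2 * l.2 - 1))
  have hcN : c.lev ≤ N := hcl ▸ min_le_left _ _
  have hcN' : c'.lev ≤ N := hcl' ▸ min_le_left _ _
  have hr := (hN c c' hc hc' hcN hcN').2 (hca.trans hca'.symm)
  -- Far below, the path `l` has nodes in both sectors adjacent to its axis. Since sectors change
  -- only at axis crossings, a path without crossings would remain in the sector `l.1 + 1` and could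
  -- not reach `c'`.
  have key : ∃ c'' : Coord, c''.Valid ∧ c''.n = l.1 + 1 ∧ c''.node = c'.node := by
    refine reachable_induction (P := fun z => ∃ c'' : Coord, c''.Valid ∧ c''.n = l.1 + 1 ∧
      c''.node = z) ⟨c, hc, hcn, rfl⟩ ?_ hr
    rintro _ z hy hyz ⟨b, hb, hbn, rfl⟩
    obtain ⟨b', hb', rfl, ⟨h2, -⟩ | ⟨h2, h3⟩⟩ := adj_step hD hb hyz
    · exact ⟨b', hb', h2.trans hbn, rfl⟩
    · exfalso
      obtain ⟨h4, h5, -⟩ := apex_spec hb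
      have h6 : OnPath m N l b.node := ⟨c, hc, hca, hcN, hy⟩
      refine hcon ⟨b.apex, h5, fun k hk => ?_⟩
      by_cases hkb : k = b.n
      · rw [hkb, ← h2]; exact h6
      · rw [eq_of_ne_ne h4 hkb hk, ← h3]
        exact h6.trans hyz.reachable
  obtain ⟨c'', hc'', h2, h3⟩ := key
  rw [node_injective hc'' h3, hcn'] at h2
  exact hnn h2

/-- Each crossing of an axis belongs to exactly one path. -/
theorem exists_crossing_bijection (hD : IsDoubleDimer orthant m) : ∃ τ : Fin 3 × ℤ → Fin 3 × ℤ,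
    (∀ μ, μ.2 < 0 → (τ μ).2 < 0 ∧ ∀ n, n ≠ μ.1 → OnPath m N (τ μ) (axisNode n μ).node) ∧
    ∀ μ μ', μ.2 < 0 → μ'.2 < 0 → τ μ = τ μ' → μ = μ' := by
  classical
  have hne : ∀ k : Fin 3, k + 1 ≠ k := by decide
  choose! σ hσ₁ hσ₂ using fun (l : Fin 3 × ℤ) (hl : l.2 < 0) => exists_axis hN hD hl
  -- The crossings above the level `N`, where `m` is unknown. There are finitely many, and choosing
  -- a crossing for each path will give an injective map of this set to itself.
  set H : Set (Fin 3 × ℤ) := {l | l.2 < 0 ∧ N < 2 * l.2 - 1} with hH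
  have hHf : H.Finite := by
    refine ((Set.finite_univ (α := Fin 3)).prod (Set.finite_Ioo (min N (-1) - 1) 0)).subset ?_
    rintro ⟨i, x⟩ ⟨h1, h2⟩
    simp only at h1 h2
    refine ⟨Set.mem_univ _, ?_, h1⟩
    simp only
    omega
  have hlow : ∀ l : Fin 3 × ℤ, l.2 < 0 → l ∉ H → ∀ n, n ≠ l.1 → OnPath m N l (axisNode n l).node := by
    intro l hl hlH n hn
    refine ⟨_, valid_axisNode hn hl, apex_axisNode hl, ?_, SimpleGraph.Reachable.refl _⟩
    rw [lev_axisNode]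
    by_contra hcon
    exact hlH ⟨hl, by omega⟩
  have hinj : Set.InjOn σ H := by
    intro l hl l' hl' h
    have h1 := hσ₂ l hl.1 _ (hne _)
    have h2 := hσ₂ l' hl'.1 _ (hne _)
    rw [← h] at h2
    exact h1.unique hN h2
  -- A crossing at or below the level `N` is on the path of the same name. If it were also on a path
  -- from `H`, the two paths would coincide, putting the crossing in `H`.
  have hmaps : Set.MapsTo σ H H := by
    intro l hl
    by_contra hcon
    have h1 := hσ₂ l hl.1 _ (hne _)
    have h2 := hlow _ (hσ₁ l hl.1) hcon _ (hne _)
    rw [← h1.unique hN h2] at hcon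
    exact hcon hl
  have hsurj : ∀ μ ∈ H, ∃ l, l ∈ H ∧ σ l = μ := by
    have h1 : σ '' H = H := Set.eq_of_subset_of_ncard_le hmaps.image_subset
      (by rw [hinj.ncard_image]) hHf
    exact fun μ hμ => h1.ge hμ
  choose! ρ hρ₁ hρ₂ using hsurj
  -- The path through a crossing: the inverse of the bijection on `H`, and the path of the same name
  -- below.
  refine ⟨fun μ => if μ ∈ H then ρ μ else μ, fun μ hμ => ?_, fun μ μ' hμ hμ' h => ?_⟩
  · by_cases h : μ ∈ H
    · simp only [if_pos h]
      have h1 := hσ₂ (ρ μ) (hρ₁ _ h).1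
      rw [hρ₂ _ h] at h1
      exact ⟨(hρ₁ _ h).1, h1⟩
    · simp only [if_neg h]
      exact ⟨hμ, hlow μ hμ h⟩
  · by_cases h1 : μ ∈ H <;> by_cases h2 : μ' ∈ H
    · simp only [if_pos h1, if_pos h2] at h
      rw [← hρ₂ _ h1, h, hρ₂ _ h2]
    · simp only [if_pos h1, if_neg h2] at h
      exact absurd (h ▸ hρ₁ _ h1) h2
    · simp only [if_neg h1, if_pos h2] at h
      exact absurd (h ▸ hρ₁ _ h2) h1
    · simpa only [if_neg h1, if_neg h2] using h

/-- A path visits all levels below its crossing with an axis in both sectors at this axis. -/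
theorem exists_onPath (hD : IsDoubleDimer orthant m) {τ : Fin 3 × ℤ → Fin 3 × ℤ}
    (hτ : ∀ μ, μ.2 < 0 → (τ μ).2 < 0 ∧ ∀ n, n ≠ μ.1 → OnPath m N (τ μ) (axisNode n μ).node)
    (hinj : ∀ μ μ', μ.2 < 0 → μ'.2 < 0 → τ μ = τ μ' → μ = μ') {μ : Fin 3 × ℤ} (hμ : μ.2 < 0)
    {n : Fin 3} (hn : n ≠ μ.1) {f : ℤ} (hf : f ≤ 2 * μ.2 - 1) :
    ∃ c : Coord, c.Valid ∧ c.n = n ∧ c.lev = f ∧ OnPath m N (τ μ) c.node := by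
  obtain ⟨hl, hax⟩ := hτ μ hμ
  set l := τ μ with hldef
  -- As `τ` is injective, `μ` is the only crossing on its path.
  have huniq : ∀ b : Coord, b.Valid → b = axisNode b.n b.apex → OnPath m N l b.node →
      b.apex = μ := by
    intro b hb h1 h2
    obtain ⟨h4, h5, -⟩ := apex_spec hb
    have h3 := (hτ b.apex h5).2 b.n h4
    rw [← h1] at h3
    exact hinj _ _ h5 hμ (h3.unique hN h2)
  -- The path has distant ends in both sectors other than `l.1`. Its only crossing does not touch
  -- the sector `μ.1`, so a path with an end there could never leave that sector. Hence `μ` and `l`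
  -- have the same axis.
  have hne : ∀ k, k ≠ l.1 → k ≠ μ.1 := by
    intro k hk hkμ
    have hk' := third_ne_right hk
    obtain ⟨c, hc, hcn, hca, hcl⟩ := exists_coord hk hl (min_le_right N (2 * l.2 - 1))
    obtain ⟨c', hc', hcn', hca', hcl'⟩ := exists_coord hk' hl (min_le_right N (2 * l.2 - 1))
    have hcN : c.lev ≤ N := hcl ▸ min_le_left _ _
    have hcN' : c'.lev ≤ N := hcl' ▸ min_le_left _ _
    have hr := (hN c c' hc hc' hcN hcN').2 (hca.trans hca'.symm)
    have key : ∃ c'' : Coord, c''.Valid ∧ c''.n = k ∧ c''.node = c'.node := by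
      refine reachable_induction (P := fun z => ∃ c'' : Coord, c''.Valid ∧ c''.n = k ∧
        c''.node = z) ⟨c, hc, hcn, rfl⟩ ?_ hr
      rintro _ z hy hyz ⟨b, hb, hbn, rfl⟩
      obtain ⟨b', hb', rfl, ⟨h2, -⟩ | ⟨h2, h3⟩⟩ := adj_step hD hb hyz
      · exact ⟨b', hb', h2.trans hbn, rfl⟩
      · exfalso
        have h6 := huniq b hb h2 ⟨c, hc, hca, hcN, hy⟩
        have h7 := (apex_spec hb).1
        rw [h6, hbn, hkμ] at h7
        exact h7 rfl
    obtain ⟨c'', hc'', h2, h3⟩ := key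
    rw [node_injective hc'' h3, hcn'] at h2
    exact third_ne_left hk h2
  have hlμ : l.1 = μ.1 := by
    by_contra hcon
    exact hne μ.1 (Ne.symm hcon) rfl
  have hnl : n ≠ l.1 := hlμ ▸ hn
  -- A starting level low enough for the path to agree with the initial one and to possess a node in
  -- the sector `n`, and not above the desired level `f`.
  set f₀ := min f (min N (2 * l.2 - 1)) with hf₀
  obtain ⟨c, hc, hcn, hca, hcl⟩ := exists_coord hnl hl
    (show f₀ ≤ 2 * l.2 - 1 from (min_le_right _ _).trans (min_le_right _ _))
  have hcN : c.lev ≤ N := hcl ▸ (min_le_right _ _).trans (min_le_left _ _)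
  have hr := (hax n hn).reachable hN hc hca hcN
  set R : ℤ → Prop := fun g => ∃ c : Coord, c.Valid ∧ c.n = n ∧ c.lev = g ∧ OnPath m N l c.node
    with hR
  -- A discrete intermediate value argument. While the path is in the sector `n`, all levels from
  -- `f₀` to the present one have been visited there; while it is elsewhere, it has left through
  -- `μ`, so all levels up to that of `μ` have been visited.
  have key : ∃ b : Coord, b.Valid ∧ b.node = (axisNode n μ).node ∧
      (∀ g, f₀ ≤ g → g ≤ (if b.n = n then b.lev else 2 * μ.2 - 1) → R g) := by
    refine reachable_induction (P := fun z => ∃ b : Coord, b.Valid ∧ b.node = z ∧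
      (∀ g, f₀ ≤ g → g ≤ (if b.n = n then b.lev else 2 * μ.2 - 1) → R g))
      ⟨c, hc, rfl, fun g hg hg' => ?_⟩ ?_ hr
    · rw [if_pos hcn] at hg'
      exact ⟨c, hc, hcn, by omega, c, hc, hca, hcN, SimpleGraph.Reachable.refl _⟩
    · rintro _ z hy hyz ⟨b, hb, rfl, hP⟩
      obtain ⟨b', hb', rfl, ⟨h2, h3⟩ | ⟨h2, h3⟩⟩ := adj_step hD hb hyz
      · refine ⟨b', hb', rfl, fun g hg hg' => ?_⟩
        rw [h2] at hg'
        by_cases hbn : b.n = n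
        · rw [if_pos hbn] at hg' hP
          by_cases hgb : g ≤ b.lev
          · exact hP g hg hgb
          · exact ⟨b', hb', h2.trans hbn, by omega, c, hc, hca, hcN, hy.trans hyz.reachable⟩
        · rw [if_neg hbn] at hg' hP
          exact hP g hg hg'
      · have h6 := huniq b hb h2 ⟨c, hc, hca, hcN, hy⟩
        refine ⟨b', hb', rfl, fun g hg hg' => hP g hg ?_⟩
        have h7 : b.lev = 2 * μ.2 - 1 := by rw [h2, lev_axisNode, h6]
        have h8 : b'.lev = 2 * μ.2 - 1 := by rw [h3, lev_axisNode, h6]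
        rw [h8, ite_self] at hg'
        rw [h7, ite_self]
        exact hg'
  obtain ⟨b, hb, h1, h2⟩ := key
  have h3 := node_injective hb h1
  refine h2 f (min_le_left _ _) ?_
  rw [h3, lev_axisNode]
  simpa [axisNode] using hf

/-- Each node is on a path, and each path visits a level of a sector at most once. -/
theorem onPath_spec (hD : IsDoubleDimer orthant m) :
    (∀ c : Coord, c.Valid → ∃ l : Fin 3 × ℤ, l.2 < 0 ∧ OnPath m N l c.node) ∧
    ∀ c c' : Coord, c.Valid → c'.Valid → c.n = c'.n → c.lev = c'.lev →
      (singleGraph m).Reachable c.node c'.node → c = c' := by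
  obtain ⟨τ, hτ, hinj⟩ := exists_crossing_bijection hN hD
  have h1 : ∀ c : Coord, c.Valid → ∃ b : Coord, b.Valid ∧ b.n = c.n ∧ b.lev = c.lev ∧
      OnPath m N (τ c.apex) b.node := by
    intro c hc
    obtain ⟨h2, h3, h4⟩ := apex_spec hc
    exact exists_onPath hN hD hτ hinj h3 h2 h4
  choose! ψ hψ hψn hψl hψp using h1
  -- A level of a sector has finitely many nodes, one for each path of the initial configuration
  -- visiting it. The map `ψ` sends them injectively to nodes of the same level and sector on
  -- distinct paths of `m`, so it is a bijection.
  have hsurj : ∀ c : Coord, c.Valid → ∃ b : Coord, b.Valid ∧ b.n = c.n ∧ b.lev = c.lev ∧ ψ b = c := by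
    intro c hc
    set F : Set Coord := {b | b.Valid ∧ b.n = c.n ∧ b.lev = c.lev} with hF
    have hFf : F.Finite := by
      have hinjF : Set.InjOn apex F := fun b hb b' hb' h =>
        eq_of_apex_eq hb.1 hb'.1 (hb.2.1.trans hb'.2.1.symm) h (hb.2.2.trans hb'.2.2.symm)
      refine Set.Finite.of_finite_image (((Set.finite_univ (α := Fin 3)).prod
        (Set.finite_Ioo (c.lev - 1) 0)).subset ?_) hinjF
      rintro _ ⟨b, hb, rfl⟩
      obtain ⟨-, h3, h4⟩ := apex_spec hb.1
      rw [hb.2.2] at h4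
      refine ⟨Set.mem_univ _, ?_, h3⟩
      have := (apex_spec hc).2
      omega
    have hmaps : Set.MapsTo ψ F F := fun b hb =>
      ⟨hψ b hb.1, (hψn b hb.1).trans hb.2.1, (hψl b hb.1).trans hb.2.2⟩
    have hinjF : Set.InjOn ψ F := by
      intro b hb b' hb' h
      have h2 := hψp b hb.1
      rw [h] at h2
      exact eq_of_apex_eq hb.1 hb'.1 (hb.2.1.trans hb'.2.1.symm)
        (hinj _ _ (apex_spec hb.1).2.1 (apex_spec hb'.1).2.1 (h2.unique hN (hψp b' hb'.1)))
        (hb.2.2.trans hb'.2.2.symm)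
    have h2 : ψ '' F = F := Set.eq_of_subset_of_ncard_le hmaps.image_subset
      (by rw [hinjF.ncard_image]) hFf
    have h3 : c ∈ ψ '' F := by rw [h2]; exact ⟨hc, rfl, rfl⟩
    obtain ⟨b, hb, hbc⟩ := h3
    exact ⟨b, hb.1, hb.2.1, hb.2.2, hbc⟩
  constructor
  · intro c hc
    obtain ⟨b, hb, -, -, rfl⟩ := hsurj c hc
    exact ⟨τ b.apex, (hτ _ (apex_spec hb).2.1).1, hψp b hb⟩
  · intro c c' hc hc' hn hl hr
    obtain ⟨b, hb, h1, h2, rfl⟩ := hsurj c hc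
    obtain ⟨b', hb', h1', h2', rfl⟩ := hsurj c' hc'
    have h3 := ((hψp b hb).trans hr).unique hN (hψp b' hb')
    rw [eq_of_apex_eq hb hb' (h1.symm.symm.trans (hn.trans h1'.symm))
      (hinj _ _ (apex_spec hb).2.1 (apex_spec hb').2.1 h3) (h2.trans (hl.trans h2'.symm))]

/-- Every node is on a path, hence not on a doubled edge. The edge to the flat neighbour cannot be
single, because it stays on the same level of the same sector. So the two single edges at each node
are those of the initial configuration. -/
theorem eq_initialConfig (hD : IsDoubleDimer orthant m) : m = initialConfig := by
  classical
  obtain ⟨hpath, huniq⟩ := onPath_spec hN hD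
  have key : ∀ c : Coord, c.Valid → m s(c.node, c.quad.node) = 1 ∧ m s(c.node, c.leg.node) = 1 ∧
      m s(c.node, c.flat.node) = 0 := by
    intro c hc
    have hadj : ∃ z, (singleGraph m).Adj c.node z := by
      obtain ⟨l, hl, hp⟩ := hpath c hc
      have h1 : ∀ k : Fin 3, k + 1 ≠ k := by decide
      obtain ⟨b, hb, -, hba, hbl⟩ := exists_coord (h1 l.1) hl
        (show min (c.lev - 1) (min N (2 * l.2 - 1)) ≤ 2 * l.2 - 1 from
          (min_le_right _ _).trans (min_le_right _ _))
      refine exists_adj_of_reachable (hp.reachable hN hb hba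
        (hbl ▸ (min_le_right _ _).trans (min_le_left _ _))).symm fun h => ?_
      have h2 := node_injective hc h
      rw [← h2] at hbl
      omega
    have hflat : m s(c.node, c.flat.node) ≠ 1 := by
      intro hcon
      have h1 : (singleGraph m).Adj c.node c.flat.node :=
        ⟨((graph orthant).mem_edgeSet.1 (mem_edgeSet_flat hc)).ne, hcon⟩
      have h2 := huniq c c.flat hc (valid_flat hc) rfl (lev_flat c).symm h1.reachable
      exact hc.p_ne_d (congrArg Coord.d h2).symm
    obtain ⟨M₁, M₂, h₁, h₂, rfl⟩ := hD
    obtain ⟨E₁, ⟨hE₁, hcE₁⟩, hu₁⟩ := h₁.2 _ (node_mem hc)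
    obtain ⟨E₂, ⟨hE₂, hcE₂⟩, hu₂⟩ := h₂.2 _ (node_mem hc)
    have hval : ∀ E, c.node ∈ E → (M₁.indicator 1 + M₂.indicator 1 : Sym2 Node → ℕ) E =
        (if E = E₁ then 1 else 0) + if E = E₂ then 1 else 0 := by
      intro E hE
      have e₁ : E ∈ M₁ ↔ E = E₁ := ⟨fun h => hu₁ E ⟨h, hE⟩, fun h => h ▸ hE₁⟩
      have e₂ : E ∈ M₂ ↔ E = E₂ := ⟨fun h => hu₂ E ⟨h, hE⟩, fun h => h ▸ hE₂⟩
      simp only [Pi.add_apply, Set.indicator_apply, Pi.one_apply, e₁, e₂]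
    have hne : E₁ ≠ E₂ := by
      rintro rfl
      obtain ⟨z, -, hz⟩ := hadj
      rw [hval _ (Sym2.mem_mk_left _ _)] at hz
      split_ifs at hz <;> omega
    rw [hval _ (Sym2.mem_mk_left _ _)] at hflat
    rw [hval _ (Sym2.mem_mk_left _ _), hval _ (Sym2.mem_mk_left _ _),
      hval _ (Sym2.mem_mk_left _ _)]
    obtain ⟨z₁, rfl⟩ := Sym2.mem_iff_exists.1 hcE₁
    obtain ⟨z₂, rfl⟩ := Sym2.mem_iff_exists.1 hcE₂
    have hz₁ := (graph_adj_iff hc).1 (h₁.1 hE₁)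
    have hz₂ := (graph_adj_iff hc).1 (h₂.1 hE₂)
    have q₁ := quad_node_ne_leg_node hc
    have q₂ := flat_node_ne_leg_node hc
    have q₃ := flat_node_ne_quad_node hc
    simp only [Sym2.congr_right, ne_eq] at hflat hne ⊢
    rcases hz₁ with rfl | rfl | rfl <;> rcases hz₂ with rfl | rfl | rfl <;>
      simp_all [eq_comm]
  funext E
  by_cases hE : E ∈ (graph orthant).edgeSet
  · induction E using Sym2.ind with
    | h x z =>
      obtain ⟨c, hc, rfl⟩ := exists_of_mem_nodes ((graph orthant).mem_edgeSet.1 hE).1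
      obtain ⟨k1, k2, k3⟩ := key c hc
      rcases (graph_adj_iff hc).1 hE with rfl | rfl | rfl
      · rw [k1, initialConfig_quad hc]
      · rw [k3, initialConfig_flat hc]
      · rw [k2, initialConfig_leg hc]
  · rw [hD.eq_zero hE, initialConfig_eq_zero hE]

end Path

end Coord

/-- The exceptional set is finite, so below some level all nodes avoid it. There the paths are those
of the initial configuration, as `Coord.eq_initialConfig` requires. -/
theorem tautConfigs_orthant : tautConfigs orthant = {initialConfig} := by
  ext m
  rw [Set.mem_singleton_iff]
  constructor
  · intro hm
    obtain ⟨hD, S, hS, -, hR⟩ := (isTaut_iff infinite_initialConfig).1 hm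
    have h1 : {c : Coord | c.Valid ∧ c.node ∈ S}.Finite := by
      refine Set.Finite.of_finite_image (f := Coord.node) (hS.subset ?_)
        fun c hc c' _ h => Coord.node_injective hc.1 h
      rintro _ ⟨c, hc, rfl⟩
      exact hc.2
    obtain ⟨b, hb⟩ := (h1.image Coord.lev).bddBelow
    refine Coord.eq_initialConfig (N := b - 1) ?_ hD
    have h2 : ∀ c : Coord, c.Valid → c.lev ≤ b - 1 → c.node ∉ S := by
      intro c hc hl hcS
      have := hb ⟨c, ⟨hc, hcS⟩, rfl⟩
      omega
    intro c c' hc hc' hl hl'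
    rw [hR _ (h2 c hc hl) _ (h2 c' hc' hl'), Coord.reachable_iff_apex_eq hc hc']
  · rintro rfl
    exact isTaut_initialConfig

/-! ### The weight of the initial configuration -/

theorem initialConfig_le_one (E : Sym2 Node) : initialConfig E = 0 ∨ initialConfig E = 1 := by
  classical
  rw [initialConfig, Set.indicator_apply]
  split_ifs <;> simp

/-- All multiplicities are `0` or `1`, so edges minus dimers counts the empty edges of the face. -/
theorem faceExponent_initialConfig {l : Label} (hf : (faceEdges orthant l).Finite) :
    faceExponent orthant initialConfig l =
      ({E | E ∈ faceEdges orthant l ∧ initialConfig E = 0}.ncard : ℤ) - 2 := by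
  classical
  have h1 : {E | E ∈ faceEdges orthant l ∧ initialConfig E = 0} =
      ((hf.toFinset.filter fun E => initialConfig E = 0 : Finset (Sym2 Node)) : Set (Sym2 Node)) := by
    ext E; simp
  rw [faceExponent, h1, Set.ncard_coe_finset, Set.ncard_eq_toFinset_card _ hf,
    finsum_mem_eq_finite_toFinset_sum _ hf, Finset.card_filter, Finset.card_eq_sum_ones]
  push_cast
  have h2 : ∑ E ∈ hf.toFinset, (initialConfig E : ℤ) =
      ∑ E ∈ hf.toFinset, (1 - if initialConfig E = 0 then 1 else 0 : ℤ) := by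
    refine Finset.sum_congr rfl fun E _ => ?_
    rcases initialConfig_le_one E with h | h <;> simp [h]
  rw [h2, Finset.sum_sub_distrib]
  ring

namespace Coord

variable {c c' : Coord}

theorem eq_of_square_eq (hc : c.Valid) (hc' : c'.Valid) (h : c'.square = c.square) :
    (c' = c ∨ c' = c.flat) ∨ c' = c.quad ∨ c' = c.quad.flat := by
  obtain ⟨n, d, x, y, b⟩ := c
  obtain ⟨n', d', x', y', b'⟩ := c'
  have hne : n ≠ d := hc.ne
  have hne' : n' ≠ d' := hc'.ne
  have h1 : n' = n := congrArg Square.normal h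
  subst h1
  have hpd : third n' d ≠ d := third_ne_right hne
  have h5 : vec2 d' (third n' d') x' y' = vec2 d (third n' d) x y := congrArg Square.base h
  by_cases hd : d' = d
  · subst hd
    rw [vec2_inj hpd] at h5
    obtain ⟨rfl, rfl⟩ := h5
    by_cases hb : b' = b
    · subst hb; exact Or.inl (Or.inl rfl)
    · right; right
      have : b' = !b := Bool.eq_not_of_ne hb
      subst this
      exact Coord.ext rfl (third_third hne).symm rfl rfl rfl
  · have hd' : d' = third n' d := eq_of_ne_ne hne hne'.symm hd
    subst hd'
    rw [third_third hne, vec2_swap hpd, vec2_inj hpd] at h5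
    obtain ⟨rfl, rfl⟩ := h5
    by_cases hb : b' = b
    · subst hb; exact Or.inl (Or.inr rfl)
    · have : b' = !b := Bool.eq_not_of_ne hb
      subst this; exact Or.inr (Or.inl rfl)

/-- The edge from a node to its flat neighbour. -/
def flatEdge (c : Coord) : Sym2 Node := s(c.node, c.flat.node)

theorem flatEdge_flat (hc : c.Valid) : c.flat.flatEdge = c.flatEdge := by
  rw [flatEdge, flatEdge, flat_flat hc, Sym2.eq_swap]

theorem flatEdge_inj (hc : c.Valid) : c.flatEdge = c'.flatEdge → c' = c ∨ c' = c.flat := by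
  intro h
  have : c'.node ∈ c.flatEdge := by rw [h]; exact Sym2.mem_mk_left _ _
  rcases Sym2.mem_iff.1 this with h | h
  · exact Or.inl (node_injective hc h.symm).symm
  · exact Or.inr (node_injective (valid_flat hc) h.symm).symm

theorem initialConfig_eq_zero_iff {E : Sym2 Node} (hE : E ∈ (graph orthant).edgeSet) :
    initialConfig E = 0 ↔ ∃ c : Coord, c.Valid ∧ c.flatEdge = E := by
  constructor
  · intro h
    induction E using Sym2.ind with
    | h x z =>
      obtain ⟨c, hc, rfl⟩ := exists_of_mem_nodes ((graph orthant).mem_edgeSet.1 hE).1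
      rcases (graph_adj_iff hc).1 hE with rfl | rfl | rfl
      · rw [initialConfig_quad hc] at h; exact absurd h one_ne_zero
      · exact ⟨c, hc, rfl⟩
      · rw [initialConfig_leg hc] at h; exact absurd h one_ne_zero
  · rintro ⟨c, hc, rfl⟩
    exact initialConfig_flat hc

theorem exists_of_mem_surface {Q : Square} (hQ : Q ∈ surface orthant) :
    ∃ c : Coord, c.Valid ∧ c.square = Q := by
  have h1 : ∀ n : Fin 3, n + 1 ≠ n := by decide
  obtain ⟨c, hc, h⟩ := exists_of_mem_nodes (z := (Q, ⟨Q.normal + 1, Q.base⟩))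
    ⟨hQ, (isSide_iff _ _).2 ⟨h1 _, Or.inl rfl⟩⟩
  exact ⟨c, hc, congrArg Prod.fst h⟩

/-- Exactly two edges of a quadrilateral are empty, those facing the nearest and the farthest
corner. -/
theorem faceExponent_face {Q : Square} (hQ : Q ∈ surface orthant) :
    faceExponent orthant initialConfig (.face Q) = 0 := by
  obtain ⟨c, hc, rfl⟩ := exists_of_mem_surface hQ
  have hq := valid_quad hc
  have hmem : ∀ z ∈ nodes orthant, z.1 = c.square →
      z = c.node ∨ z = c.flat.node ∨ z = c.quad.node ∨ z = c.quad.flat.node := by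
    intro z hz h
    obtain ⟨c', hc', rfl⟩ := exists_of_mem_nodes hz
    rcases eq_of_square_eq hc hc' h with (rfl | rfl) | rfl | rfl <;> simp
  have hfin : (faceEdges orthant (.face c.square)).Finite := by
    refine (Set.toFinite ((fun p : Node × Node => s(p.1, p.2)) ''
      (({c.node, c.flat.node, c.quad.node, c.quad.flat.node} : Set Node) ×ˢ
      ({c.node, c.flat.node, c.quad.node, c.quad.flat.node} : Set Node)))).subset ?_
    rintro E ⟨hE, h⟩
    induction E using Sym2.ind with
    | h x z =>
      obtain ⟨hx, hz, -⟩ := (graph orthant).mem_edgeSet.1 hE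
      exact ⟨(x, z), ⟨hmem x hx (h x (Sym2.mem_mk_left x z)),
        hmem z hz (h z (Sym2.mem_mk_right x z))⟩, rfl⟩
  have hset : {E | E ∈ faceEdges orthant (.face c.square) ∧ initialConfig E = 0} =
      {c.flatEdge, c.quad.flatEdge} := by
    ext E
    constructor
    · rintro ⟨⟨hE, h⟩, h0⟩
      obtain ⟨c', hc', rfl⟩ := (initialConfig_eq_zero_iff hE).1 h0
      rcases eq_of_square_eq hc hc' (h c'.node (Sym2.mem_mk_left _ _)) with (rfl | rfl) | rfl | rfl
      · exact Or.inl rfl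
      · exact Or.inl (flatEdge_flat hc)
      · exact Or.inr rfl
      · exact Or.inr (flatEdge_flat hq)
    · have key : ∀ b : Coord, b.Valid → b.square = c.square →
          b.flatEdge ∈ {E | E ∈ faceEdges orthant (.face c.square) ∧ initialConfig E = 0} :=
        fun b hb h => ⟨⟨mem_edgeSet_flat hb, forall_mem_mk.2 ⟨h, (square_flat hb).trans h⟩⟩,
          initialConfig_flat hb⟩
      rintro (rfl | rfl)
      · exact key c hc rfl
      · exact key c.quad hq (square_quad hc)
  rw [faceExponent_initialConfig hfin, hset, Set.ncard_pair]
  · norm_num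
  · intro h
    rcases flatEdge_inj hc h with h1 | h1 <;> have h2 := congrArg Coord.h h1 <;>
      simp [quad, flat] at h2

/-- The corner faced by the edge from a node to its flat neighbour. -/
theorem mem_ends_flat (hc : c.Valid) {w : Vec} : (w ∈ c.side.ends ∧ w ∈ c.flat.side.ends) ↔
    w = vec2 c.d c.p (c.x + bit c.h) (c.y + bit c.h) := by
  have hp := hc.p_ne_d
  rw [side_flat hc]
  change (w = vec2 c.d c.p c.x (c.y + bit c.h) ∨ w = vec2 c.d c.p c.x (c.y + bit c.h) + e c.d) ∧
    (w = vec2 c.d c.p (c.x + bit c.h) c.y ∨ w = vec2 c.d c.p (c.x + bit c.h) c.y + e c.p) ↔ _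
  rw [vec2_add_left hp, vec2_add_right hp]
  have hw : ∀ x y x' y' : ℤ, (vec2 c.d c.p x y = vec2 c.d c.p x' y' ↔ x = x' ∧ y = y') :=
    fun _ _ _ _ => vec2_inj hp
  have key : ∀ x y b : ℤ, b = 0 ∨ b = 1 →
      ((w = vec2 c.d c.p x (y + b) ∨ w = vec2 c.d c.p (x + 1) (y + b)) ∧
        (w = vec2 c.d c.p (x + b) y ∨ w = vec2 c.d c.p (x + b) (y + 1)) ↔
        w = vec2 c.d c.p (x + b) (y + b)) := by
    intro x y b hb
    constructor
    · rintro ⟨rfl | rfl, h2⟩ <;> simp only [hw, and_true] at h2 ⊢ <;>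
        rcases hb with rfl | rfl <;> clear hp hw <;> omega
    · rintro rfl
      simp only [hw, and_true, true_and]
      rcases hb with rfl | rfl <;> simp
  refine key c.x c.y (bit c.h) ?_
  rcases bit_cases c.h with ⟨-, hb⟩ | ⟨-, hb⟩
  exacts [Or.inl hb, Or.inr hb]

/-- The nodes next to a corner of the given type at the lattice point `w`. -/
def cornerCoord (w : Vec) (q : Fin 3 × Bool) : Coord :=
  ⟨q.1, q.1 + 1, w (q.1 + 1) - bit q.2, w (q.1 + 2) - bit q.2, q.2⟩

-- The empty edges at `w` correspond to the squares of which `w` is the nearest or the farthest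
-- corner. There are three at the origin, and two at every other vertex, whether on an axis or in
-- the interior of a coordinate plane.
open Classical in
theorem faceExponent_vertex {w : Vec} (hw : Label.vertex w ∈ labels orthant) :
    faceExponent orthant initialConfig (.vertex w) = if w = 0 then 1 else 0 := by
  have hf3 : ∀ n : Fin 3, n ≠ n + 1 ∧ third n (n + 1) = n + 2 ∧ n + 2 ≠ n ∧ n + 2 ≠ n + 1 := by decide
  obtain ⟨hw0, hex⟩ : (∀ i, w i ≤ 0) ∧ ∃ i, w i = 0 := by
    obtain ⟨Q, hQ, hwQ⟩ := hw
    obtain ⟨h0, h1⟩ := square_base_of_mem hQ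
    have h2 := hwQ.1
    rw [h0] at h2
    refine ⟨fun i => ?_, Q.normal, h2⟩
    by_cases hi : i = Q.normal
    · rw [hi, h2]
    · have := h1 i hi
      rcases hwQ.2 i hi with h3 | h3 <;> omega
  have hfin : (faceEdges orthant (.vertex w)).Finite := by
    refine (finite_faceCond_vertex w).subset ?_
    rintro E ⟨hE, h⟩
    refine ⟨h, fun x hx => ?_⟩
    induction E using Sym2.ind with
    | h x z =>
      obtain ⟨hx', hz', -⟩ := (graph orthant).mem_edgeSet.1 hE
      rcases Sym2.mem_iff.1 hx with rfl | rfl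
      exacts [hx'.2, hz'.2]
  -- A pair gives the normal of the square and whether `w` is its nearest corner. If `w` is the
  -- farthest corner, the square extends towards the origin, so the other two coordinates must be
  -- nonzero.
  set I : Finset (Fin 3 × Bool) := Finset.univ.filter fun q =>
    w q.1 = 0 ∧ (q.2 = false → ∀ i, i ≠ q.1 → w i ≠ 0) with hI
  have hvalid : ∀ q ∈ I, (cornerCoord w q).Valid := by
    rintro ⟨n, h⟩ hq
    obtain ⟨-, hq0, hq1⟩ := Finset.mem_filter.1 hq
    obtain ⟨k1, k2, k3, k4⟩ := hf3 n
    have a1 := hw0 (n + 1)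
    have a2 := hw0 (n + 2)
    refine ⟨k1, ?_, ?_⟩ <;> cases h <;> simp only [cornerCoord, bit_true, bit_false]
    · have := hq1 rfl (n + 1) k1.symm; omega
    · omega
    · have := hq1 rfl (n + 2) k3; omega
    · omega
  have hwI : ∀ q ∈ I, w = vec2 (cornerCoord w q).d (cornerCoord w q).p
      ((cornerCoord w q).x + bit (cornerCoord w q).h)
      ((cornerCoord w q).y + bit (cornerCoord w q).h) := by
    rintro ⟨n, h⟩ hq
    obtain ⟨-, hq0, -⟩ := Finset.mem_filter.1 hq
    obtain ⟨k1, k2, k3, k4⟩ := hf3 n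
    simp only [cornerCoord, p, k2, sub_add_cancel]
    refine vec_ext k1 ?_ ?_ ?_
    · rw [vec2_other k1 k3.symm]; exact hq0
    · rw [vec2_left]
    · rw [k2, vec2_right k4]
  have hset : {E | E ∈ faceEdges orthant (.vertex w) ∧ initialConfig E = 0} =
      (fun q => (cornerCoord w q).flatEdge) '' (I : Set (Fin 3 × Bool)) := by
    ext E
    constructor
    · rintro ⟨⟨hE, h⟩, h0⟩
      obtain ⟨c, hc, rfl⟩ := (initialConfig_eq_zero_iff hE).1 h0
      have h1 := (mem_ends_flat hc).1 (forall_mem_mk.1 h)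
      have hne := hc.ne
      have hpn := hc.p_ne_n
      have hpd := hc.p_ne_d
      have wd : w c.d = c.x + bit c.h := by rw [h1, vec2_left]
      have wp : w c.p = c.y + bit c.h := by rw [h1, vec2_right hpd]
      have wn : w c.n = 0 := by rw [h1, vec2_other hne hpn.symm]
      refine ⟨(c.n, c.h), ?_, ?_⟩
      · refine Finset.mem_coe.2 (Finset.mem_filter.2 ⟨Finset.mem_univ _, wn, fun hh i hi => ?_⟩)
        simp only at hh hi
        rw [hh, bit_false, add_zero] at wd wp
        by_cases hid : i = c.d
        · rw [hid, wd]; exact hc.x_neg.ne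
        · rw [eq_of_ne_ne hne hi hid]
          change w c.p ≠ 0
          rw [wp]; exact hc.y_neg.ne
      · obtain ⟨k1, k2, k3, k4⟩ := hf3 c.n
        have h2 : c.d = c.n + 1 ∨ c.d = c.n + 2 := by
          have : ∀ n d : Fin 3, n ≠ d → d = n + 1 ∨ d = n + 2 := by decide
          exact this _ _ hne
        rcases h2 with h2 | h2
        · have h3 : c.p = c.n + 2 := by rw [p, h2, k2]
          have : cornerCoord w (c.n, c.h) = c := by
            refine Coord.ext rfl h2.symm ?_ ?_ rfl
            · simp only [cornerCoord]; rw [← h2, wd]; ring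
            · simp only [cornerCoord]; rw [← h3, wp]; ring
          simp only [this]
        · have h3 : c.p = c.n + 1 := by
            have : ∀ n : Fin 3, third n (n + 2) = n + 1 := by decide
            rw [p, h2, this]
          have : cornerCoord w (c.n, c.h) = c.flat := by
            refine Coord.ext rfl h3.symm ?_ ?_ rfl
            · simp only [cornerCoord, flat]; rw [← h3, wp]; ring
            · simp only [cornerCoord, flat]; rw [← h2, wd]; ring
          simp only [this, flatEdge_flat hc]
    · rintro ⟨q, hq, rfl⟩
      have hv := hvalid q hq
      exact ⟨⟨mem_edgeSet_flat hv, forall_mem_mk.2 ((mem_ends_flat hv).2 (hwI q hq))⟩,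
        initialConfig_flat hv⟩
  have hinj : Set.InjOn (fun q => (cornerCoord w q).flatEdge) (I : Set (Fin 3 × Bool)) := by
    rintro ⟨n, h⟩ hq ⟨n', h'⟩ - heq
    rcases flatEdge_inj (hvalid _ hq) heq with h1 | h1
    · exact Prod.ext (congrArg Coord.n h1).symm (congrArg Coord.h h1).symm
    · exact Prod.ext (congrArg Coord.n h1).symm (congrArg Coord.h h1).symm
  have hcard : ∀ b : Fin 3 → Bool, (∃ i, b i = true) →
      (Finset.univ.filter fun q : Fin 3 × Bool =>
        b q.1 = true ∧ (q.2 = false → ∀ i, i ≠ q.1 → b i = false)).card =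
      if ∀ i, b i = true then 3 else 2 := by decide +kernel
  have hI' : I.card = if w = 0 then 3 else 2 := by
    have h1 := hcard (fun i => decide (w i = 0)) (by simpa using hex)
    have h2 : (∀ i, decide (w i = 0) = true) ↔ w = 0 := by
      simp only [decide_eq_true_eq]
      exact ⟨fun h => funext h, fun h i => by rw [h]; rfl⟩
    simp only [h2] at h1
    rw [← h1, hI]
    congr 1
    ext q
    simp
  rw [faceExponent_initialConfig hfin, hset, hinj.ncard_image, Set.ncard_coe_finset, hI']
  split_ifs <;> norm_num

end Coord

theorem faceExponent_orthant {l : Label} (hl : l ∈ labels orthant) (h0 : l ≠ .vertex 0) :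
    faceExponent orthant initialConfig l = 0 := by
  cases l with
  | vertex w =>
    rw [Coord.faceExponent_vertex hl, if_neg fun h => h0 (by rw [h])]
  | face Q => exact Coord.faceExponent_face hl

theorem zero_mem_labels_orthant : Label.vertex 0 ∈ labels orthant := by
  have key : ∀ i : Fin 3, (-(e 0 + e 1 + e 2) : Vec) i = -1 := by decide +kernel
  refine ⟨⟨0, -(e 0 + e 1 + e 2) + e 0⟩, ⟨fun i => ?_, fun h => ?_⟩, ?_, fun i hi => Or.inr ?_⟩
  · simp only [add_sub_cancel_right]
    rw [key]; norm_num
  · have : (-(e 0 + e 1 + e 2) + e 0 : Vec) 0 < 0 := h 0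
    rw [Pi.add_apply, key, e_same] at this
    norm_num at this
  · change (0 : ℤ) = (-(e 0 + e 1 + e 2) + e 0 : Vec) 0
    rw [Pi.add_apply, key, e_same]; rfl
  · change i ≠ 0 at hi
    change (0 : ℤ) = (-(e 0 + e 1 + e 2) + e 0 : Vec) i + 1
    rw [Pi.add_apply, key, e_of_ne hi]; rfl

theorem loopCount_initialConfig : loopCount initialConfig = 0 := by
  suffices h : loopSets initialConfig = ∅ by rw [loopCount_eq, h, Set.ncard_empty]
  rw [Set.eq_empty_iff_forall_notMem]
  rintro _ ⟨x, rfl, hf, hn⟩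
  obtain ⟨y, hxy⟩ := nontrivial_iff_exists_adj.1 hn
  have h1 : s(x, y) ∈ (graph orthant).edgeSet := by
    by_contra hcon
    have := Coord.initialConfig_eq_zero hcon
    rw [hxy.2] at this
    exact one_ne_zero this
  exact infinite_initialConfig x ((graph orthant).mem_edgeSet.1 h1).1 hf

theorem hasFiniteExponents_orthant : HasFiniteExponents orthant := by
  intro m hm
  rw [tautConfigs_orthant, Set.mem_singleton_iff] at hm
  subst hm
  refine (Set.finite_singleton (Label.vertex 0)).subset ?_
  rintro l ⟨hl, h⟩
  by_contra hcon
  exact h (faceExponent_orthant hl hcon)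

theorem tautSum_orthant {F : Type*} [Field F] (A : Label → F) :
    ∑ᶠ m ∈ tautConfigs orthant, 2 ^ loopCount m * faceWeight orthant A m = A (.vertex 0) := by
  classical
  rw [tautConfigs_orthant, finsum_mem_singleton, loopCount_initialConfig, pow_zero, one_mul,
    faceWeight, finprod_eq_single _ (Label.vertex 0)]
  · rw [finprod_eq_if, if_pos zero_mem_labels_orthant,
      Coord.faceExponent_vertex zero_mem_labels_orthant, if_pos rfl, zpow_one]
  · intro l hl
    rw [finprod_eq_if]
    split_ifs with h
    · rw [faceExponent_orthant h hl, zpow_zero]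
    · rfl

end Hexahedron
end

noncomputable section

namespace Hexahedron

/-! ### Removing cubes one at a time -/

section Solids

variable {U : Set Vec} {v : Vec}

/-- A minimal removed cube has all its predecessors in `U`, so putting it back gives a lower set
again. -/
theorem IsSolid.exists_isCorner (hU : IsSolid U) (hne : U ≠ orthant) :
    ∃ v ∈ orthant, IsCorner U v ∧ IsSolid (insert v U) := by
  have hex : (orthant \ U).Nonempty := by
    rw [Set.nonempty_iff_ne_empty]
    intro h
    exact hne (hU.subset.antisymm (Set.sdiff_eq_empty.1 h))
  obtain ⟨v, hv⟩ := hU.cofinite.exists_minimal hex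
  have hlt : ∀ u, u ≤ v → u ≠ v → u ∈ U := by
    intro u hu huv
    by_contra hcon
    exact huv (hu.antisymm (hv.2 ⟨fun i => (hu i).trans_lt (hv.1.1 i), hcon⟩ hu))
  have hcorner : IsCorner U v := by
    refine ⟨hU.lower, hv.1.2, fun i => hlt _ (sub_le_self v (e_nonneg i)) fun h => ?_⟩
    have := congrFun h i
    rw [Pi.sub_apply, e_same] at this
    omega
  refine ⟨v, hv.1.1, hcorner, ?_, ?_, ?_⟩
  · rintro a b hab (rfl | ha)
    · by_cases hb : b = a
      · exact Or.inl hb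
      · exact Or.inr (hlt b hab hb)
    · exact Or.inr (hU.lower hab ha)
  · rintro u (rfl | hu)
    exacts [hv.1.1, hU.subset hu]
  · exact hU.cofinite.subset (Set.sdiff_subset_sdiff_right (Set.subset_insert v U))

/-- Solids are obtained from the orthant by removing cubes one at a time. -/
theorem IsSolid.induction {p : Set Vec → Prop} (horthant : p orthant)
    (hremove : ∀ U v, v ∈ orthant → IsCorner U v → p (insert v U) → p U) (hU : IsSolid U) :
    p U := by
  suffices h : ∀ n (U : Set Vec), IsSolid U → (orthant \ U).ncard = n → p U from h _ U hU rfl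
  intro n
  induction n using Nat.strong_induction_on with
  | _ n ih =>
    intro U hU hn
    by_cases hne : U = orthant
    · rwa [hne]
    obtain ⟨v, hv, hc, hs⟩ := hU.exists_isCorner hne
    refine hremove U v hv hc (ih _ ?_ _ hs rfl)
    rw [← hn]
    refine Set.ncard_lt_ncard ?_ hU.cofinite
    refine ⟨Set.sdiff_subset_sdiff_right (Set.subset_insert v U), fun h => ?_⟩
    exact (h ⟨hv, hc.notMem⟩).2 (Set.mem_insert v U)

theorem labels_insert (h : IsCorner U v) :
    labels (insert v U) = commonLabels U v ∪ Set.range (patchLabel false v) :=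
  labels_patchSolid h false

theorem labels_of_isCorner (h : IsCorner U v) :
    labels U = commonLabels U v ∪ Set.range (patchLabel true v) :=
  labels_patchSolid h true

theorem tautConfigs_finite (hU : IsSolid U) : (tautConfigs U).Finite := by
  refine hU.induction (p := fun U => (tautConfigs U).Finite) ?_ fun U v _ hc ih =>
    tautConfigs_finite_exchange infinite_initialConfig (facePatchPair hc).toPatchPair ih
  rw [tautConfigs_orthant]
  exact Set.finite_singleton _

theorem hasFiniteExponents (hU : IsSolid U) : HasFiniteExponents U :=
  hU.induction hasFiniteExponents_orthant fun _ _ _ hc ih =>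
    hasFiniteExponents_exchange infinite_initialConfig (facePatchPair hc) ih

end Solids

/-! ### Positive solutions of the recurrence -/

/-- A set of nonzero elements which is closed under addition, multiplication and inversion. -/
structure IsPositiveCone {F : Type*} [Field F] (P : Set F) : Prop where
  zero_notMem : 0 ∉ P
  add_mem : ∀ {a b}, a ∈ P → b ∈ P → a + b ∈ P
  mul_mem : ∀ {a b}, a ∈ P → b ∈ P → a * b ∈ P
  inv_mem : ∀ {a}, a ∈ P → a⁻¹ ∈ P

section Positive

variable {F : Type*} [Field F] {P : Set F}

theorem IsPositiveCone.ne_zero (hP : IsPositiveCone P) {a : F} (ha : a ∈ P) : a ≠ 0 :=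
  fun h => hP.zero_notMem (h ▸ ha)

theorem IsPositiveCone.pow_two_mem (hP : IsPositiveCone P) {a : F} (ha : a ∈ P) : a ^ 2 ∈ P := by
  rw [pow_two]
  exact hP.mul_mem ha ha

theorem IsPositiveCone.mem_of_mul_mem (hP : IsPositiveCone P) {a b : F} (hb : b ∈ P)
    (hab : a * b ∈ P) : a ∈ P := by
  have := hP.mul_mem hab (hP.inv_mem hb)
  rwa [mul_assoc, mul_inv_cancel₀ (hP.ne_zero hb), mul_one] at this

/-- Each upper value times a product of lower values is a sum of products of lower values, with the
coefficient `2` read as a repeated summand; no subtraction occurs. -/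
theorem IsPositiveCone.mem_of_patchRecurrence (hP : IsPositiveCone P) {a a' : Fin 10 → F}
    (h : PatchRecurrence a a') (ha' : ∀ i, a' i ∈ P) (i : Fin 10) : a i ∈ P := by
  obtain ⟨h0, h6, h7, h8, h9⟩ := h
  have hlow : ∀ k : Fin 10, k.1 < 6 → a k ∈ P := fun k hk => h0 k hk ▸ ha' k
  have m {x y} := @IsPositiveCone.mul_mem F _ P hP x y
  have s {x y} := @IsPositiveCone.add_mem F _ P hP x y
  have a0 := hlow 0 (by decide)
  have a1 := hlow 1 (by decide)
  have a2 := hlow 2 (by decide)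
  have a3 := hlow 3 (by decide)
  have a4 := hlow 4 (by decide)
  have a5 := hlow 5 (by decide)
  have b6 := ha' 6
  have b7 := ha' 7
  have b8 := ha' 8
  have b9 := ha' 9
  have c0 := s (m (m b7 b8) b6) (m (m a0 a2) a4)
  have k6 : a 6 ∈ P := hP.mem_of_mul_mem b7 (hP.mem_of_mul_mem b9 (h6 ▸ s c0 (m (m b9 a0) a3)))
  have k7 : a 7 ∈ P := hP.mem_of_mul_mem b8 (hP.mem_of_mul_mem b9 (h7 ▸ s c0 (m (m b9 a2) a5)))
  have k8 : a 8 ∈ P := hP.mem_of_mul_mem b6 (hP.mem_of_mul_mem b9 (h8 ▸ s c0 (m (m b9 a4) a1)))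
  have k9 : a 9 ∈ P := by
    have hw := m (m b7 b8) b6
    have hd := m (m (m (hP.pow_two_mem b9) b7) b8) b6
    refine hP.mem_of_mul_mem hd ?_
    have he : a 9 * (a' 9 ^ 2 * a' 7 * a' 8 * a' 6) = a 9 * a' 9 ^ 2 * a' 7 * a' 8 * a' 6 := by
      ring
    rw [he, h9]
    refine s (s (hP.pow_two_mem hw) (m hw (s (s (s ?_ (m (m b9 a0) a3)) (m (m b9 a2) a5))
      (m (m b9 a4) a1)))) (m (m (s (m a0 a2) (m b9 a1)) (s (m a0 a4) (m b9 a5)))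
      (s (m a2 a4) (m b9 a3)))
    have h2 : 2 * a 0 * a 2 * a 4 = a 0 * a 2 * a 4 + a 0 * a 2 * a 4 := by ring
    rw [h2]
    exact s (m (m a0 a2) a4) (m (m a0 a2) a4)
  fin_cases i
  exacts [a0, a1, a2, a3, a4, a5, k6, k7, k8, k9]

variable {U : Set Vec} {v : Vec} {A : Label → F}

theorem IsPositiveCone.mem_of_hexahedronAt (hP : IsPositiveCone P) (h : IsCorner U v)
    (hA : ∀ l ∈ labels U, A l ∈ P) (hv : HexahedronAt A v) : ∀ l ∈ labels (insert v U), A l ∈ P := by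
  rw [labels_of_isCorner h] at hA
  rw [labels_insert h]
  rintro l (hl | ⟨i, rfl⟩)
  · exact hA l (Or.inl hl)
  · exact hP.mem_of_patchRecurrence (patchRecurrence_iff.2 hv)
      (fun j => hA _ (Or.inr ⟨j, rfl⟩)) i

/-- The value at the origin of a positive solution of the hexahedron recurrence. -/
theorem apply_zero_eq_tautSum [CharZero F] (hP : IsPositiveCone P) (hU : IsSolid U) :
    ∀ A : Label → F, (∀ l ∈ labels U, A l ∈ P) → SatisfiesRecurrence U A →
      A (.vertex 0) = ∑ᶠ m ∈ tautConfigs U, 2 ^ loopCount m * faceWeight U A m := by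
  -- Finiteness is carried along because the exchange of a patch in the sum needs it for the larger
  -- solid.
  refine (hU.induction (p := fun U => ((tautConfigs U).Finite ∧ HasFiniteExponents U) ∧
    ∀ A : Label → F, (∀ l ∈ labels U, A l ∈ P) → SatisfiesRecurrence U A →
      A (.vertex 0) = ∑ᶠ m ∈ tautConfigs U, 2 ^ loopCount m * faceWeight U A m) ?_ ?_).2
  · exact ⟨⟨by rw [tautConfigs_orthant]; exact Set.finite_singleton _, hasFiniteExponents_orthant⟩,
      fun A _ _ => (tautSum_orthant A).symm⟩
  · rintro U v hv hc ⟨⟨hfin, hexp⟩, ih⟩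
    refine ⟨⟨tautConfigs_finite_exchange infinite_initialConfig (facePatchPair hc).toPatchPair hfin,
      hasFiniteExponents_exchange infinite_initialConfig (facePatchPair hc) hexp⟩,
      fun A hA hrec => ?_⟩
    have hvrec := hrec v ⟨hv, hc.notMem⟩
    have hA' := hP.mem_of_hexahedronAt hc hA hvrec
    rw [ih A hA' fun u hu => hrec u ⟨hu.1, fun h => hu.2 (Or.inr h)⟩]
    refine tautSum_exchange infinite_initialConfig (facePatchPair hc) (fun i => hP.ne_zero ?_)
      (fun i => hP.ne_zero ?_) (patchRecurrence_iff.2 hvrec) hfin hexp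
    · exact hA' _ (by rw [labels_insert hc]; exact Or.inr ⟨i, rfl⟩)
    · exact hA _ (by rw [labels_of_isCorner hc]; exact Or.inr ⟨i, rfl⟩)

end Positive

/-! ### Existence of solutions -/

section Existence

/-- The cube for which a label is one of the four labels at its upper end. -/
def Label.cubeBelow : Label → Vec
  | .vertex w => w - (e 0 + e 1 + e 2)
  | .face Q => Q.base - e Q.normal

theorem cubeBelow_shift (v : Vec) (l : Label) : (l.shift v).cubeBelow = v + l.cubeBelow := by
  cases l <;> exact add_sub_assoc _ _ _

theorem cubeBelow_patchLabel_le (t : Bool) (v : Vec) (i : Fin 10) :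
    (patchLabel t v i).cubeBelow ≤ v := by
  have key : ∀ t i j, (innerLabel t i).cubeBelow j ≤ 0 := by decide +kernel
  rw [patchLabel, cubeBelow_shift]
  exact add_le_of_nonpos_right (key t i)

theorem cubeBelow_patchLabel_true_ne (v : Vec) (i : Fin 10) :
    (patchLabel true v i).cubeBelow ≠ v := by
  have key : ∀ i, (innerLabel true i).cubeBelow ≠ 0 := by decide +kernel
  rw [patchLabel, cubeBelow_shift]
  exact fun h => key i (add_eq_left.1 h)

theorem cubeBelow_patchLabel_false (v : Vec) {i : Fin 10} (hi : ¬ i.1 < 6) :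
    (patchLabel false v i).cubeBelow = v := by
  have key : ∀ i : Fin 10, ¬ i.1 < 6 → (innerLabel false i).cubeBelow = 0 := by decide +kernel
  rw [patchLabel, cubeBelow_shift, key i hi, add_zero]

theorem patchLabel_false_eq_true (v : Vec) {i : Fin 10} (hi : i.1 < 6) :
    patchLabel false v i = patchLabel true v i := by
  have key : ∀ i : Fin 10, i.1 < 6 → innerLabel false i = innerLabel true i := by decide +kernel
  rw [patchLabel, patchLabel, key i hi]

theorem patchLabel_injective (t : Bool) (v : Vec) : Function.Injective (patchLabel t v) := by
  intro i j h
  refine innerLabel_injective t ?_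
  simp only [patchLabel] at h
  cases hi : innerLabel t i <;> cases hj : innerLabel t j <;> rw [hi, hj] at h <;>
    simp [Label.shift, Square.shift, Square.ext_iff] at h ⊢ <;> exact h

/-- Consequently solving the recurrence, which defines values only at labels above removed cubes,
never alters the initial variables. -/
theorem cubeBelow_mem_of_mem_labels {U : Set Vec} (hU : IsLowerSet U) {l : Label}
    (hl : l ∈ labels U) : l.cubeBelow ∈ U := by
  cases l with
  | face Q => exact hl.1
  | vertex w =>
    obtain ⟨Q, hQ, hw⟩ := hl
    refine hU (fun i => ?_) hQ.1
    have hsum : ∀ i : Fin 3, (e 0 + e 1 + e 2) i = 1 := by decide +kernel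
    change w i - (e 0 + e 1 + e 2) i ≤ Q.base i - e Q.normal i
    rw [hsum]
    by_cases hi : i = Q.normal
    · rw [hi, hw.1, e_same]
    · rw [e_of_ne hi]
      rcases hw.2 i hi with h | h <;> rw [h] <;> norm_num

variable {F : Type*} [Field F] {P : Set F}

/-- The values at the labels of a cube determined by the ones at its lower end. -/
def solvePatch (a' : Fin 10 → F) (i : Fin 10) : F :=
  if i.1 < 6 then a' i
  else if i = 6 then
    (a' 7 * a' 8 * a' 6 + a' 0 * a' 2 * a' 4 + a' 9 * a' 0 * a' 3) / (a' 7 * a' 9)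
  else if i = 7 then
    (a' 7 * a' 8 * a' 6 + a' 0 * a' 2 * a' 4 + a' 9 * a' 2 * a' 5) / (a' 8 * a' 9)
  else if i = 8 then
    (a' 7 * a' 8 * a' 6 + a' 0 * a' 2 * a' 4 + a' 9 * a' 4 * a' 1) / (a' 6 * a' 9)
  else ((a' 7 * a' 8 * a' 6) ^ 2 + a' 7 * a' 8 * a' 6 *
    (2 * a' 0 * a' 2 * a' 4 + a' 9 * a' 0 * a' 3 + a' 9 * a' 2 * a' 5 + a' 9 * a' 4 * a' 1) +
    (a' 0 * a' 2 + a' 9 * a' 1) * (a' 0 * a' 4 + a' 9 * a' 5) * (a' 2 * a' 4 + a' 9 * a' 3)) /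
    (a' 9 ^ 2 * a' 7 * a' 8 * a' 6)

theorem patchRecurrence_solvePatch {a' : Fin 10 → F} (h : ∀ i, a' i ≠ 0) :
    PatchRecurrence (solvePatch a') a' := by
  have h6 := h 6
  have h7 := h 7
  have h8 := h 8
  have h9 := h 9
  have hlow : ∀ k : Fin 10, k.1 < 6 → solvePatch a' k = a' k := fun k hk => if_pos hk
  rw [PatchRecurrence, hlow 0 (by decide), hlow 1 (by decide), hlow 2 (by decide),
    hlow 3 (by decide), hlow 4 (by decide), hlow 5 (by decide)]
  refine ⟨hlow, ?_, ?_, ?_, ?_⟩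
  · change (_ / _) * _ * _ = _
    rw [mul_assoc, div_mul_cancel₀ _ (mul_ne_zero h7 h9)]
  · change (_ / _) * _ * _ = _
    rw [mul_assoc, div_mul_cancel₀ _ (mul_ne_zero h8 h9)]
  · change (_ / _) * _ * _ = _
    rw [mul_assoc, div_mul_cancel₀ _ (mul_ne_zero h6 h9)]
  · change (_ / _) * _ * _ * _ * _ = _
    rw [mul_assoc, mul_assoc, mul_assoc, ← mul_assoc (a' 7), ← mul_assoc (a' 9 ^ 2),
      ← mul_assoc (a' 9 ^ 2),
      div_mul_cancel₀ _ (mul_ne_zero (mul_ne_zero (mul_ne_zero (pow_ne_zero 2 h9) h7) h8) h6)]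

/-- Positive values on the labels of a solid extend to a solution of the recurrence. -/
theorem exists_satisfiesRecurrence (hP : IsPositiveCone P) {U : Set Vec} (hU : IsSolid U)
    (A₀ : Label → F) (hA₀ : ∀ l ∈ labels U, A₀ l ∈ P) :
    ∃ A : Label → F, (∀ l ∈ labels U, A l = A₀ l) ∧ SatisfiesRecurrence U A := by
  -- The induction needs to know exactly which values may change: those at labels for which the cube
  -- below has been removed. Agreement on the labels of `U` alone would not keep the recurrence
  -- valid at cubes already treated.
  suffices h : ∀ A₀ : Label → F, (∀ l ∈ labels U, A₀ l ∈ P) → ∃ A : Label → F,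
      (∀ l : Label, l.cubeBelow ∉ orthant \ U → A l = A₀ l) ∧ SatisfiesRecurrence U A by
    obtain ⟨A, hA, hrec⟩ := h A₀ hA₀
    exact ⟨A, fun l hl => hA l fun h => h.2 (cubeBelow_mem_of_mem_labels hU.lower hl), hrec⟩
  clear hA₀ A₀
  refine hU.induction (p := fun U => ∀ A₀ : Label → F, (∀ l ∈ labels U, A₀ l ∈ P) →
    ∃ A : Label → F, (∀ l : Label, l.cubeBelow ∉ orthant \ U → A l = A₀ l) ∧
      SatisfiesRecurrence U A) ?_ ?_
  · exact fun A₀ _ => ⟨A₀, fun _ _ => rfl, fun v hv => absurd hv.1 hv.2⟩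
  · intro U v hv hc ih A₀ hA₀
    set a' : Fin 10 → F := fun i => A₀ (patchLabel true v i) with ha'
    -- The values at the upper end of the cube `v` are overwritten by the solution of the
    -- recurrence. At the six corners of the hexagon this changes nothing.
    set A₁ : Label → F := Function.extend (patchLabel false v) (solvePatch a') A₀ with hA₁
    have hup : ∀ i, A₁ (patchLabel false v i) = solvePatch a' i := fun i =>
      (patchLabel_injective false v).extend_apply _ _ i
    have hdown : ∀ l : Label, l.cubeBelow ≠ v → A₁ l = A₀ l := by
      intro l hl
      by_cases hex : ∃ i, patchLabel false v i = l
      · obtain ⟨i, rfl⟩ := hex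
        by_cases hi : i.1 < 6
        · rw [hup, solvePatch, if_pos hi, patchLabel_false_eq_true v hi]
        · exact absurd (cubeBelow_patchLabel_false v hi) hl
      · exact Function.extend_apply' _ _ _ hex
    have hlow : ∀ i, A₁ (patchLabel true v i) = a' i := fun i =>
      hdown _ (cubeBelow_patchLabel_true_ne v i)
    have hpos' : ∀ i, a' i ∈ P := fun i =>
      hA₀ _ (by rw [labels_of_isCorner hc]; exact Or.inr ⟨i, rfl⟩)
    have hrec₁ : HexahedronAt A₁ v := by
      rw [← patchRecurrence_iff]
      simp only [hup, hlow]
      exact patchRecurrence_solvePatch fun i => hP.ne_zero (hpos' i)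
    have hpos : ∀ l ∈ labels U, A₁ l ∈ P := by
      intro l hl
      rw [hdown l fun h => hc.notMem (h ▸ cubeBelow_mem_of_mem_labels hc.lower hl)]
      exact hA₀ l hl
    obtain ⟨A, hA, hrec⟩ := ih A₁ (hP.mem_of_hexahedronAt hc hpos hrec₁)
    refine ⟨A, fun l hl => ?_, fun u hu => ?_⟩
    · rw [hA l fun h => hl ⟨h.1, fun h' => h.2 (Or.inr h')⟩,
        hdown l fun h => hl (h ▸ ⟨hv, hc.notMem⟩)]
    · by_cases huv : u = v
      · subst huv
        -- The cube below any label of `u` is `u` itself or smaller, thus in `insert u U`. Later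
        -- steps do not touch these values, and the equation at `u` survives.
        have hpatch : ∀ t i, A (patchLabel t u i) = A₁ (patchLabel t u i) := by
          intro t i
          refine hA _ fun h => h.2 ?_
          by_cases heq : (patchLabel t u i).cubeBelow = u
          · exact Or.inl heq
          · exact Or.inr (hc.mem_of_lt (cubeBelow_patchLabel_le t u i) heq)
        rw [← patchRecurrence_iff] at hrec₁ ⊢
        simpa only [hpatch] using hrec₁
      · exact hrec u ⟨hu.1, fun h => h.elim huv hu.2⟩

end Existence

/-! ### Positive cones -/

section Cones

theorem isPositiveCone_rat (K : Type*) [Field K] [CharZero K] :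
    IsPositiveCone {x : K | ∃ q : ℚ, 0 < q ∧ (q : K) = x} where
  zero_notMem := by
    rintro ⟨q, hq, h⟩
    exact hq.ne' (Rat.cast_eq_zero.1 h)
  add_mem := by
    rintro _ _ ⟨q, hq, rfl⟩ ⟨r, hr, rfl⟩
    exact ⟨q + r, add_pos hq hr, Rat.cast_add q r⟩
  mul_mem := by
    rintro _ _ ⟨q, hq, rfl⟩ ⟨r, hr, rfl⟩
    exact ⟨q * r, mul_pos hq hr, Rat.cast_mul q r⟩
  inv_mem := by
    rintro _ ⟨q, hq, rfl⟩
    exact ⟨q⁻¹, inv_pos.2 hq, Rat.cast_inv q⟩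

variable {K : Type*} [Field K]

/-- The value of a polynomial where all variables are `1` is a positive rational number. -/
def IsPositiveAtOne (f : MvPolynomial Label K) : Prop :=
  ∃ q : ℚ, 0 < q ∧ (q : K) = MvPolynomial.eval 1 f

/-- The rational functions whose value where all variables are `1` is a positive rational. -/
def positiveAtOne (K : Type*) [Field K] : Set (RatFun K) :=
  {x | ∃ f g : MvPolynomial Label K, IsPositiveAtOne f ∧ IsPositiveAtOne g ∧
    x = algebraMap _ (RatFun K) f / algebraMap _ (RatFun K) g}

theorem var_mem_positiveAtOne (l : Label) : var K l ∈ positiveAtOne K := by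
  refine ⟨MvPolynomial.X l, 1, ⟨1, one_pos, ?_⟩, ⟨1, one_pos, ?_⟩, ?_⟩
  · rw [MvPolynomial.eval_X, Rat.cast_one, Pi.one_apply]
  · rw [map_one, Rat.cast_one]
  · rw [map_one, div_one]; rfl

variable [CharZero K] {f g : MvPolynomial Label K}

theorem IsPositiveAtOne.ne_zero (hf : IsPositiveAtOne f) : f ≠ 0 := by
  rintro rfl
  refine (isPositiveCone_rat K).zero_notMem ?_
  rwa [IsPositiveAtOne, map_zero] at hf

theorem IsPositiveAtOne.add (hf : IsPositiveAtOne f) (hg : IsPositiveAtOne g) :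
    IsPositiveAtOne (f + g) := by
  rw [IsPositiveAtOne, map_add]
  exact (isPositiveCone_rat K).add_mem hf hg

theorem IsPositiveAtOne.mul (hf : IsPositiveAtOne f) (hg : IsPositiveAtOne g) :
    IsPositiveAtOne (f * g) := by
  rw [IsPositiveAtOne, map_mul]
  exact (isPositiveCone_rat K).mul_mem hf hg

/-- The condition is imposed on a numerator and a denominator, so both are nonzero polynomials, and
the usual formulas for sums, products and inverses of fractions preserve it. -/
theorem isPositiveCone_positiveAtOne (K : Type*) [Field K] [CharZero K] :
    IsPositiveCone (positiveAtOne K) := by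
  have hne : ∀ {f : MvPolynomial Label K}, IsPositiveAtOne f → algebraMap _ (RatFun K) f ≠ 0 :=
    fun hf h => hf.ne_zero ((FaithfulSMul.algebraMap_eq_zero_iff _ _).1 h)
  constructor
  · rintro ⟨f, g, hf, hg, h⟩
    exact div_ne_zero (hne hf) (hne hg) h.symm
  · rintro _ _ ⟨f, g, hf, hg, rfl⟩ ⟨f', g', hf', hg', rfl⟩
    refine ⟨f * g' + g * f', g * g', (hf.mul hg').add (hg.mul hf'), hg.mul hg', ?_⟩
    rw [div_add_div _ _ (hne hg) (hne hg'), map_add, map_mul, map_mul, map_mul]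
  · rintro _ _ ⟨f, g, hf, hg, rfl⟩ ⟨f', g', hf', hg', rfl⟩
    refine ⟨f * f', g * g', hf.mul hf', hg.mul hg', ?_⟩
    rw [div_mul_div_comm, map_mul, map_mul]
  · rintro _ ⟨f, g, hf, hg, rfl⟩
    exact ⟨g, f, hg, hf, inv_div _ _⟩

theorem faceWeight_eq_one {F : Type*} [Field F] {U : Set Vec} {A : Label → F}
    (hA : ∀ l ∈ labels U, A l = 1) (m : Sym2 Node → ℕ) : faceWeight U A m = 1 :=
  finprod_mem_eq_one_of_forall_eq_one fun l hl => by rw [hA l hl, one_zpow]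

/-- The positive rationals inside `K` serve as the cone, so no value becomes zero; all weights are
`1`. -/
theorem apply_zero_eq_of_eq_one {U : Set Vec} (hU : IsSolid U) {A : Label → K}
    (hA : ∀ l ∈ labels U, A l = 1) (hrec : SatisfiesRecurrence U A) :
    A (.vertex 0) = ∑ᶠ m ∈ tautConfigs U, 2 ^ loopCount m := by
  rw [apply_zero_eq_tautSum (isPositiveCone_rat K) hU A
    (fun l hl => ⟨1, one_pos, by rw [hA l hl, Rat.cast_one]⟩) hrec]
  simp only [faceWeight_eq_one hA, mul_one]

end Cones

/-! ### The solids cut off by planes -/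

section CornerSolid

theorem isSolid_cornerSolid (n : ℕ) : IsSolid (cornerSolid n) where
  lower := by
    intro a b hab ha
    refine ⟨fun i => (hab i).trans_lt (ha.1 i), le_trans ?_ ha.2⟩
    exact Finset.sum_le_sum fun i _ => Int.add_le_add_right (hab i) 1
  subset := fun _ hu => hu.1
  cofinite := by
    refine (Set.finite_Icc (fun _ : Fin 3 => -(n : ℤ) - 1) fun _ => 0).subset ?_
    rintro u ⟨hu, hnot⟩
    have h0 := hu 0
    have h1 := hu 1
    have h2 := hu 2
    have hs : ¬ (u 0 + 1 + (u 1 + 1) + (u 2 + 1) ≤ -(n : ℤ)) := by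
      intro h
      refine hnot ⟨hu, ?_⟩
      rwa [Fin.sum_univ_three]
    constructor <;> rw [Pi.le_def, Fin.forall_fin_succ, Fin.forall_fin_succ, Fin.forall_fin_succ] <;>
      refine ⟨?_, ?_, ?_, fun i => i.elim0⟩
    · change -(n : ℤ) - 1 ≤ u 0; omega
    · change -(n : ℤ) - 1 ≤ u 1; omega
    · change -(n : ℤ) - 1 ≤ u 2; omega
    · exact h0.le
    · exact h1.le
    · exact h2.le

theorem level_shift (v : Vec) (l : Label) : (l.shift v).level = ∑ i, v i + l.level := by
  cases l with
  | vertex w => exact Finset.sum_add_distrib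
  | face Q =>
    change ∑ i, (v i + Q.base i) + 1 = ∑ i, v i + (∑ i, Q.base i + 1)
    rw [Finset.sum_add_distrib, add_assoc]

theorem le_level_patchLabel (t : Bool) (v : Vec) (i : Fin 10) :
    ∑ i, v i ≤ (patchLabel t v i).level := by
  have key : ∀ t i, 0 ≤ (innerLabel t i).level := by decide +kernel
  rw [patchLabel, level_shift]
  exact le_add_of_nonneg_right (key t i)

/-- The right side is the level of the top corner of the cube below. For the solid cut off by a
plane it bounds the levels of all labels of the surface by `-n`. -/
theorem level_le_cubeBelow (l : Label) : l.level ≤ ∑ i, (l.cubeBelow i + 1) := by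
  have h3 : ∀ i : Fin 3, ∑ j, e i j = 1 := by decide +kernel
  have h1 : ∑ j : Fin 3, (1 : ℤ) = 3 := by decide +kernel
  cases l with
  | vertex w =>
    have : ∑ i : Fin 3, (e 0 + e 1 + e 2) i = 3 := by decide +kernel
    change ∑ i, w i ≤ ∑ i, ((w i - (e 0 + e 1 + e 2) i) + 1)
    rw [Finset.sum_add_distrib, Finset.sum_sub_distrib, this, h1]
    simp
  | face Q =>
    change ∑ i, Q.base i + 1 ≤ ∑ i, ((Q.base i - e Q.normal i) + 1)
    rw [Finset.sum_add_distrib, Finset.sum_sub_distrib, h3, h1]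
    omega

/-- Only the variables on the three uppermost levels influence the value at the origin. -/
theorem apply_zero_eq_cornerSolid {K : Type*} [Field K] [CharZero K] (n : ℕ) {A : Label → K}
    (hA : ∀ l ∈ labels (cornerSolid n), -(n : ℤ) - 2 ≤ l.level → l.level ≤ -(n : ℤ) → A l = 1)
    (hrec : SatisfiesRecurrence (cornerSolid n) A) :
    A (.vertex 0) = ∑ᶠ m ∈ tautConfigs (cornerSolid n), 2 ^ loopCount m := by
  classical
  have hU := isSolid_cornerSolid n
  -- The values below the three uppermost levels are reset to `1`, which makes `A'` equal to `1` on
  -- all labels of the surface.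
  set A' : Label → K := fun l => if -(n : ℤ) - 2 ≤ l.level then A l else 1 with hA'
  have h0 : A' (.vertex 0) = A (.vertex 0) := by
    refine if_pos ?_
    have : (Label.vertex 0).level = 0 := by decide +kernel
    rw [this]
    omega
  rw [← h0]
  refine apply_zero_eq_of_eq_one hU (fun l hl => ?_) fun v hv => ?_
  · by_cases h : -(n : ℤ) - 2 ≤ l.level
    · have h1 := (cubeBelow_mem_of_mem_labels hU.lower hl).2
      refine (if_pos h).trans ?_
      exact hA l hl h ((level_le_cubeBelow l).trans h1)
    · exact if_neg h
  -- The top corner of a removed cube has level at least `-n + 1`, and its lowest corner is three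
  -- levels below. So all labels of the cube are in the range where `A'` equals `A`.
  · have hlev : -(n : ℤ) - 2 ≤ ∑ i, v i := by
      by_contra hcon
      refine hv.2 ⟨hv.1, ?_⟩
      have h1 : ∑ j : Fin 3, (1 : ℤ) = 3 := by decide +kernel
      rw [Finset.sum_add_distrib, h1]
      omega
    have hpatch : ∀ t i, A' (patchLabel t v i) = A (patchLabel t v i) := fun t i =>
      if_pos (hlev.trans (le_level_patchLabel t v i))
    have := patchRecurrence_iff.2 (hrec v hv)
    rw [← patchRecurrence_iff]
    simpa only [hpatch] using this

end CornerSolid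

end Hexahedron
end

theorem theorem4p1 {K : Type*} [Field K] [CharZero K] :
    (∀ U : Set Hexahedron.Vec, Hexahedron.IsSolid U →
      -- the sum, the loop numbers and the products below are finite
      (Hexahedron.tautConfigs U).Finite ∧
      (∀ m ∈ Hexahedron.tautConfigs U, (Hexahedron.loops m).Finite ∧
        {l | l ∈ Hexahedron.labels U ∧ Hexahedron.faceExponent U m l ≠ 0}.Finite) ∧
      -- the representation of `A(0,0,0)` exists, and is given by the formula
      (∃ A : Hexahedron.Label → Hexahedron.RatFun K, Hexahedron.IsRepresentation U A) ∧
      (∀ A : Hexahedron.Label → Hexahedron.RatFun K, Hexahedron.IsRepresentation U A →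
        A (.vertex 0) = ∑ᶠ m ∈ Hexahedron.tautConfigs U,
          2 ^ Hexahedron.loopCount m *
            ∏ᶠ l ∈ Hexahedron.labels U, Hexahedron.var K l ^ Hexahedron.faceExponent U m l) ∧
      -- all initial variables equal to `1`
      (∀ A : Hexahedron.Label → K, (∀ l ∈ Hexahedron.labels U, A l = 1) →
        Hexahedron.SatisfiesRecurrence U A →
        A (.vertex 0) = ∑ᶠ m ∈ Hexahedron.tautConfigs U, 2 ^ Hexahedron.loopCount m)) ∧
    -- the solids cut off by the planes `x + y + z = -n`
    (∀ n : ℕ, ∀ A : Hexahedron.Label → K,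
      (∀ l ∈ Hexahedron.labels (Hexahedron.cornerSolid n),
        -(n : ℤ) - 2 ≤ l.level → l.level ≤ -(n : ℤ) → A l = 1) →
      Hexahedron.SatisfiesRecurrence (Hexahedron.cornerSolid n) A →
      A (.vertex 0) =
        ∑ᶠ m ∈ Hexahedron.tautConfigs (Hexahedron.cornerSolid n), 2 ^ Hexahedron.loopCount m) := by
  have : CharZero (Hexahedron.RatFun K) :=
    charZero_of_injective_algebraMap (FaithfulSMul.algebraMap_injective
      (MvPolynomial Hexahedron.Label K) (Hexahedron.RatFun K))
  -- This cone contains all variables, so it serves both for the existence of the representation and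
  -- for the formula satisfied by every representation.
  have hP := Hexahedron.isPositiveCone_positiveAtOne K
  refine ⟨fun U hU => ⟨Hexahedron.tautConfigs_finite hU, fun m hm =>
    ⟨Hexahedron.IsTaut.loops_finite Hexahedron.infinite_initialConfig hm,
      Hexahedron.hasFiniteExponents hU m hm⟩, ?_, fun A hA => ?_,
    fun A hA hrec => Hexahedron.apply_zero_eq_of_eq_one hU hA hrec⟩,
    fun n A hA hrec => Hexahedron.apply_zero_eq_cornerSolid n hA hrec⟩
  · exact Hexahedron.exists_satisfiesRecurrence hP hU (Hexahedron.var K)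
      fun l _ => Hexahedron.var_mem_positiveAtOne l
  · rw [Hexahedron.apply_zero_eq_tautSum hP hU A
      (fun l hl => hA.1 l hl ▸ Hexahedron.var_mem_positiveAtOne l) hA.2]
    refine finsum_mem_congr rfl fun m _ => ?_
    rw [Hexahedron.faceWeight]
    congr 1
    exact finprod_mem_congr rfl fun l hl => by rw [hA.1 l hl]
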